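/- Let $\Bbbk$ be a commutative ring and let $t \in \Bbbk$. **The partition category.** $\mathcal{P}ar(t)$ is the strict $\Bbbk$-linear monoidal category whose objects are the natural numbers and in which $\mathrm{Hom}(m,\ell)$ is the free $\Bbbk$-module on the set partitions of a disjoint union of a bottom row of $m$ and a top row of $\ell$ vertices. The composite of $D \colon m \to \ell$ followed by $D' \colon \ell \to k$ is $t^{\alpha}\, E$. Here $D'$ is stacked on top of $D$ and the middle rows are identified; $\alpha$ is the number of connected components of the stack that contain only middle vertices; and $E$ is the partition of the remaining vertices into the connected components of the stack. Composition is extended bilinearly. The tensor product is addition on objects and horizontal juxtaposition on partitions. Let $\mu \colon 2 \to 1$, $\Delta \colon 1 \to 2$, $\eta \colon 0 \to 1$, $\varepsilon \colon 1 \to 0$ be given by the partitions with one block, and let $s \colon 2 \to 2$ be given by the partition that joins each bottom vertex with the opposite top vertex. **The Heisenberg category.** Write $f ; g$ for "$f$ followed by $g$". $\mathcal{H}eis$ is the strict $\Bbbk$-linear monoidal category generated by objects $\uparrow, \downarrow$ and morphisms $x \colon {\uparrow\uparrow} \to {\uparrow\uparrow}$, $c \colon \mathbf 1 \to {\downarrow\uparrow}$,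 $d \colon {\uparrow\downarrow} \to \mathbf 1$, $c' \colon \mathbf 1 \to {\uparrow\downarrow}$, $d' \colon {\downarrow\uparrow} \to \mathbf 1$ (crossing, right cup, right cap, left cup, left cap), subject to the following relations. * $x ; x = 1$ and $(x \otimes 1_\uparrow);(1_\uparrow \otimes x);(x \otimes 1_\uparrow) = (1_\uparrow \otimes x);(x \otimes 1_\uparrow);(1_\uparrow \otimes x)$. * $(1_\uparrow \otimes c);(d \otimes 1_\uparrow) = 1_\uparrow$, $(c \otimes 1_\downarrow);(1_\downarrow \otimes d) = 1_\downarrow$, $(c' \otimes 1_\uparrow);(1_\uparrow \otimes d') = 1_\uparrow$, $(1_\downarrow \otimes c');(d' \otimes 1_\downarrow) = 1_\downarrow$. * $r ; l = 1_{\uparrow\downarrow}$, $\ l ; r = 1_{\downarrow\uparrow} - d' ; c$, $\ (c \otimes 1_\uparrow);(1_\downarrow \otimes x);(d' \otimes 1_\uparrow) = 0$, $\ c ; d' = 1_{\mathbf 1}$, where $l = (1_{\downarrow\uparrow} \otimes c');(1_\downarrow \otimes x \otimes 1_\downarrow);(d' \otimes 1_{\uparrow\downarrow}) \colon {\downarrow\uparrow}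 \to {\uparrow\downarrow}$ and $r = (c \otimes 1_{\uparrow\downarrow});(1_\downarrow \otimes x \otimes 1_\downarrow);(1_{\downarrow\uparrow} \otimes d) \colon {\uparrow\downarrow} \to {\downarrow\uparrow}$ are the left and right crossings. The downward crossing is $y = (1_{\downarrow\downarrow} \otimes c');(1_\downarrow \otimes l \otimes 1_\downarrow);(d' \otimes 1_{\downarrow\downarrow}) \colon {\downarrow\downarrow} \to {\downarrow\downarrow}$. The clockwise bubble is $c' ; d \in \mathrm{End}(\mathbf 1)$. **The category $\mathcal{P}eis(t)$.** Let $\mathcal{P}eis$ be the full $\Bbbk$-linear monoidal subcategory of $\mathcal{H}eis$ whose objects are the powers $(\uparrow\downarrow)^k$, $k \in \mathbb N$. Let $\mathcal{P}eis(t)$ be the quotient of $\mathcal{P}eis$ by the tensor ideal of $\mathcal{P}eis$ generated by $c' ; d - t\, 1_{\mathbf 1}$. **Theorem.** There is a strict $\Bbbk$-linear monoidal functor $\Psi_t \colon \mathcal{P}ar(t) \to \mathcal{P}eis(t)$ with $\Psi_t(k) = (\uparrow\downarrow)^k$ for all $k$ and $$\mu \mapsto 1_\uparrow \otimes d' \otimes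 1_\downarrow, \qquad \Delta \mapsto 1_\uparrow \otimes c \otimes 1_\downarrow, \qquad \eta \mapsto c', \qquad \varepsilon \mapsto d,$$ $$s \mapsto (1_\uparrow \otimes l \otimes 1_\downarrow);(x \otimes y);(1_\uparrow \otimes r \otimes 1_\downarrow) \;+\; (1_\uparrow \otimes d' \otimes 1_\downarrow);(1_\uparrow \otimes c \otimes 1_\downarrow).$$ Moreover $X = {\uparrow\downarrow}$ with these images, again denoted $\mu, \Delta, s, \eta, \varepsilon$, is a $t$-dimensional special commutative Frobenius object in $\mathcal{P}eis(t)$, with $s$ in the role of the symmetry. That is, the following relations hold (with $1 = 1_X$). * Frobenius object: $(\eta \otimes 1);\mu = 1 = (1 \otimes \eta);\mu$, $\ \Delta;(\varepsilon \otimes 1) = 1 = \Delta;(1 \otimes \varepsilon)$, $\ (1 \otimes \Delta);(\mu \otimes 1) = \mu;\Delta = (\Delta \otimes 1);(1 \otimes \mu)$. * Symmetry: $s;s = 1_{X \otimes X}$, $\ (s \otimes 1);(1 \otimes s);(s \otimes 1) = (1 \otimes s);(s \otimes 1);(1 \otimes s)$, $\ (1 \otimes \eta);s = \eta \otimes 1$,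 $\ (1 \otimes s);(s \otimes 1);(1 \otimes \mu) = (\mu \otimes 1);s$, $\ s;(1 \otimes \varepsilon) = \varepsilon \otimes 1$, $\ (1 \otimes \Delta);(s \otimes 1);(1 \otimes s) = s;(\Delta \otimes 1)$. * Commutative, special, of dimension $t$: $s;\mu = \mu$, $\ \Delta;\mu = 1$, $\ \eta;\varepsilon = t\, 1_{\mathbf 1}$. -/

import Mathlib

open CategoryTheory MonoidalCategory

universe v u

/-! ### Strict monoidal categories and strict linear monoidal functors -/

/-- A monoidal category is strict when the tensor product is strictly associative and unital on
objects and all associators and unitors are identities (transported along these equalities). -/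
class IsStrictMonoidal (C : Type*) [Category* C] [MonoidalCategory C] : Prop where
  tensor_assoc (X Y Z : C) : (X ⊗ Y) ⊗ Z = X ⊗ (Y ⊗ Z)
  unit_tensor (X : C) : 𝟙_ C ⊗ X = X
  tensor_unit (X : C) : X ⊗ 𝟙_ C = X
  associator_hom (X Y Z : C) : (α_ X Y Z).hom = eqToHom (tensor_assoc X Y Z)
  leftUnitor_hom (X : C) : (λ_ X).hom = eqToHom (unit_tensor X)
  rightUnitor_hom (X : C) : (ρ_ X).hom = eqToHom (tensor_unit X)

/-- A strict `R`-linear monoidal functor between strict `R`-linear monoidal categories: an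
`R`-linear functor that preserves the unit object and tensor products of objects and of morphisms
on the nose. -/
structure StrictLinearMonoidalFunctor (R : Type*) [CommRing R]
    (C D : Type*) [Category* C] [Preadditive C] [Linear R C] [MonoidalCategory C]
    [IsStrictMonoidal C]
    [Category* D] [Preadditive D] [Linear R D] [MonoidalCategory D] [IsStrictMonoidal D]
    extends C ⥤ D where
  map_add {X Y : C} (f g : X ⟶ Y) : map (f + g) = map f + map g
  map_smul {X Y : C} (r : R) (f : X ⟶ Y) : map (r • f) = r • map f
  obj_unit : obj (𝟙_ C) = 𝟙_ D
  obj_tensor (X Y : C) : obj (X ⊗ Y) = obj X ⊗ obj Y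
  map_tensor {X X' Y Y' : C} (f : X ⟶ Y) (g : X' ⟶ Y') :
    map (f ⊗ₘ g) = eqToHom (obj_tensor X X') ≫ (map f ⊗ₘ map g) ≫ eqToHom (obj_tensor Y Y').symm

/-- The tensor powers `X ^ k` of an object. -/
def tensorPow {C : Type*} [Category* C] [MonoidalCategory C] (X : C) : ℕ → C
  | 0 => 𝟙_ C
  | k + 1 => tensorPow X k ⊗ X

/-- The monoidal structure determined by strict data: a tensor product on objects that is
associative and unital up to equality, and a compatible functorial tensor product on morphisms. -/
@[reducible]
def strictMonoidalCategory {C : Type u} [Category.{v} C]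
    (tobj : C → C → C) (one : C)
    (thom : ∀ {X Y X' Y' : C}, (X ⟶ Y) → (X' ⟶ Y') → (tobj X X' ⟶ tobj Y Y'))
    (assoc : ∀ X Y Z, tobj (tobj X Y) Z = tobj X (tobj Y Z))
    (one_t : ∀ X, tobj one X = X) (t_one : ∀ X, tobj X one = X)
    (thom_id : ∀ X Y, thom (𝟙 X) (𝟙 Y) = 𝟙 (tobj X Y))
    (thom_comp : ∀ {X Y Z X' Y' Z' : C} (f : X ⟶ Y) (f' : X' ⟶ Y') (g : Y ⟶ Z) (g' : Y' ⟶ Z'),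
      thom f f' ≫ thom g g' = thom (f ≫ g) (f' ≫ g'))
    (thom_assoc : ∀ {X Y X' Y' X'' Y'' : C} (f : X ⟶ Y) (f' : X' ⟶ Y') (f'' : X'' ⟶ Y''),
      thom (thom f f') f'' ≫ eqToHom (assoc Y Y' Y'') =
        eqToHom (assoc X X' X'') ≫ thom f (thom f' f''))
    (one_thom : ∀ {X Y : C} (f : X ⟶ Y), thom (𝟙 one) f ≫ eqToHom (one_t Y) =
      eqToHom (one_t X) ≫ f)
    (thom_one : ∀ {X Y : C} (f : X ⟶ Y), thom f (𝟙 one) ≫ eqToHom (t_one Y) =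
      eqToHom (t_one X) ≫ f) :
    MonoidalCategory C :=
  letI : MonoidalCategoryStruct C :=
    { tensorObj := tobj
      tensorUnit := one
      whiskerLeft := fun X _ _ f => thom (𝟙 X) f
      whiskerRight := fun f Y => thom f (𝟙 Y)
      tensorHom := thom
      associator := fun X Y Z => eqToIso (assoc X Y Z)
      leftUnitor := fun X => eqToIso (one_t X)
      rightUnitor := fun X => eqToIso (t_one X) }
  have hr : ∀ {X Y : C} (h : X = Y) (Z : C),
      thom (eqToHom h) (𝟙 Z) = eqToHom (by rw [h]) := by
    rintro X _ rfl Z; exact thom_id _ _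
  have hl : ∀ {X Y : C} (h : X = Y) (Z : C),
      thom (𝟙 Z) (eqToHom h) = eqToHom (by rw [h]) := by
    rintro X _ rfl Z; exact thom_id _ _
  MonoidalCategory.ofTensorHom
    (id_tensorHom_id := thom_id)
    (id_tensorHom := fun _ _ _ _ => rfl)
    (tensorHom_id := fun _ _ => rfl)
    (tensorHom_comp_tensorHom := thom_comp)
    (associator_naturality := thom_assoc)
    (leftUnitor_naturality := one_thom)
    (rightUnitor_naturality := thom_one)
    (pentagon := fun W X Y Z => by
      change thom (eqToHom (assoc W X Y)) (𝟙 Z) ≫ eqToHom (assoc W (tobj X Y) Z) ≫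
        thom (𝟙 W) (eqToHom (assoc X Y Z)) =
          eqToHom (assoc (tobj W X) Y Z) ≫ eqToHom (assoc W X (tobj Y Z))
      rw [hr, hl]; simp)
    (triangle := fun X Y => by
      change eqToHom (assoc X one Y) ≫ thom (𝟙 X) (eqToHom (one_t Y)) =
        thom (eqToHom (t_one X)) (𝟙 Y)
      rw [hr, hl]; simp)

/-! ### The Heisenberg category -/

/-- The two generating objects `↑` and `↓`. -/
inductive Strand
  | up
  | down

/-- Formal morphisms between words in `↑` and `↓`.  `f.comp g` is `f` followed by `g` (so `g` is
stacked on top of `f`), and `f.tensor g` is `f` placed to the left of `g`. -/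
inductive HeisTerm (𝕜 : Type u) : List Strand → List Strand → Type u
  /-- the upward crossing `↑↑ → ↑↑` -/
  | cross : HeisTerm 𝕜 [.up, .up] [.up, .up]
  /-- the right cup `1 → ↓↑` -/
  | cupR : HeisTerm 𝕜 [] [.down, .up]
  /-- the right cap `↑↓ → 1` -/
  | capR : HeisTerm 𝕜 [.up, .down] []
  /-- the left cup `1 → ↑↓` -/
  | cupL : HeisTerm 𝕜 [] [.up, .down]
  /-- the left cap `↓↑ → 1` -/
  | capL : HeisTerm 𝕜 [.down, .up] []
  | id (a : List Strand) : HeisTerm 𝕜 a a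
  | comp {a b c : List Strand} (f : HeisTerm 𝕜 a b) (g : HeisTerm 𝕜 b c) : HeisTerm 𝕜 a c
  | tensor {a b c d : List Strand} (f : HeisTerm 𝕜 a b) (g : HeisTerm 𝕜 c d) :
      HeisTerm 𝕜 (a ++ c) (b ++ d)
  | zero (a b : List Strand) : HeisTerm 𝕜 a b
  | add {a b : List Strand} (f g : HeisTerm 𝕜 a b) : HeisTerm 𝕜 a b
  | smul {a b : List Strand} (r : 𝕜) (f : HeisTerm 𝕜 a b) : HeisTerm 𝕜 a b

namespace HeisTerm

open Strand

variable {𝕜 : Type u}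

/-- The identity morphism, transported along an equality of words. -/
def ofEq {a b : List Strand} (h : a = b) : HeisTerm 𝕜 a b := h ▸ id a

/-- The identity morphism of `↑`. -/
abbrev idUp : HeisTerm 𝕜 [up] [up] := id [up]

/-- The identity morphism of `↓`. -/
abbrev idDown : HeisTerm 𝕜 [down] [down] := id [down]

/-- The crossing of the first two of three upward strands. -/
def crossId : HeisTerm 𝕜 [up, up, up] [up, up, up] := tensor cross idUp

/-- The crossing of the last two of three upward strands. -/
def idCross : HeisTerm 𝕜 [up, up, up] [up, up, up] := tensor idUp cross

/-- The left crossing `↓↑ → ↑↓`. -/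
def crossL : HeisTerm 𝕜 [down, up] [up, down] :=
  comp (b := [down, up, up, down]) (tensor (id [down, up]) cupL)
    (comp (b := [down, up, up, down]) (tensor idDown (tensor cross idDown))
      (tensor capL (id [up, down])))

/-- The right crossing `↑↓ → ↓↑`. -/
def crossR : HeisTerm 𝕜 [up, down] [down, up] :=
  comp (b := [down, up, up, down]) (tensor cupR (id [up, down]))
    (comp (b := [down, up, up, down]) (tensor idDown (tensor cross idDown))
      (tensor (id [down, up]) capR))

/-- The downward crossing `↓↓ → ↓↓`. -/
def crossDown : HeisTerm 𝕜 [down, down] [down, down] :=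
  comp (b := [down, down, up, down]) (tensor (id [down, down]) cupL)
    (comp (b := [down, up, down, down]) (tensor idDown (tensor crossL idDown))
      (tensor capL (id [down, down])))

/-- The clockwise bubble. -/
def bubble : HeisTerm 𝕜 [] [] := comp cupL capR

/-- The diagram `↑ capL ↓`. -/
def mulTerm : HeisTerm 𝕜 [up, down, up, down] [up, down] := tensor idUp (tensor capL idDown)

/-- The diagram `↑ cupR ↓`. -/
def comulTerm : HeisTerm 𝕜 [up, down] [up, down, up, down] := tensor idUp (tensor cupR idDown)

/-- The four strands of `↑↓↑↓` interchanged in pairs, plus `mulTerm` followed by `comulTerm`. -/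
def swapTerm : HeisTerm 𝕜 [up, down, up, down] [up, down, up, down] :=
  add
    (comp (b := [up, up, down, down]) (tensor idUp (tensor crossL idDown))
      (comp (b := [up, up, down, down]) (tensor cross crossDown)
        (tensor idUp (tensor crossR idDown))))
    (comp mulTerm comulTerm)

end HeisTerm

open HeisTerm in
/-- The relations of the Heisenberg category: the smallest relation that contains the defining
relations together with the axioms of a strict `𝕜`-linear monoidal category. -/
inductive HeisRel (𝕜 : Type u) [CommRing 𝕜] :
    ∀ {a b : List Strand}, HeisTerm 𝕜 a b → HeisTerm 𝕜 a b → Prop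
  -- the symmetric group relations for upward crossings
  | cross_cross : HeisRel 𝕜 (comp cross cross) (id [.up, .up])
  | braid : HeisRel 𝕜 (comp crossId (comp idCross crossId)) (comp idCross (comp crossId idCross))
  -- isotopy invariance: `↓` is right dual to `↑`
  | zigzag_right_up : HeisRel 𝕜
      (comp (b := [.up, .down, .up]) (tensor idUp cupR) (tensor capR idUp)) idUp
  | zigzag_right_down : HeisRel 𝕜
      (comp (b := [.down, .up, .down]) (tensor cupR idDown) (tensor idDown capR)) idDown
  -- isotopy invariance: `↓` is left dual to `↑`
  | zigzag_left_up : HeisRel 𝕜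
      (comp (b := [.up, .down, .up]) (tensor cupL idUp) (tensor idUp capL)) idUp
  | zigzag_left_down : HeisRel 𝕜
      (comp (b := [.down, .up, .down]) (tensor idDown cupL) (tensor capL idDown)) idDown
  -- the inversion relations, the left curl, and the counterclockwise bubble
  | crossR_crossL : HeisRel 𝕜 (comp crossR crossL) (id [.up, .down])
  | crossL_crossR : HeisRel 𝕜 (comp crossL crossR)
      (add (id [.down, .up]) (smul (-1) (comp capL cupR)))
  | left_curl : HeisRel 𝕜
      (comp (b := [.down, .up, .up]) (tensor cupR idUp)
        (comp (b := [.down, .up, .up]) (tensor idDown cross) (tensor capL idUp)))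
      (zero [.up] [.up])
  | ccw_bubble : HeisRel 𝕜 (comp cupR capL) (id [])
  -- congruence
  | refl {a b} (f : HeisTerm 𝕜 a b) : HeisRel 𝕜 f f
  | symm {a b} {f g : HeisTerm 𝕜 a b} : HeisRel 𝕜 f g → HeisRel 𝕜 g f
  | trans {a b} {f g h : HeisTerm 𝕜 a b} : HeisRel 𝕜 f g → HeisRel 𝕜 g h → HeisRel 𝕜 f h
  | comp_congr {a b c} {f f' : HeisTerm 𝕜 a b} {g g' : HeisTerm 𝕜 b c} :
      HeisRel 𝕜 f f' → HeisRel 𝕜 g g' → HeisRel 𝕜 (comp f g) (comp f' g')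
  | tensor_congr {a b c d} {f f' : HeisTerm 𝕜 a b} {g g' : HeisTerm 𝕜 c d} :
      HeisRel 𝕜 f f' → HeisRel 𝕜 g g' → HeisRel 𝕜 (tensor f g) (tensor f' g')
  | add_congr {a b} {f f' g g' : HeisTerm 𝕜 a b} :
      HeisRel 𝕜 f f' → HeisRel 𝕜 g g' → HeisRel 𝕜 (add f g) (add f' g')
  | smul_congr {a b} (r : 𝕜) {f f' : HeisTerm 𝕜 a b} :
      HeisRel 𝕜 f f' → HeisRel 𝕜 (smul r f) (smul r f')
  -- category axioms
  | id_comp {a b} (f : HeisTerm 𝕜 a b) : HeisRel 𝕜 (comp (id a) f) f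
  | comp_id {a b} (f : HeisTerm 𝕜 a b) : HeisRel 𝕜 (comp f (id b)) f
  | comp_assoc {a b c d} (f : HeisTerm 𝕜 a b) (g : HeisTerm 𝕜 b c) (h : HeisTerm 𝕜 c d) :
      HeisRel 𝕜 (comp (comp f g) h) (comp f (comp g h))
  -- strict monoidal category axioms
  | tensor_id (a b) :
      HeisRel 𝕜 (HeisTerm.tensor (HeisTerm.id a) (HeisTerm.id b)) (HeisTerm.id (a ++ b))
  | interchange {a b c a' b' c'} (f : HeisTerm 𝕜 a b) (f' : HeisTerm 𝕜 a' b')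
      (g : HeisTerm 𝕜 b c) (g' : HeisTerm 𝕜 b' c') :
      HeisRel 𝕜 (comp (tensor f f') (tensor g g')) (tensor (comp f g) (comp f' g'))
  | tensor_assoc {a b a' b' a'' b''} (f : HeisTerm 𝕜 a b) (f' : HeisTerm 𝕜 a' b')
      (f'' : HeisTerm 𝕜 a'' b'') :
      HeisRel 𝕜 (comp (tensor (tensor f f') f'') (ofEq (List.append_assoc b b' b'')))
        (comp (ofEq (List.append_assoc a a' a'')) (tensor f (tensor f' f'')))
  | unit_tensor {a b} (f : HeisTerm 𝕜 a b) : HeisRel 𝕜 (tensor (id []) f) f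
  | tensor_unit {a b} (f : HeisTerm 𝕜 a b) :
      HeisRel 𝕜 (comp (tensor f (id [])) (ofEq (List.append_nil b)))
        (comp (ofEq (List.append_nil a)) f)
  -- module axioms
  | add_comm {a b} (f g : HeisTerm 𝕜 a b) : HeisRel 𝕜 (add f g) (add g f)
  | add_assoc {a b} (f g h : HeisTerm 𝕜 a b) :
      HeisRel 𝕜 (add (add f g) h) (add f (add g h))
  | zero_add {a b} (f : HeisTerm 𝕜 a b) : HeisRel 𝕜 (add (zero a b) f) f
  | zero_smul {a b} (f : HeisTerm 𝕜 a b) : HeisRel 𝕜 (smul 0 f) (zero a b)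
  | one_smul {a b} (f : HeisTerm 𝕜 a b) : HeisRel 𝕜 (smul 1 f) f
  | mul_smul {a b} (r s : 𝕜) (f : HeisTerm 𝕜 a b) :
      HeisRel 𝕜 (smul (r * s) f) (smul r (smul s f))
  | add_smul {a b} (r s : 𝕜) (f : HeisTerm 𝕜 a b) :
      HeisRel 𝕜 (smul (r + s) f) (add (smul r f) (smul s f))
  | smul_add {a b} (r : 𝕜) (f g : HeisTerm 𝕜 a b) :
      HeisRel 𝕜 (smul r (add f g)) (add (smul r f) (smul r g))
  -- bilinearity of composition and of the tensor product
  | add_comp {a b c} (f g : HeisTerm 𝕜 a b) (h : HeisTerm 𝕜 b c) :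
      HeisRel 𝕜 (comp (add f g) h) (add (comp f h) (comp g h))
  | comp_add {a b c} (f : HeisTerm 𝕜 a b) (g h : HeisTerm 𝕜 b c) :
      HeisRel 𝕜 (comp f (add g h)) (add (comp f g) (comp f h))
  | smul_comp {a b c} (r : 𝕜) (f : HeisTerm 𝕜 a b) (g : HeisTerm 𝕜 b c) :
      HeisRel 𝕜 (comp (smul r f) g) (smul r (comp f g))
  | comp_smul {a b c} (r : 𝕜) (f : HeisTerm 𝕜 a b) (g : HeisTerm 𝕜 b c) :
      HeisRel 𝕜 (comp f (smul r g)) (smul r (comp f g))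
  | add_tensor {a b c d} (f g : HeisTerm 𝕜 a b) (h : HeisTerm 𝕜 c d) :
      HeisRel 𝕜 (tensor (add f g) h) (add (tensor f h) (tensor g h))
  | tensor_add {a b c d} (f : HeisTerm 𝕜 a b) (g h : HeisTerm 𝕜 c d) :
      HeisRel 𝕜 (tensor f (add g h)) (add (tensor f g) (tensor f h))
  | smul_tensor {a b c d} (r : 𝕜) (f : HeisTerm 𝕜 a b) (g : HeisTerm 𝕜 c d) :
      HeisRel 𝕜 (tensor (smul r f) g) (smul r (tensor f g))
  | tensor_smul {a b c d} (r : 𝕜) (f : HeisTerm 𝕜 a b) (g : HeisTerm 𝕜 c d) :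
      HeisRel 𝕜 (tensor f (smul r g)) (smul r (tensor f g))

/-- The Heisenberg category: objects are words in `↑` and `↓`. -/
structure Heis (𝕜 : Type u) [CommRing 𝕜] where
  /-- the underlying word -/
  word : List Strand

namespace Heis

variable (𝕜 : Type u) [CommRing 𝕜]

/-- Two formal morphisms are identified when they are related by the relations. -/
@[reducible]
def homSetoid (a b : List Strand) : Setoid (HeisTerm 𝕜 a b) where
  r := HeisRel 𝕜
  iseqv := ⟨HeisRel.refl, HeisRel.symm, HeisRel.trans⟩

/-- The morphisms of the Heisenberg category: formal morphisms modulo the relations. -/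
def Hom (a b : List Strand) : Type u := Quotient (homSetoid 𝕜 a b)

variable {𝕜}

/-- The class of a formal morphism. -/
def cls {a b : List Strand} (f : HeisTerm 𝕜 a b) : Hom 𝕜 a b := Quotient.mk (homSetoid 𝕜 a b) f

theorem cls_eq {a b : List Strand} {f g : HeisTerm 𝕜 a b} (h : HeisRel 𝕜 f g) :
    cls f = cls g := Quotient.sound h

theorem cls_surj {a b : List Strand} (f : Hom 𝕜 a b) : ∃ x, cls x = f := Quotient.exists_rep f

instance (a b : List Strand) : Zero (Hom 𝕜 a b) := ⟨cls (.zero a b)⟩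

instance (a b : List Strand) : Add (Hom 𝕜 a b) :=
  ⟨Quotient.map₂ HeisTerm.add fun _ _ h _ _ h' => .add_congr h h'⟩

instance (a b : List Strand) : SMul 𝕜 (Hom 𝕜 a b) :=
  ⟨fun r => Quotient.map (HeisTerm.smul r) fun _ _ h => .smul_congr r h⟩

instance (a b : List Strand) : AddCommMonoid (Hom 𝕜 a b) where
  add_assoc := by
    rintro ⟨x⟩ ⟨y⟩ ⟨z⟩; exact cls_eq (.add_assoc x y z)
  add_comm := by
    rintro ⟨x⟩ ⟨y⟩; exact cls_eq (.add_comm x y)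
  zero_add := by
    rintro ⟨x⟩; exact cls_eq (.zero_add x)
  add_zero := by
    rintro ⟨x⟩; exact cls_eq (.trans (.add_comm _ _) (.zero_add x))
  nsmul := nsmulRec

instance homModule (a b : List Strand) : Module 𝕜 (Hom 𝕜 a b) where
  one_smul := by
    rintro ⟨x⟩; exact cls_eq (.one_smul x)
  mul_smul := by
    rintro r s ⟨x⟩; exact cls_eq (.mul_smul r s x)
  smul_zero := fun r => cls_eq (f := .smul r (.zero a b)) (g := .zero a b) <|
    .trans (.smul_congr r (.symm (.zero_smul (.zero a b)))) <|
      .trans (.symm (.mul_smul r 0 _)) (by rw [mul_zero]; exact .zero_smul _)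
  smul_add := by
    rintro r ⟨x⟩ ⟨y⟩; exact cls_eq (.smul_add r x y)
  add_smul := by
    rintro r s ⟨x⟩; exact cls_eq (.add_smul r s x)
  zero_smul := by
    rintro ⟨x⟩; exact cls_eq (.zero_smul x)

instance homGroup (a b : List Strand) : AddCommGroup (Hom 𝕜 a b) :=
  Module.addCommMonoidToAddCommGroup 𝕜

/-- Composition in the Heisenberg category. -/
def comp {a b c : List Strand} : Hom 𝕜 a b → Hom 𝕜 b c → Hom 𝕜 a c :=
  Quotient.map₂ HeisTerm.comp fun _ _ h _ _ h' => .comp_congr h h'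

/-- The tensor product of morphisms in the Heisenberg category. -/
def tensor {a b c d : List Strand} : Hom 𝕜 a b → Hom 𝕜 c d → Hom 𝕜 (a ++ c) (b ++ d) :=
  Quotient.map₂ HeisTerm.tensor fun _ _ h _ _ h' => .tensor_congr h h'

instance : Category (Heis 𝕜) where
  Hom X Y := Hom 𝕜 X.word Y.word
  id X := cls (.id X.word)
  comp := comp
  id_comp := by
    rintro X Y ⟨f⟩; exact cls_eq (.id_comp f)
  comp_id := by
    rintro X Y ⟨f⟩; exact cls_eq (.comp_id f)
  assoc := by
    rintro X Y Z W ⟨f⟩ ⟨g⟩ ⟨h⟩; exact cls_eq (.comp_assoc f g h)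

instance : Preadditive (Heis 𝕜) where
  homGroup X Y := homGroup X.word Y.word
  add_comp := by
    rintro X Y Z ⟨f⟩ ⟨g⟩ ⟨h⟩; exact cls_eq (.add_comp f g h)
  comp_add := by
    rintro X Y Z ⟨f⟩ ⟨g⟩ ⟨h⟩; exact cls_eq (.comp_add f g h)

instance : Linear 𝕜 (Heis 𝕜) where
  homModule X Y := homModule X.word Y.word
  smul_comp := by
    rintro X Y Z r ⟨f⟩ ⟨g⟩; exact cls_eq (.smul_comp r f g)
  comp_smul := by
    rintro X Y Z ⟨f⟩ r ⟨g⟩; exact cls_eq (.comp_smul r f g)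

/-- The morphism of the Heisenberg category represented by a formal morphism. -/
def ofTerm {a b : List Strand} (f : HeisTerm 𝕜 a b) : (⟨a⟩ : Heis 𝕜) ⟶ ⟨b⟩ := cls f

theorem ofTerm_ofEq {a b : List Strand} (h : a = b) :
    ofTerm (𝕜 := 𝕜) (.ofEq h) = eqToHom (by rw [h]) := by
  subst h; rfl

instance : MonoidalCategory (Heis 𝕜) :=
  strictMonoidalCategory (fun X Y => ⟨X.word ++ Y.word⟩) ⟨[]⟩ (fun f g => tensor f g)
    (fun X Y Z => congrArg Heis.mk (List.append_assoc X.word Y.word Z.word))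
    (fun _ => rfl)
    (fun X => congrArg Heis.mk (List.append_nil X.word))
    (fun X Y => cls_eq (.tensor_id X.word Y.word))
    (by
      rintro X Y Z X' Y' Z' ⟨f⟩ ⟨f'⟩ ⟨g⟩ ⟨g'⟩; exact cls_eq (.interchange f f' g g'))
    (by
      rintro X Y X' Y' X'' Y'' ⟨f⟩ ⟨f'⟩ ⟨f''⟩
      rw [← ofTerm_ofEq (List.append_assoc Y.word Y'.word Y''.word),
        ← ofTerm_ofEq (List.append_assoc X.word X'.word X''.word)]
      exact cls_eq (.tensor_assoc f f' f''))
    (by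
      rintro X Y ⟨f⟩
      exact cls_eq (.trans (.comp_id _) (.trans (.unit_tensor f) (.symm (.id_comp f)))))
    (by
      rintro X Y ⟨f⟩
      rw [← ofTerm_ofEq (List.append_nil Y.word), ← ofTerm_ofEq (List.append_nil X.word)]
      exact cls_eq (.tensor_unit f))

instance : IsStrictMonoidal (Heis 𝕜) where
  tensor_assoc X Y Z := congrArg Heis.mk (List.append_assoc X.word Y.word Z.word)
  unit_tensor _ := rfl
  tensor_unit X := congrArg Heis.mk (List.append_nil X.word)
  associator_hom _ _ _ := rfl
  leftUnitor_hom _ := rfl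
  rightUnitor_hom _ := rfl

theorem add_tensor {X Y X' Y' : Heis 𝕜} (f g : X ⟶ Y) (h : X' ⟶ Y') :
    (f + g) ⊗ₘ h = (f ⊗ₘ h) + (g ⊗ₘ h) := by
  obtain ⟨f⟩ := f; obtain ⟨g⟩ := g; obtain ⟨h⟩ := h; exact cls_eq (.add_tensor f g h)

theorem tensor_add {X Y X' Y' : Heis 𝕜} (f : X ⟶ Y) (g h : X' ⟶ Y') :
    f ⊗ₘ (g + h) = (f ⊗ₘ g) + (f ⊗ₘ h) := by
  obtain ⟨f⟩ := f; obtain ⟨g⟩ := g; obtain ⟨h⟩ := h; exact cls_eq (.tensor_add f g h)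

theorem smul_tensor {X Y X' Y' : Heis 𝕜} (r : 𝕜) (f : X ⟶ Y) (h : X' ⟶ Y') :
    (r • f) ⊗ₘ h = r • (f ⊗ₘ h) := by
  obtain ⟨f⟩ := f; obtain ⟨h⟩ := h; exact cls_eq (.smul_tensor r f h)

theorem tensor_smul {X Y X' Y' : Heis 𝕜} (r : 𝕜) (f : X ⟶ Y) (h : X' ⟶ Y') :
    f ⊗ₘ (r • h) = r • (f ⊗ₘ h) := by
  obtain ⟨f⟩ := f; obtain ⟨h⟩ := h; exact cls_eq (.tensor_smul r f h)

instance : MonoidalPreadditive (Heis 𝕜) where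
  whiskerLeft_zero {X Y Z} := by
    rw [← id_tensorHom, ← zero_smul 𝕜 (0 : Y ⟶ Z), tensor_smul, zero_smul]
  zero_whiskerRight {X Y Z} := by
    rw [← tensorHom_id, ← zero_smul 𝕜 (0 : Y ⟶ Z), smul_tensor, zero_smul]
  whiskerLeft_add := by intros; simp only [← id_tensorHom, tensor_add]
  add_whiskerRight := by intros; simp only [← tensorHom_id, add_tensor]

instance : MonoidalLinear 𝕜 (Heis 𝕜) where
  whiskerLeft_smul := by intros; simp only [← id_tensorHom, tensor_smul]
  smul_whiskerRight := by intros; simp only [← tensorHom_id, smul_tensor]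

end Heis

/-! ### Quotients by tensor ideals -/

section TensorIdeal

variable (R : Type*) [CommRing R] {C : Type*} [Category* C] [Preadditive C] [Linear R C]
  [MonoidalCategory C]

/-- The tensor ideal of an `R`-linear monoidal category generated by a class `S` of morphisms. -/
inductive InTensorIdeal (S : MorphismProperty C) : ∀ {X Y : C}, (X ⟶ Y) → Prop
  | of {X Y : C} (f : X ⟶ Y) : S f → InTensorIdeal S f
  | zero (X Y : C) : InTensorIdeal S (0 : X ⟶ Y)
  | add {X Y : C} (f g : X ⟶ Y) : InTensorIdeal S f → InTensorIdeal S g → InTensorIdeal S (f + g)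
  | smul {X Y : C} (r : R) (f : X ⟶ Y) : InTensorIdeal S f → InTensorIdeal S (r • f)
  | comp_right {X Y Z : C} (f : X ⟶ Y) (g : Y ⟶ Z) : InTensorIdeal S f → InTensorIdeal S (f ≫ g)
  | comp_left {X Y Z : C} (f : X ⟶ Y) (g : Y ⟶ Z) : InTensorIdeal S g → InTensorIdeal S (f ≫ g)
  | whiskerLeft {X Y : C} (Z : C) (f : X ⟶ Y) : InTensorIdeal S f → InTensorIdeal S (Z ◁ f)
  | whiskerRight {X Y : C} (f : X ⟶ Y) (Z : C) : InTensorIdeal S f → InTensorIdeal S (f ▷ Z)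

/-- The morphisms `X ⟶ Y` in the tensor ideal generated by `S`. -/
def tensorIdeal (S : MorphismProperty C) (X Y : C) : Submodule R (X ⟶ Y) where
  carrier := {f | InTensorIdeal R S f}
  add_mem' hf hg := .add _ _ hf hg
  zero_mem' := .zero X Y
  smul_mem' r _ hf := .smul r _ hf

end TensorIdeal

/-- The quotient of an `R`-linear monoidal category by the tensor ideal generated by `S`. -/
structure TensorQuotient (R : Type*) [CommRing R] {C : Type*} [Category* C] [Preadditive C]
    [Linear R C] [MonoidalCategory C] (S : MorphismProperty C) where
  /-- the underlying object -/
  as : C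

namespace TensorQuotient

variable {R : Type*} [CommRing R] {C : Type*} [Category* C] [Preadditive C] [Linear R C]
  [MonoidalCategory C] {S : MorphismProperty C}

/-- The class of a morphism modulo the tensor ideal. -/
def cls {X Y : C} (f : X ⟶ Y) : (X ⟶ Y) ⧸ tensorIdeal R S X Y :=
  Submodule.Quotient.mk f

theorem cls_eq {X Y : C} {f g : X ⟶ Y} (h : InTensorIdeal R S (f - g)) :
    (cls f : (X ⟶ Y) ⧸ tensorIdeal R S X Y) = cls g :=
  (Submodule.Quotient.eq _).2 h

theorem cls_surj {X Y : C} (f : (X ⟶ Y) ⧸ tensorIdeal R S X Y) : ∃ x, cls x = f :=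
  Submodule.Quotient.mk_surjective _ f

theorem sub_mem {X Y : C} {f g : X ⟶ Y}
    (h : (tensorIdeal R S X Y).quotientRel f g) : InTensorIdeal R S (f - g) :=
  (Submodule.quotientRel_def _).1 h

/-- Composition modulo the tensor ideal. -/
def comp {X Y Z : C} (f : (X ⟶ Y) ⧸ tensorIdeal R S X Y) (g : (Y ⟶ Z) ⧸ tensorIdeal R S Y Z) :
    (X ⟶ Z) ⧸ tensorIdeal R S X Z :=
  Quotient.liftOn₂ f g (fun f g => cls (f ≫ g)) <| by
    intro f g f' g' hf hg
    refine cls_eq ?_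
    have : f ≫ g - f' ≫ g' = (f - f') ≫ g + f' ≫ (g - g') := by simp
    rw [this]
    exact .add _ _ (.comp_right _ _ (sub_mem hf)) (.comp_left _ _ (sub_mem hg))

instance : Category (TensorQuotient R S) where
  Hom X Y := (X.as ⟶ Y.as) ⧸ tensorIdeal R S X.as Y.as
  id X := cls (𝟙 X.as)
  comp := comp
  id_comp := by
    rintro X Y f; obtain ⟨f, rfl⟩ := cls_surj f
    exact congrArg cls (Category.id_comp f)
  comp_id := by
    rintro X Y f; obtain ⟨f, rfl⟩ := cls_surj f
    exact congrArg cls (Category.comp_id f)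
  assoc := by
    rintro X Y Z W f g h
    obtain ⟨f, rfl⟩ := cls_surj f
    obtain ⟨g, rfl⟩ := cls_surj g
    obtain ⟨h, rfl⟩ := cls_surj h
    exact congrArg cls (Category.assoc f g h)

instance : Preadditive (TensorQuotient R S) where
  homGroup X Y := inferInstanceAs (AddCommGroup ((X.as ⟶ Y.as) ⧸ tensorIdeal R S X.as Y.as))
  add_comp := by
    rintro X Y Z f g h
    obtain ⟨f, rfl⟩ := cls_surj f
    obtain ⟨g, rfl⟩ := cls_surj g
    obtain ⟨h, rfl⟩ := cls_surj h
    exact congrArg cls (Preadditive.add_comp _ _ _ f g h)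
  comp_add := by
    rintro X Y Z f g h
    obtain ⟨f, rfl⟩ := cls_surj f
    obtain ⟨g, rfl⟩ := cls_surj g
    obtain ⟨h, rfl⟩ := cls_surj h
    exact congrArg cls (Preadditive.comp_add _ _ _ f g h)

instance : Linear R (TensorQuotient R S) where
  homModule X Y := inferInstanceAs (Module R ((X.as ⟶ Y.as) ⧸ tensorIdeal R S X.as Y.as))
  smul_comp := by
    rintro X Y Z r f g
    obtain ⟨f, rfl⟩ := cls_surj f
    obtain ⟨g, rfl⟩ := cls_surj g
    exact congrArg cls (Linear.smul_comp _ _ _ r f g)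
  comp_smul := by
    rintro X Y Z f r g
    obtain ⟨f, rfl⟩ := cls_surj f
    obtain ⟨g, rfl⟩ := cls_surj g
    exact congrArg cls (Linear.comp_smul _ _ _ f r g)

/-- The morphism of the quotient represented by a morphism of `C`. -/
def homMk {X Y : C} (f : X ⟶ Y) : (⟨X⟩ : TensorQuotient R S) ⟶ ⟨Y⟩ := cls f

theorem homMk_surj {X Y : TensorQuotient R S} (f : X ⟶ Y) :
    ∃ x : X.as ⟶ Y.as, homMk x = f := cls_surj f

@[simp]
theorem homMk_id (X : C) : homMk (R := R) (S := S) (𝟙 X) = 𝟙 (⟨X⟩ : TensorQuotient R S) := rfl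

theorem homMk_comp {X Y Z : C} (f : X ⟶ Y) (g : Y ⟶ Z) :
    homMk (R := R) (S := S) (f ≫ g) = homMk f ≫ homMk g := rfl

theorem homMk_add {X Y : C} (f g : X ⟶ Y) :
    homMk (R := R) (S := S) (f + g) = homMk f + homMk g := rfl

theorem homMk_smul {X Y : C} (r : R) (f : X ⟶ Y) :
    homMk (R := R) (S := S) (r • f) = r • homMk f := rfl

theorem homMk_eqToHom {X Y : C} (h : X = Y) :
    homMk (R := R) (S := S) (eqToHom h) = eqToHom (by rw [h]) := by
  subst h; rfl

theorem homMk_eq {X Y : C} {f g : X ⟶ Y} (h : InTensorIdeal R S (f - g)) :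
    homMk (R := R) (S := S) f = homMk g := cls_eq h

variable [MonoidalPreadditive C]

/-- The tensor product of morphisms modulo the tensor ideal. -/
def tensor {X Y X' Y' : C} (f : (X ⟶ Y) ⧸ tensorIdeal R S X Y)
    (g : (X' ⟶ Y') ⧸ tensorIdeal R S X' Y') :
    (X ⊗ X' ⟶ Y ⊗ Y') ⧸ tensorIdeal R S (X ⊗ X') (Y ⊗ Y') :=
  Quotient.liftOn₂ f g (fun f g => cls (f ⊗ₘ g)) <| by
    intro f g f' g' hf hg
    refine cls_eq ?_
    have : f ⊗ₘ g - f' ⊗ₘ g' = (f - f') ▷ X' ≫ Y ◁ g + f' ▷ X' ≫ Y ◁ (g - g') := by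
      have h₁ : (f - f') ▷ X' ≫ Y ◁ g + f' ▷ X' ≫ Y ◁ g = f ▷ X' ≫ Y ◁ g := by
        rw [← Preadditive.add_comp, ← MonoidalPreadditive.add_whiskerRight, sub_add_cancel]
      have h₂ : f' ▷ X' ≫ Y ◁ (g - g') + f' ▷ X' ≫ Y ◁ g' = f' ▷ X' ≫ Y ◁ g := by
        rw [← Preadditive.comp_add, ← MonoidalPreadditive.whiskerLeft_add, sub_add_cancel]
      rw [MonoidalCategory.tensorHom_def, MonoidalCategory.tensorHom_def, ← h₁, ← h₂]
      abel
    rw [this]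
    exact .add _ _ (.comp_right _ _ (.whiskerRight _ _ (sub_mem hf)))
      (.comp_left _ _ (.whiskerLeft _ _ (sub_mem hg)))

/-- An isomorphism of `C`, viewed in the quotient. -/
def isoMk {X Y : C} (e : X ≅ Y) : (⟨X⟩ : TensorQuotient R S) ≅ ⟨Y⟩ where
  hom := homMk e.hom
  inv := homMk e.inv
  hom_inv_id := by rw [← homMk_comp, e.hom_inv_id]; rfl
  inv_hom_id := by rw [← homMk_comp, e.inv_hom_id]; rfl

instance : MonoidalCategoryStruct (TensorQuotient R S) where
  tensorObj X Y := ⟨X.as ⊗ Y.as⟩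
  tensorUnit := ⟨𝟙_ C⟩
  whiskerLeft X _ _ f := tensor (cls (𝟙 X.as)) f
  whiskerRight f Y := tensor f (cls (𝟙 Y.as))
  tensorHom := tensor
  associator X Y Z := isoMk (α_ X.as Y.as Z.as)
  leftUnitor X := isoMk (λ_ X.as)
  rightUnitor X := isoMk (ρ_ X.as)

theorem homMk_tensor {X Y X' Y' : C} (f : X ⟶ Y) (g : X' ⟶ Y') :
    homMk (R := R) (S := S) (f ⊗ₘ g) = homMk f ⊗ₘ homMk g := rfl

instance : MonoidalCategory (TensorQuotient R S) :=
  MonoidalCategory.ofTensorHom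
    (id_tensorHom_id := fun X Y => congrArg homMk (id_tensorHom_id X.as Y.as))
    (id_tensorHom := fun _ _ _ _ => rfl)
    (tensorHom_id := fun _ _ => rfl)
    (tensorHom_comp_tensorHom := by
      intro X Y Z X' Y' Z' f f' g g'
      obtain ⟨f, rfl⟩ := homMk_surj f
      obtain ⟨f', rfl⟩ := homMk_surj f'
      obtain ⟨g, rfl⟩ := homMk_surj g
      obtain ⟨g', rfl⟩ := homMk_surj g'
      exact congrArg homMk (tensorHom_comp_tensorHom f f' g g'))
    (associator_naturality := by
      intro X X' X'' Y Y' Y'' f f' f''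
      obtain ⟨f, rfl⟩ := homMk_surj f
      obtain ⟨f', rfl⟩ := homMk_surj f'
      obtain ⟨f'', rfl⟩ := homMk_surj f''
      exact congrArg homMk (associator_naturality f f' f''))
    (leftUnitor_naturality := by
      intro X Y f
      obtain ⟨f, rfl⟩ := homMk_surj f
      refine congrArg homMk (?_ : (𝟙 (𝟙_ C) ⊗ₘ f) ≫ (λ_ Y.as).hom = (λ_ X.as).hom ≫ f)
      simp)
    (rightUnitor_naturality := by
      intro X Y f
      obtain ⟨f, rfl⟩ := homMk_surj f
      refine congrArg homMk (?_ : (f ⊗ₘ 𝟙 (𝟙_ C)) ≫ (ρ_ Y.as).hom = (ρ_ X.as).hom ≫ f)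
      simp)
    (pentagon := by
      intro W X Y Z
      refine congrArg homMk (?_ : ((α_ W.as X.as Y.as).hom ⊗ₘ 𝟙 Z.as) ≫
        (α_ W.as (X.as ⊗ Y.as) Z.as).hom ≫ (𝟙 W.as ⊗ₘ (α_ X.as Y.as Z.as).hom) =
          (α_ (W.as ⊗ X.as) Y.as Z.as).hom ≫ (α_ W.as X.as (Y.as ⊗ Z.as)).hom)
      simp)
    (triangle := by
      intro X Y
      refine congrArg homMk (?_ : (α_ X.as (𝟙_ C) Y.as).hom ≫ (𝟙 X.as ⊗ₘ (λ_ Y.as).hom) =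
        ((ρ_ X.as).hom ⊗ₘ 𝟙 Y.as))
      simp)

instance [IsStrictMonoidal C] : IsStrictMonoidal (TensorQuotient R S) where
  tensor_assoc X Y Z :=
    congrArg TensorQuotient.mk (IsStrictMonoidal.tensor_assoc X.as Y.as Z.as)
  unit_tensor X := congrArg TensorQuotient.mk (IsStrictMonoidal.unit_tensor X.as)
  tensor_unit X := congrArg TensorQuotient.mk (IsStrictMonoidal.tensor_unit X.as)
  associator_hom X Y Z :=
    (congrArg homMk (IsStrictMonoidal.associator_hom X.as Y.as Z.as)).trans (homMk_eqToHom _)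
  leftUnitor_hom X :=
    (congrArg homMk (IsStrictMonoidal.leftUnitor_hom X.as)).trans (homMk_eqToHom _)
  rightUnitor_hom X :=
    (congrArg homMk (IsStrictMonoidal.rightUnitor_hom X.as)).trans (homMk_eqToHom _)

end TensorQuotient

/-! ### The category `Peis(t)` -/

theorem CategoryTheory.ObjectProperty.homMk_eqToHom {C : Type*} [Category* C]
    (P : ObjectProperty C) {X Y : P.FullSubcategory} (h : X = Y) (h' : X.obj = Y.obj) :
    (ObjectProperty.homMk (eqToHom h') : X ⟶ Y) = eqToHom h := by
  subst h; rfl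

/-- Full subcategories of strict monoidal categories that contain the unit and are closed under
tensor products are strict. -/
instance {C : Type*} [Category* C] [MonoidalCategory C] [IsStrictMonoidal C]
    (P : ObjectProperty C) [P.IsMonoidal] : IsStrictMonoidal P.FullSubcategory where
  tensor_assoc X Y Z := ObjectProperty.FullSubcategory.ext (IsStrictMonoidal.tensor_assoc _ _ _)
  unit_tensor X := ObjectProperty.FullSubcategory.ext (IsStrictMonoidal.unit_tensor _)
  tensor_unit X := ObjectProperty.FullSubcategory.ext (IsStrictMonoidal.tensor_unit _)
  associator_hom X Y Z := by
    rw [← ObjectProperty.homMk_eqToHom P _ (IsStrictMonoidal.tensor_assoc _ _ _)]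
    exact P.hom_ext (IsStrictMonoidal.associator_hom X.obj Y.obj Z.obj)
  leftUnitor_hom X := by
    rw [← ObjectProperty.homMk_eqToHom P _ (IsStrictMonoidal.unit_tensor _)]
    exact P.hom_ext (IsStrictMonoidal.leftUnitor_hom X.obj)
  rightUnitor_hom X := by
    rw [← ObjectProperty.homMk_eqToHom P _ (IsStrictMonoidal.tensor_unit _)]
    exact P.hom_ext (IsStrictMonoidal.rightUnitor_hom X.obj)

/-- Powers of an object of a strict monoidal category add up. -/
theorem tensorPow_add {C : Type*} [Category* C] [MonoidalCategory C] [IsStrictMonoidal C]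
    (X : C) (k l : ℕ) : tensorPow X k ⊗ tensorPow X l = tensorPow X (k + l) := by
  induction l with
  | zero => exact IsStrictMonoidal.tensor_unit _
  | succ l ih =>
    exact (IsStrictMonoidal.tensor_assoc (tensorPow X k) (tensorPow X l) X).symm.trans
      (congrArg (fun Y => Y ⊗ X) ih)

section Peis

variable (𝕜 : Type u) [CommRing 𝕜]

/-- The object `↑` of the Heisenberg category. -/
def Heis.up : Heis 𝕜 := ⟨[.up]⟩

/-- The object `↓` of the Heisenberg category. -/
def Heis.down : Heis 𝕜 := ⟨[.down]⟩

/-- The objects `(↑↓)^k` of the Heisenberg category. -/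
def IsPeisObject : ObjectProperty (Heis 𝕜) :=
  fun X => ∃ k, X = tensorPow (Heis.up 𝕜 ⊗ Heis.down 𝕜) k

instance : (IsPeisObject 𝕜).IsMonoidal where
  prop_unit := ⟨0, rfl⟩
  prop_tensor := by
    rintro X Y ⟨k, rfl⟩ ⟨l, rfl⟩
    exact ⟨k + l, tensorPow_add _ k l⟩

/-- The full monoidal subcategory of the Heisenberg category generated by `↑↓`: its objects are
the tensor powers of `↑↓`. -/
abbrev Peis : Type := (IsPeisObject 𝕜).FullSubcategory

namespace Peis

/-- The object `↑↓`. -/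
def updown : Peis 𝕜 := ⟨Heis.up 𝕜 ⊗ Heis.down 𝕜, 1, rfl⟩

/-- The clockwise bubble, an endomorphism of the unit object. -/
def bubble : 𝟙_ (Peis 𝕜) ⟶ 𝟙_ (Peis 𝕜) :=
  ObjectProperty.homMk (Heis.ofTerm HeisTerm.bubble)

end Peis

variable {𝕜} in
/-- The single morphism `bubble - t • 𝟙`. -/
inductive BubbleRel (t : 𝕜) : MorphismProperty (Peis 𝕜)
  | mk : BubbleRel t (Peis.bubble 𝕜 - t • 𝟙 (𝟙_ (Peis 𝕜)))

variable {𝕜} in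
/-- The category `Peis(t)`: the quotient of `Peis` by the tensor ideal generated by
`bubble - t • 𝟙`. -/
abbrev PeisT (t : 𝕜) : Type := TensorQuotient 𝕜 (BubbleRel t)

namespace PeisT

open HeisTerm

variable {𝕜} (t : 𝕜)

/-- The object `↑↓` of `Peis(t)`. -/
def updown : PeisT t := ⟨Peis.updown 𝕜⟩

/-- The morphism of `Peis(t)` represented by a morphism of the Heisenberg category. -/
def homMk {X Y : PeisT t} (f : X.as.obj ⟶ Y.as.obj) : X ⟶ Y :=
  TensorQuotient.homMk (X := X.as) (Y := Y.as) (ObjectProperty.homMk f)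

/-- The image of the merge `μ`: a left cap between `↑` and `↓`. -/
def mul : updown t ⊗ updown t ⟶ updown t := homMk t (Heis.ofTerm mulTerm)

/-- The image of the split `Δ`: a right cup between `↑` and `↓`. -/
def comul : updown t ⟶ updown t ⊗ updown t := homMk t (Heis.ofTerm comulTerm)

/-- The image of the crossing `s`. -/
def swap : updown t ⊗ updown t ⟶ updown t ⊗ updown t := homMk t (Heis.ofTerm swapTerm)

/-- The image of the unit pin `η`: a left cup. -/
def unit : 𝟙_ (PeisT t) ⟶ updown t := homMk t (Heis.ofTerm cupL)

/-- The image of the counit pin `ε`: a right cap. -/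
def counit : updown t ⟶ 𝟙_ (PeisT t) := homMk t (Heis.ofTerm capR)

end PeisT

end Peis

/-! ### The partition category -/

/-- The partition obtained by stacking the partition `Q` (of type `γ` over `β`) on top of the
partition `P` (of type `β` over `α`) and identifying the vertices in the middle row. -/
def stackSetoid {α β γ : Type} (P : Setoid (α ⊕ β)) (Q : Setoid (β ⊕ γ)) :
    Setoid (α ⊕ (β ⊕ γ)) :=
  P.map (Sum.map id Sum.inl) ⊔ Q.map Sum.inr

/-- The partition obtained from the stack by removing the middle row. -/
def starSetoid {α β γ : Type} (P : Setoid (α ⊕ β)) (Q : Setoid (β ⊕ γ)) : Setoid (α ⊕ γ) :=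
  (stackSetoid P Q).comap (Sum.map id Sum.inr)

/-- The number of components of the stack all of whose vertices lie in the middle row. -/
noncomputable def middleCount {α β γ : Type} (P : Setoid (α ⊕ β)) (Q : Setoid (β ⊕ γ)) : ℕ :=
  Nat.card {q : Quotient (stackSetoid P Q) //
    ∀ x, Quotient.mk (stackSetoid P Q) x = q → ∃ y, x = Sum.inr (Sum.inl y)}

/-- The horizontal juxtaposition of partitions, with `P` placed to the left of `Q`. -/
def juxtSetoid {a b c d : ℕ} (P : Setoid (Fin a ⊕ Fin b)) (Q : Setoid (Fin c ⊕ Fin d)) :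
    Setoid (Fin (a + c) ⊕ Fin (b + d)) :=
  P.map (Sum.map (Fin.castAdd c) (Fin.castAdd d)) ⊔ Q.map (Sum.map (Fin.natAdd a) (Fin.natAdd b))

/-- The identity partition, which joins each bottom vertex with the top vertex above it. -/
def idSetoid (α : Type) : Setoid (α ⊕ α) := Setoid.ker (Sum.elim id id)

section Colourings

theorem map_le_ker_iff {α β κ : Type} (P : Setoid α) (f : α → β) (c : β → κ) :
    P.map f ≤ Setoid.ker c ↔ P ≤ Setoid.ker (c ∘ f) := by
  constructor
  · intro h x y hxy
    exact h (Setoid.le_comap_map hxy)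
  · intro h
    refine Setoid.eqvGen_le ?_
    rintro _ _ ⟨x, y, hxy, rfl, rfl⟩
    exact h hxy

theorem setoid_ext_colour {α : Type} {P Q : Setoid α}
    (h : ∀ c : α → Bool, P ≤ Setoid.ker c ↔ Q ≤ Setoid.ker c) : P = Q := by
  classical
  have key : ∀ {P Q : Setoid α}, (∀ c : α → Bool, Q ≤ Setoid.ker c → P ≤ Setoid.ker c) →
      P ≤ Q := by
    intro P Q h x y hxy
    have := h (fun z => decide (Q x z)) (fun u v huv => by
      have : Q x u ↔ Q x v := ⟨fun h => Q.trans h huv, fun h => Q.trans h (Q.symm huv)⟩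
      simp [this]) hxy
    have h1 : decide (Q x x) = decide (Q x y) := this
    have h2 : Q x x := Q.refl x
    simpa [h2] using h1
  exact le_antisymm (key fun c => (h c).2) (key fun c => (h c).1)

theorem stack_le_iff {α β γ κ : Type} (P : Setoid (α ⊕ β)) (Q : Setoid (β ⊕ γ))
    (a : α → κ) (b : β → κ) (c : γ → κ) :
    stackSetoid P Q ≤ Setoid.ker (Sum.elim a (Sum.elim b c)) ↔
      P ≤ Setoid.ker (Sum.elim a b) ∧ Q ≤ Setoid.ker (Sum.elim b c) := by
  rw [stackSetoid, sup_le_iff, map_le_ker_iff, map_le_ker_iff, Sum.elim_comp_map,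
    Sum.elim_comp_inl, Sum.elim_comp_inr, Function.comp_id]

theorem juxt_le_iff {a b c d : ℕ} {κ : Type} (P : Setoid (Fin a ⊕ Fin b))
    (Q : Setoid (Fin c ⊕ Fin d)) (x : Fin (a + c) → κ) (y : Fin (b + d) → κ) :
    juxtSetoid P Q ≤ Setoid.ker (Sum.elim x y) ↔
      P ≤ Setoid.ker (Sum.elim (x ∘ Fin.castAdd c) (y ∘ Fin.castAdd d)) ∧
      Q ≤ Setoid.ker (Sum.elim (x ∘ Fin.natAdd a) (y ∘ Fin.natAdd b)) := by
  rw [juxtSetoid, sup_le_iff, map_le_ker_iff, map_le_ker_iff, Sum.elim_comp_map,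
    Sum.elim_comp_map]

theorem idSetoid_le_iff {α κ : Type} (a b : α → κ) :
    idSetoid α ≤ Setoid.ker (Sum.elim a b) ↔ a = b := by
  constructor
  · intro h
    funext x
    exact @h (Sum.inl x) (Sum.inr x) rfl
  · rintro rfl x y h
    have h' : Sum.elim id id x = Sum.elim id id y := h
    change Sum.elim a a x = Sum.elim a a y
    have : ∀ z, Sum.elim a a z = a (Sum.elim id id z) := by rintro (z | z) <;> rfl
    rw [this, this, h']

open Classical in
/-- The indicator function of the colourings that are constant on the blocks of a partition. -/
noncomputable def colourMat {α β : Type} (P : Setoid (α ⊕ β)) :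
    Matrix (α → Bool) (β → Bool) ℕ :=
  Matrix.of fun a b => if P ≤ Setoid.ker (Sum.elim a b) then 1 else 0

theorem colourMat_idSetoid (α : Type) [Finite α] [DecidableEq (α → Bool)] :
    colourMat (idSetoid α) = 1 := by
  ext a b
  simp [colourMat, idSetoid_le_iff, Matrix.one_apply]

theorem star_le_of_stack_le {α β γ κ : Type} {P : Setoid (α ⊕ β)} {Q : Setoid (β ⊕ γ)}
    {a : α → κ} {b : β → κ} {c : γ → κ}
    (h : stackSetoid P Q ≤ Setoid.ker (Sum.elim a (Sum.elim b c))) :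
    starSetoid P Q ≤ Setoid.ker (Sum.elim a c) := by
  intro x y hxy
  have h1 : Sum.elim a (Sum.elim b c) (Sum.map id Sum.inr x) =
      Sum.elim a (Sum.elim b c) (Sum.map id Sum.inr y) := h hxy
  have h2 : ∀ z, Sum.elim a (Sum.elim b c) (Sum.map id Sum.inr z) = Sum.elim a c z := by
    rintro (z | z) <;> rfl
  rw [h2, h2] at h1
  exact h1

/-- The components of the stack that lie in the middle row. -/
abbrev MiddleBlock {α β γ : Type} (P : Setoid (α ⊕ β)) (Q : Setoid (β ⊕ γ)) : Type :=
  {q : Quotient (stackSetoid P Q) //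
    ∀ x, Quotient.mk (stackSetoid P Q) x = q → ∃ y, x = Sum.inr (Sum.inl y)}

theorem exists_end {α β γ : Type} {P : Setoid (α ⊕ β)} {Q : Setoid (β ⊕ γ)}
    {q : Quotient (stackSetoid P Q)}
    (h : ¬ ∀ x, Quotient.mk (stackSetoid P Q) x = q → ∃ y, x = Sum.inr (Sum.inl y)) :
    ∃ z : α ⊕ γ, Quotient.mk (stackSetoid P Q) (Sum.map id Sum.inr z) = q := by
  by_contra h'
  refine h fun x hx => ?_
  rcases x with x | x | x
  · exact absurd ⟨Sum.inl x, hx⟩ h'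
  · exact ⟨x, rfl⟩
  · exact absurd ⟨Sum.inr x, hx⟩ h'

open Classical in
/-- Extending a colouring of the end vertices to the middle row. -/
noncomputable def extendColour {α β γ κ : Type} (P : Setoid (α ⊕ β)) (Q : Setoid (β ⊕ γ))
    (a : α → κ) (c : γ → κ) (φ : MiddleBlock P Q → κ) (q : Quotient (stackSetoid P Q)) : κ :=
  if h : ∀ x, Quotient.mk (stackSetoid P Q) x = q → ∃ y, x = Sum.inr (Sum.inl y) then φ ⟨q, h⟩
  else Sum.elim a c (exists_end h).choose

theorem extendColour_end {α β γ κ : Type} {P : Setoid (α ⊕ β)} {Q : Setoid (β ⊕ γ)}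
    {a : α → κ} {c : γ → κ} (h : starSetoid P Q ≤ Setoid.ker (Sum.elim a c))
    (φ : MiddleBlock P Q → κ) (z : α ⊕ γ) :
    extendColour P Q a c φ (Quotient.mk _ (Sum.map id Sum.inr z)) = Sum.elim a c z := by
  have hz : ¬ ∀ x, Quotient.mk (stackSetoid P Q) x =
      Quotient.mk (stackSetoid P Q) (Sum.map id Sum.inr z) → ∃ y, x = Sum.inr (Sum.inl y) := by
    intro hz
    obtain ⟨y, hy⟩ := hz _ rfl
    rcases z with z | z <;> simp at hy
  rw [extendColour, dif_neg hz]
  have h1 := Quotient.exact (exists_end hz).choose_spec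
  exact h (show starSetoid P Q _ _ from h1)

theorem extendColour_stack_le {α β γ κ : Type} {P : Setoid (α ⊕ β)} {Q : Setoid (β ⊕ γ)}
    {a : α → κ} {c : γ → κ} (h : starSetoid P Q ≤ Setoid.ker (Sum.elim a c))
    (φ : MiddleBlock P Q → κ) :
    stackSetoid P Q ≤ Setoid.ker (Sum.elim a (Sum.elim
      (fun y => extendColour P Q a c φ (Quotient.mk _ (Sum.inr (Sum.inl y)))) c)) := by
  have key : ∀ x, Sum.elim a (Sum.elim
      (fun y => extendColour P Q a c φ (Quotient.mk _ (Sum.inr (Sum.inl y)))) c) x =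
        extendColour P Q a c φ (Quotient.mk _ x) := by
    rintro (x | x | x)
    · exact (extendColour_end h φ (Sum.inl x)).symm
    · rfl
    · exact (extendColour_end h φ (Sum.inr x)).symm
  intro x y hxy
  have : Quotient.mk (stackSetoid P Q) x = Quotient.mk (stackSetoid P Q) y := Quotient.sound hxy
  change Sum.elim _ _ x = Sum.elim _ _ y
  rw [key, key, this]

/-- Colourings of the middle row compatible with a given colouring of the end vertices. -/
noncomputable def middleColourEquiv {α β γ κ : Type} (P : Setoid (α ⊕ β)) (Q : Setoid (β ⊕ γ))
    (a : α → κ) (c : γ → κ) (h : starSetoid P Q ≤ Setoid.ker (Sum.elim a c)) :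
    {b : β → κ // stackSetoid P Q ≤ Setoid.ker (Sum.elim a (Sum.elim b c))} ≃
      (MiddleBlock P Q → κ) where
  toFun b q := Quotient.lift (Sum.elim a (Sum.elim b.1 c)) (fun _ _ hxy => b.2 hxy) q.1
  invFun φ := ⟨_, extendColour_stack_le h φ⟩
  left_inv := by
    rintro ⟨b, hb⟩
    refine Subtype.ext (funext fun y => ?_)
    by_cases hy : ∀ x, Quotient.mk (stackSetoid P Q) x =
        Quotient.mk (stackSetoid P Q) (Sum.inr (Sum.inl y)) → ∃ y, x = Sum.inr (Sum.inl y)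
    · simp only [extendColour, dif_pos hy]
      rfl
    · simp only [extendColour, dif_neg hy]
      have h1 := hb (Quotient.exact (exists_end hy).choose_spec)
      change _ = b y at h1
      rw [← h1]
      rcases (exists_end hy).choose with z | z <;> rfl
  right_inv := by
    intro φ
    funext ⟨q, hq⟩
    induction q using Quotient.inductionOn with
    | h x =>
      obtain ⟨y, rfl⟩ := hq x rfl
      change extendColour P Q a c φ (Quotient.mk _ (Sum.inr (Sum.inl y))) = _
      rw [extendColour, dif_pos hq]

theorem colourMat_mul {α β γ : Type} [Fintype (β → Bool)] [Finite α] [Finite β] [Finite γ]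
    (P : Setoid (α ⊕ β)) (Q : Setoid (β ⊕ γ)) :
    colourMat P * colourMat Q = 2 ^ middleCount P Q • colourMat (starSetoid P Q) := by
  classical
  ext a c
  have h1 : (colourMat P * colourMat Q) a c = Nat.card {b : β → Bool //
      stackSetoid P Q ≤ Setoid.ker (Sum.elim a (Sum.elim b c))} := by
    rw [Nat.card_eq_fintype_card, Fintype.card_subtype, Finset.card_filter, Matrix.mul_apply]
    refine Finset.sum_congr rfl fun b _ => ?_
    simp only [stack_le_iff, colourMat, Matrix.of_apply]
    split_ifs <;> simp_all
  rw [h1]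
  by_cases h : starSetoid P Q ≤ Setoid.ker (Sum.elim a c)
  · rw [Nat.card_congr (middleColourEquiv P Q a c h)]
    simp only [Nat.card_fun, Nat.card_eq_fintype_card (α := Bool), Fintype.card_bool, colourMat,
      Matrix.smul_apply, Matrix.of_apply, h, if_true, smul_eq_mul, mul_one]
    rfl
  · have : IsEmpty {b : β → Bool //
        stackSetoid P Q ≤ Setoid.ker (Sum.elim a (Sum.elim b c))} :=
      ⟨fun b => h (star_le_of_stack_le b.2)⟩
    simp [colourMat, h]

theorem colourMat_const {α β : Type} (P : Setoid (α ⊕ β)) :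
    colourMat P (fun _ => true) (fun _ => true) = 1 := by
  have : (Sum.elim (fun _ => true) (fun _ => true) : α ⊕ β → Bool) = fun _ => true := by
    funext x; cases x <;> rfl
  simp only [colourMat, Matrix.of_apply, this, ite_eq_left_iff]
  intro h
  exact absurd (fun x y _ => rfl) h

theorem colourMat_inj {α β : Type} {P Q : Setoid (α ⊕ β)} {m n : ℕ}
    (h : 2 ^ m • colourMat P = 2 ^ n • colourMat Q) : m = n ∧ P = Q := by
  have h1 := congrFun (congrFun h fun _ => true) fun _ => true
  simp only [Matrix.smul_apply, colourMat_const, smul_eq_mul, mul_one] at h1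
  have h2 : m = n := Nat.pow_right_injective le_rfl h1
  refine ⟨h2, setoid_ext_colour fun c => ?_⟩
  subst h2
  have h3 := congrFun (congrFun h (c ∘ Sum.inl)) (c ∘ Sum.inr)
  have h4 : 2 ^ m ≠ 0 := by positivity
  simp only [Matrix.smul_apply, smul_eq_mul, colourMat, Matrix.of_apply,
    Sum.elim_comp_inl_inr] at h3
  by_cases hP : P ≤ Setoid.ker c <;> by_cases hQ : Q ≤ Setoid.ker c <;> simp_all

end Colourings

/-! ### Linear combinations of partitions -/

section Linear

variable {𝕜 : Type u} [CommRing 𝕜]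

/-- Composition of linear combinations of partitions. -/
noncomputable def parComp (t : 𝕜) {m l k : ℕ} :
    (Setoid (Fin m ⊕ Fin l) →₀ 𝕜) →ₗ[𝕜] (Setoid (Fin l ⊕ Fin k) →₀ 𝕜) →ₗ[𝕜]
      (Setoid (Fin m ⊕ Fin k) →₀ 𝕜) :=
  Finsupp.linearCombination 𝕜 fun P => Finsupp.linearCombination 𝕜 fun Q =>
    Finsupp.single (starSetoid P Q) (t ^ middleCount P Q)

/-- Juxtaposition of linear combinations of partitions. -/
noncomputable def parTensor (𝕜 : Type u) [CommRing 𝕜] {a b c d : ℕ} :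
    (Setoid (Fin a ⊕ Fin b) →₀ 𝕜) →ₗ[𝕜] (Setoid (Fin c ⊕ Fin d) →₀ 𝕜) →ₗ[𝕜]
      (Setoid (Fin (a + c) ⊕ Fin (b + d)) →₀ 𝕜) :=
  Finsupp.linearCombination 𝕜 fun P => Finsupp.linearCombination 𝕜 fun Q => Finsupp.single (juxtSetoid P Q) 1

theorem parComp_single (t : 𝕜) {m l k : ℕ} (P : Setoid (Fin m ⊕ Fin l))
    (Q : Setoid (Fin l ⊕ Fin k)) :
    parComp t (Finsupp.single P 1) (Finsupp.single Q 1) =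
      Finsupp.single (starSetoid P Q) (t ^ middleCount P Q) := by
  simp [parComp]

theorem parTensor_single {a b c d : ℕ} (P : Setoid (Fin a ⊕ Fin b)) (Q : Setoid (Fin c ⊕ Fin d)) :
    parTensor 𝕜 (Finsupp.single P 1) (Finsupp.single Q 1) =
      Finsupp.single (juxtSetoid P Q) 1 := by
  simp [parTensor]

end Linear

section Identities

theorem star_assoc {α β γ δ : Type} [Finite α] [Finite β] [Finite γ] [Finite δ]
    (P : Setoid (α ⊕ β)) (Q : Setoid (β ⊕ γ)) (R : Setoid (γ ⊕ δ)) :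
    middleCount P Q + middleCount (starSetoid P Q) R =
      middleCount Q R + middleCount P (starSetoid Q R) ∧
    starSetoid (starSetoid P Q) R = starSetoid P (starSetoid Q R) := by
  classical
  have := Fintype.ofFinite β
  have := Fintype.ofFinite γ
  apply colourMat_inj
  have h := Matrix.mul_assoc (colourMat P) (colourMat Q) (colourMat R)
  rw [colourMat_mul, colourMat_mul, Matrix.smul_mul, Matrix.mul_smul, colourMat_mul, colourMat_mul,
    smul_smul, smul_smul, ← pow_add, ← pow_add] at h
  exact h

theorem id_star {α β : Type} [Finite α] [Finite β] (P : Setoid (α ⊕ β)) :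
    middleCount (idSetoid α) P = 0 ∧ starSetoid (idSetoid α) P = P := by
  classical
  have := Fintype.ofFinite α
  apply colourMat_inj
  rw [← colourMat_mul, colourMat_idSetoid, Matrix.one_mul, pow_zero, one_smul]

theorem star_id {α β : Type} [Finite α] [Finite β] (P : Setoid (α ⊕ β)) :
    middleCount P (idSetoid β) = 0 ∧ starSetoid P (idSetoid β) = P := by
  classical
  have := Fintype.ofFinite β
  apply colourMat_inj
  rw [← colourMat_mul, colourMat_idSetoid, Matrix.mul_one, pow_zero, one_smul]

theorem colourMat_juxt {a b c d : ℕ} (P : Setoid (Fin a ⊕ Fin b)) (Q : Setoid (Fin c ⊕ Fin d))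
    (x : Fin (a + c) → Bool) (y : Fin (b + d) → Bool) :
    colourMat (juxtSetoid P Q) x y =
      colourMat P (x ∘ Fin.castAdd c) (y ∘ Fin.castAdd d) *
        colourMat Q (x ∘ Fin.natAdd a) (y ∘ Fin.natAdd b) := by
  have h := juxt_le_iff P Q x y
  simp only [colourMat, Matrix.of_apply]
  by_cases hP : P ≤ Setoid.ker (Sum.elim (x ∘ Fin.castAdd c) (y ∘ Fin.castAdd d)) <;>
    by_cases hQ : Q ≤ Setoid.ker (Sum.elim (x ∘ Fin.natAdd a) (y ∘ Fin.natAdd b)) <;>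
    simp [h, hP, hQ]

theorem star_juxt {a b c a' b' c' : ℕ} (P : Setoid (Fin a ⊕ Fin b)) (P' : Setoid (Fin a' ⊕ Fin b'))
    (Q : Setoid (Fin b ⊕ Fin c)) (Q' : Setoid (Fin b' ⊕ Fin c')) :
    middleCount (juxtSetoid P P') (juxtSetoid Q Q') = middleCount P Q + middleCount P' Q' ∧
    starSetoid (juxtSetoid P P') (juxtSetoid Q Q') =
      juxtSetoid (starSetoid P Q) (starSetoid P' Q') := by
  apply colourMat_inj
  rw [← colourMat_mul]
  ext x y
  have h1 := congrFun (congrFun (colourMat_mul P Q) (x ∘ Fin.castAdd a')) (y ∘ Fin.castAdd c')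
  have h2 := congrFun (congrFun (colourMat_mul P' Q') (x ∘ Fin.natAdd a)) (y ∘ Fin.natAdd c)
  simp only [Matrix.smul_apply, smul_eq_mul] at h1 h2
  rw [Matrix.smul_apply, smul_eq_mul, pow_add, colourMat_juxt, mul_mul_mul_comm, ← h1, ← h2]
  simp only [Matrix.mul_apply, colourMat_juxt]
  rw [Finset.sum_mul_sum, ← Fintype.sum_prod_type']
  rw [← (Fin.appendEquiv b b').sum_comp]
  refine Finset.sum_congr rfl fun u _ => ?_
  have e1 : (Fin.append u.1 u.2) ∘ Fin.castAdd b' = u.1 := by funext i; simp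
  have e2 : (Fin.append u.1 u.2) ∘ Fin.natAdd b = u.2 := by funext i; simp
  simp only [Fin.appendEquiv, Equiv.coe_fn_mk, e1, e2]
  ring

theorem juxt_id (a b : ℕ) :
    juxtSetoid (idSetoid (Fin a)) (idSetoid (Fin b)) = idSetoid (Fin (a + b)) := by
  apply setoid_ext_colour
  intro c
  rw [← Sum.elim_comp_inl_inr c, juxt_le_iff, idSetoid_le_iff, idSetoid_le_iff, idSetoid_le_iff]
  constructor
  · rintro ⟨h1, h2⟩
    funext i
    refine Fin.addCases (fun j => congrFun h1 j) (fun j => congrFun h2 j) i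
  · intro h
    rw [h]; exact ⟨rfl, rfl⟩

/-- Renumbering the vertices of a partition along equalities. -/
def castSetoid {a b a' b' : ℕ} (h : a' = a) (h' : b' = b) (P : Setoid (Fin a ⊕ Fin b)) :
    Setoid (Fin a' ⊕ Fin b') := P.comap (Sum.map (Fin.cast h) (Fin.cast h'))

theorem castSetoid_le_iff {a b a' b' : ℕ} {κ : Type} (h : a' = a) (h' : b' = b)
    (P : Setoid (Fin a ⊕ Fin b)) (x : Fin a' → κ) (y : Fin b' → κ) :
    castSetoid h h' P ≤ Setoid.ker (Sum.elim x y) ↔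
      P ≤ Setoid.ker (Sum.elim (x ∘ Fin.cast h.symm) (y ∘ Fin.cast h'.symm)) := by
  subst h h'
  simp [castSetoid, Setoid.comap]

theorem juxt_assoc {a b a' b' a'' b'' : ℕ} (P : Setoid (Fin a ⊕ Fin b))
    (P' : Setoid (Fin a' ⊕ Fin b')) (P'' : Setoid (Fin a'' ⊕ Fin b'')) :
    castSetoid rfl (Nat.add_assoc b b' b'').symm (juxtSetoid (juxtSetoid P P') P'') =
      castSetoid (Nat.add_assoc a a' a'') rfl (juxtSetoid P (juxtSetoid P' P'')) := by
  apply setoid_ext_colour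
  intro c
  rw [← Sum.elim_comp_inl_inr c]
  simp only [juxt_le_iff, castSetoid_le_iff, and_assoc]
  refine and_congr ?_ (and_congr ?_ ?_)
  all_goals
    refine iff_of_eq (congrArg (fun f => _ ≤ Setoid.ker f) ?_)
    refine congrArg₂ Sum.elim (funext fun i => ?_) (funext fun i => ?_)
    all_goals
      simp only [Function.comp_apply]
      congr 2
      try (ext; simp [Nat.add_assoc])

theorem empty_juxt {a b : ℕ} (P : Setoid (Fin a ⊕ Fin b)) :
    castSetoid rfl (Nat.zero_add b).symm (juxtSetoid (idSetoid (Fin 0)) P) =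
      castSetoid (Nat.zero_add a) rfl P := by
  apply setoid_ext_colour
  intro c
  rw [← Sum.elim_comp_inl_inr c]
  simp only [juxt_le_iff, castSetoid_le_iff, idSetoid_le_iff]
  rw [and_iff_right (Subsingleton.elim _ _)]
  refine iff_of_eq (congrArg (fun f => _ ≤ Setoid.ker f) ?_)
  refine congrArg₂ Sum.elim (funext fun i => ?_) (funext fun i => ?_)
  all_goals
    simp only [Function.comp_apply]
    congr 2
    try (ext; simp)

theorem juxt_empty {a b : ℕ} (P : Setoid (Fin a ⊕ Fin b)) :
    juxtSetoid P (idSetoid (Fin 0)) = P := by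
  apply setoid_ext_colour
  intro c
  rw [← Sum.elim_comp_inl_inr c]
  simp only [juxt_le_iff, idSetoid_le_iff]
  rw [and_iff_left (Subsingleton.elim _ _)]
  rfl

end Identities

section Linear

variable {𝕜 : Type u} [CommRing 𝕜]

@[elab_as_elim]
theorem parHom_induction {m l : ℕ} {p : (Setoid (Fin m ⊕ Fin l) →₀ 𝕜) → Prop} (f)
    (zero : p 0) (add : ∀ f g, p f → p g → p (f + g)) (smul : ∀ (r : 𝕜) f, p f → p (r • f))
    (single : ∀ P, p (Finsupp.single P 1)) : p f := by
  induction f using Finsupp.induction_linear with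
  | zero => exact zero
  | add f g hf hg => exact add f g hf hg
  | single P r =>
    have : Finsupp.single P r = r • Finsupp.single P (1 : 𝕜) := by simp
    rw [this]; exact smul r _ (single P)

theorem single_pow (t : 𝕜) {m l : ℕ} (P : Setoid (Fin m ⊕ Fin l)) (n : ℕ) :
    Finsupp.single P (t ^ n) = t ^ n • Finsupp.single P (1 : 𝕜) := by simp

theorem parComp_id (t : 𝕜) {m l : ℕ} (f : Setoid (Fin m ⊕ Fin l) →₀ 𝕜) :
    parComp t f (Finsupp.single (idSetoid (Fin l)) 1) = f := by
  induction f using parHom_induction with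
  | zero => simp
  | add f f' hf hf' => simp [hf, hf']
  | smul r f hf => simp [hf]
  | single P =>
  rw [parComp_single, (star_id P).1, (star_id P).2, pow_zero]

theorem id_parComp (t : 𝕜) {m l : ℕ} (f : Setoid (Fin m ⊕ Fin l) →₀ 𝕜) :
    parComp t (Finsupp.single (idSetoid (Fin m)) 1) f = f := by
  induction f using parHom_induction with
  | zero => simp
  | add f f' hf hf' => simp [hf, hf']
  | smul r f hf => simp [hf]
  | single P =>
  rw [parComp_single, (id_star P).1, (id_star P).2, pow_zero]

theorem parComp_assoc (t : 𝕜) {m l k n : ℕ} (f : Setoid (Fin m ⊕ Fin l) →₀ 𝕜)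
    (g : Setoid (Fin l ⊕ Fin k) →₀ 𝕜) (h : Setoid (Fin k ⊕ Fin n) →₀ 𝕜) :
    parComp t (parComp t f g) h = parComp t f (parComp t g h) := by
  induction f using parHom_induction with
  | zero => simp
  | add f f' hf hf' => simp [hf, hf']
  | smul r f hf => simp [hf]
  | single P =>
  induction g using parHom_induction with
  | zero => simp
  | add f f' hf hf' => simp [hf, hf']
  | smul r f hf => simp [hf]
  | single Q =>
  induction h using parHom_induction with
  | zero => simp
  | add f f' hf hf' => simp [hf, hf']
  | smul r f hf => simp [hf]
  | single R =>
  simp only [parComp_single]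
  rw [single_pow, single_pow, map_smul, LinearMap.smul_apply, map_smul, parComp_single,
    parComp_single, single_pow, single_pow, smul_smul, smul_smul, ← pow_add, ← pow_add,
    (star_assoc P Q R).1, (star_assoc P Q R).2]

theorem parTensor_id (a b : ℕ) :
    parTensor 𝕜 (Finsupp.single (idSetoid (Fin a)) 1) (Finsupp.single (idSetoid (Fin b)) 1) =
      Finsupp.single (idSetoid (Fin (a + b))) 1 := by
  rw [parTensor_single, juxt_id]

theorem parTensor_interchange (t : 𝕜) {a b c a' b' c' : ℕ} (f : Setoid (Fin a ⊕ Fin b) →₀ 𝕜)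
    (f' : Setoid (Fin a' ⊕ Fin b') →₀ 𝕜) (g : Setoid (Fin b ⊕ Fin c) →₀ 𝕜)
    (g' : Setoid (Fin b' ⊕ Fin c') →₀ 𝕜) :
    parComp t (parTensor 𝕜 f f') (parTensor 𝕜 g g') =
      parTensor 𝕜 (parComp t f g) (parComp t f' g') := by
  induction f using parHom_induction with
  | zero => simp
  | add f f' hf hf' => simp [hf, hf']
  | smul r f hf => simp [hf]
  | single P =>
  induction f' using parHom_induction with
  | zero => simp
  | add f f' hf hf' => simp [hf, hf']
  | smul r f hf => simp [hf]
  | single P' =>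
  induction g using parHom_induction with
  | zero => simp
  | add f f' hf hf' => simp [hf, hf']
  | smul r f hf => simp [hf]
  | single Q =>
  induction g' using parHom_induction with
  | zero => simp
  | add f f' hf hf' => simp [hf, hf']
  | smul r f hf => simp [hf]
  | single Q' =>
  simp only [parComp_single, parTensor_single]
  rw [single_pow, single_pow t (starSetoid P Q), single_pow t (starSetoid P' Q'), map_smul,
    map_smul, LinearMap.smul_apply, parTensor_single, smul_smul,
    (star_juxt P P' Q Q').1, (star_juxt P P' Q Q').2, pow_add,
    mul_comm]

/-- Renumbering the vertices in a linear combination of partitions. -/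
noncomputable def parCast {a b a' b' : ℕ} (h : a' = a) (h' : b' = b) :
    (Setoid (Fin a ⊕ Fin b) →₀ 𝕜) →ₗ[𝕜] (Setoid (Fin a' ⊕ Fin b') →₀ 𝕜) :=
  Finsupp.lmapDomain 𝕜 𝕜 (castSetoid h h')

theorem parCast_single {a b a' b' : ℕ} (h : a' = a) (h' : b' = b) (P : Setoid (Fin a ⊕ Fin b)) :
    parCast h h' (Finsupp.single P (1 : 𝕜)) = Finsupp.single (castSetoid h h' P) 1 := by
  simp [parCast]

theorem parCast_rfl {m l : ℕ} (f : Setoid (Fin m ⊕ Fin l) →₀ 𝕜) : parCast rfl rfl f = f := by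
  induction f using parHom_induction with
  | zero => simp
  | add f f' hf hf' => simp [hf, hf']
  | smul r f hf => simp [hf]
  | single P =>
  rw [parCast_single]
  congr 1
  ext x y
  rcases x with x | x <;> rcases y with y | y <;> rfl

theorem parTensor_assoc {a b a' b' a'' b'' : ℕ} (f : Setoid (Fin a ⊕ Fin b) →₀ 𝕜)
    (f' : Setoid (Fin a' ⊕ Fin b') →₀ 𝕜) (f'' : Setoid (Fin a'' ⊕ Fin b'') →₀ 𝕜) :
    parCast rfl (Nat.add_assoc b b' b'').symm (parTensor 𝕜 (parTensor 𝕜 f f') f'') =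
      parCast (Nat.add_assoc a a' a'') rfl (parTensor 𝕜 f (parTensor 𝕜 f' f'')) := by
  induction f using parHom_induction with
  | zero => simp
  | add f f' hf hf' => simp [hf, hf']
  | smul r f hf => simp [hf]
  | single P =>
  induction f' using parHom_induction with
  | zero => simp
  | add f f' hf hf' => simp [hf, hf']
  | smul r f hf => simp [hf]
  | single P' =>
  induction f'' using parHom_induction with
  | zero => simp
  | add f f' hf hf' => simp [hf, hf']
  | smul r f hf => simp [hf]
  | single P'' =>
  simp only [parTensor_single, parCast_single, juxt_assoc]

theorem zero_parTensor {a b : ℕ} (f : Setoid (Fin a ⊕ Fin b) →₀ 𝕜) :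
    parCast rfl (Nat.zero_add b).symm
      (parTensor 𝕜 (Finsupp.single (idSetoid (Fin 0)) 1) f) =
        parCast (Nat.zero_add a) rfl f := by
  induction f using parHom_induction with
  | zero => simp
  | add f f' hf hf' => simp [hf, hf']
  | smul r f hf => simp [hf]
  | single P =>
  simp only [parTensor_single, parCast_single, empty_juxt]

theorem parTensor_zero {a b : ℕ} (f : Setoid (Fin a ⊕ Fin b) →₀ 𝕜) :
    parTensor 𝕜 f (Finsupp.single (idSetoid (Fin 0)) 1) = f := by
  induction f using parHom_induction with
  | zero => simp
  | add f f' hf hf' => simp [hf, hf']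
  | smul r f hf => simp [hf]
  | single P =>
  rw [parTensor_single, juxt_empty]

end Linear

/-- The partition category with parameter `t`: objects are natural numbers. -/
structure Par {𝕜 : Type u} [CommRing 𝕜] (t : 𝕜) where
  /-- the number of vertices -/
  n : ℕ

namespace Par

variable {𝕜 : Type u} [CommRing 𝕜] (t : 𝕜)

noncomputable instance : Category (Par t) where
  Hom X Y := Setoid (Fin X.n ⊕ Fin Y.n) →₀ 𝕜
  id X := Finsupp.single (idSetoid (Fin X.n)) 1
  comp f g := parComp t f g
  id_comp f := id_parComp t f
  comp_id f := parComp_id t f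
  assoc f g h := parComp_assoc t f g h

noncomputable instance homGroup (X Y : Par t) : AddCommGroup (X ⟶ Y) :=
  inferInstanceAs (AddCommGroup (Setoid (Fin X.n ⊕ Fin Y.n) →₀ 𝕜))

noncomputable instance homModule (X Y : Par t) : Module 𝕜 (X ⟶ Y) :=
  inferInstanceAs (Module 𝕜 (Setoid (Fin X.n ⊕ Fin Y.n) →₀ 𝕜))

noncomputable instance : Preadditive (Par t) where
  homGroup := homGroup t
  add_comp X Y Z f g h := by
    refine Eq.trans (congrFun (congrArg DFunLike.coe (map_add (parComp t) f g)) h) ?_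
    rfl
  comp_add X Y Z f g h := map_add (parComp t f) g h

noncomputable instance : Linear 𝕜 (Par t) where
  homModule := homModule t
  smul_comp X Y Z r f g := by
    refine Eq.trans (congrFun (congrArg DFunLike.coe (map_smul (parComp t) r f)) g) ?_
    rfl
  comp_smul X Y Z f r g := map_smul (parComp t f) r g

/-- The morphism given by a single partition. -/
noncomputable def ofPartition {m l : ℕ} (P : Setoid (Fin m ⊕ Fin l)) :
    (⟨m⟩ : Par t) ⟶ ⟨l⟩ := Finsupp.single P 1

theorem comp_eqToHom {m l l' : ℕ} (f : (⟨m⟩ : Par t) ⟶ ⟨l⟩) (h : l = l') :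
    f ≫ eqToHom (congrArg mk h) = parCast rfl h.symm f := by
  subst h
  rw [parCast_rfl, eqToHom_refl, Category.comp_id]

theorem eqToHom_comp {m m' l : ℕ} (f : (⟨m⟩ : Par t) ⟶ ⟨l⟩) (h : m' = m) :
    eqToHom (congrArg mk h) ≫ f = parCast h rfl f := by
  subst h
  rw [parCast_rfl, eqToHom_refl, Category.id_comp]

noncomputable instance : MonoidalCategory (Par t) :=
  strictMonoidalCategory (fun X Y => ⟨X.n + Y.n⟩) ⟨0⟩ (fun f g => parTensor 𝕜 f g)
    (fun X Y Z => congrArg mk (Nat.add_assoc X.n Y.n Z.n))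
    (fun X => congrArg mk (Nat.zero_add X.n))
    (fun _ => rfl)
    (fun X Y => parTensor_id X.n Y.n)
    (fun f f' g g' => parTensor_interchange t f f' g g')
    (fun {_ Y _ Y' _ Y''} f f' f'' => (comp_eqToHom t _ (Nat.add_assoc Y.n Y'.n Y''.n)).trans
      ((parTensor_assoc f f' f'').trans (eqToHom_comp t _ _).symm))
    (fun {_ Y} f => (comp_eqToHom t _ (Nat.zero_add Y.n)).trans
      ((zero_parTensor f).trans (eqToHom_comp t _ _).symm))
    (fun f => (Category.comp_id _).trans ((parTensor_zero f).trans (Category.id_comp _).symm))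

instance : IsStrictMonoidal (Par t) where
  tensor_assoc X Y Z := congrArg mk (Nat.add_assoc X.n Y.n Z.n)
  unit_tensor X := congrArg mk (Nat.zero_add X.n)
  tensor_unit _ := rfl
  associator_hom _ _ _ := rfl
  leftUnitor_hom _ := rfl
  rightUnitor_hom _ := rfl

/-- The merge: the one-block partition `2 → 1`. -/
noncomputable def mul : (⟨2⟩ : Par t) ⟶ ⟨1⟩ := ofPartition t ⊤

/-- The split: the one-block partition `1 → 2`. -/
noncomputable def comul : (⟨1⟩ : Par t) ⟶ ⟨2⟩ := ofPartition t ⊤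

/-- The crossing: each bottom vertex is joined with the opposite top vertex. -/
noncomputable def swap : (⟨2⟩ : Par t) ⟶ ⟨2⟩ := ofPartition t (Setoid.ker (Sum.elim id Fin.rev))

/-- The unit pin: the one-block partition `0 → 1`. -/
noncomputable def unit : (⟨0⟩ : Par t) ⟶ ⟨1⟩ := ofPartition t ⊤

/-- The counit pin: the one-block partition `1 → 0`. -/
noncomputable def counit : (⟨1⟩ : Par t) ⟶ ⟨0⟩ := ofPartition t ⊤

end Par

/-! ### Special commutative Frobenius objects -/

/-- The object `X`, with multiplication `μ`, comultiplication `Δ`, crossing `s`, unit `η` and counit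
`ε`, is a `t`-dimensional special commutative Frobenius object, where `s` plays the role of the
symmetry of the tensor powers of `X`. -/
structure IsSpecialCommFrobenius {R : Type*} [CommRing R] (t : R) {C : Type*} [Category* C]
    [Preadditive C] [Linear R C] [MonoidalCategory C] (X : C) (μ : X ⊗ X ⟶ X) (Δ : X ⟶ X ⊗ X)
    (s : X ⊗ X ⟶ X ⊗ X) (η : 𝟙_ C ⟶ X) (ε : X ⟶ 𝟙_ C) : Prop where
  -- `(X, μ, η, Δ, ε)` is a Frobenius object
  one_mul : η ▷ X ≫ μ = (λ_ X).hom
  mul_one : X ◁ η ≫ μ = (ρ_ X).hom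
  counit_comul : Δ ≫ ε ▷ X = (λ_ X).inv
  comul_counit : Δ ≫ X ◁ ε = (ρ_ X).inv
  frobenius_left : X ◁ Δ ≫ (α_ X X X).inv ≫ μ ▷ X = μ ≫ Δ
  frobenius_right : Δ ▷ X ≫ (α_ X X X).hom ≫ X ◁ μ = μ ≫ Δ
  -- `s` satisfies the symmetric group relations
  swap_swap : s ≫ s = 𝟙 (X ⊗ X)
  braid : s ▷ X ≫ (α_ X X X).hom ≫ X ◁ s ≫ (α_ X X X).inv ≫ s ▷ X =
    (α_ X X X).hom ≫ X ◁ s ≫ (α_ X X X).inv ≫ s ▷ X ≫ (α_ X X X).hom ≫ X ◁ s ≫ (α_ X X X).inv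
  -- the structure morphisms are natural with respect to `s`
  swap_unit : (ρ_ X).inv ≫ X ◁ η ≫ s = (λ_ X).inv ≫ η ▷ X
  swap_mul : X ◁ s ≫ (α_ X X X).inv ≫ s ▷ X ≫ (α_ X X X).hom ≫ X ◁ μ =
    (α_ X X X).inv ≫ μ ▷ X ≫ s
  swap_counit : s ≫ X ◁ ε ≫ (ρ_ X).hom = ε ▷ X ≫ (λ_ X).hom
  swap_comul : X ◁ Δ ≫ (α_ X X X).inv ≫ s ▷ X ≫ (α_ X X X).hom ≫ X ◁ s =
    s ≫ Δ ▷ X ≫ (α_ X X X).hom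
  -- commutative, special, of dimension `t`
  comm : s ≫ μ = μ
  special : Δ ≫ μ = 𝟙 X
  dimension : η ≫ ε = t • 𝟙 (𝟙_ C)

/-! The relations among `μ`, `Δ`, `η`, `ε` are formal: zigzags and interchange give the Frobenius
relations, the counterclockwise bubble gives `Δ ; μ = 1`, and `η ; ε` is the clockwise bubble, which
the quotient sets equal to `t`. The work lies in the relations for `s`.

The inversion relations split `↓↑` into `↑↓` and the unit object, hence `↑↓↑↓` into `↑↑↓↓` and `↑↓`.
The idempotent of the second summand is `join = μ ; Δ`, and `s = cross4 + join`, where `cross4`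
permutes the strands of the first summand and vanishes on the second. So `s ; s = 1` reads `cross4 ;
cross4 = 1 - join`. This needs `y ; y = 1`. The crossing `y` is built with the left duality, and
`y_eq_z` identifies it with the rotation `z` built with the right duality, to which the symmetric
group relations transfer easily. The identification rests on the curl, which passes a crossing like
a generator of the degenerate affine Hecke algebra (`curl_x`, `c'_z`).

Naturality of `s` (`mul_swap`, `swap_comul`) comes from sliding cups and caps through crossings;
mixed terms contain a vanishing curl. For the braid relation (`swap_braid`) the identity of `(↑↓)³`
is decomposed (`id_decomposition`): on `↑↑↑↓↓↓` the claim is the braid relation for strands, and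
every other term contains a `join`, where naturality suffices.

The functor is built without a presentation of the partition category. A partition acts directly
(`diagram`): insert units for the top row, link all factors of a common block, apply counits to the
bottom row. A link lets the copairing `η ; Δ` act on two factors. Links commute, are idempotent and
transitive, so a composite of links depends only on the equivalence relation generated (`links_eq`),
and joins of relations become composites (`blocks_sup`). In a composite of two diagrams the middle
row consists of factors between a unit and a counit; removing them one at a time costs nothing for a
factor that is linked to another and a scalar `t` for an isolated one (`ins_blocks_del_gap`). This
gives `diagram_comp`; `diagram_juxt` treats tensor products.

Both halves use components of natural transformations between functors `- ⊗ X`, so that naturality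
replaces interchange and associators disappear from the calculations. -/

set_option linter.unusedSimpArgs false
set_option linter.unusedSectionVars false

/-! ### The Heisenberg relations as identities of natural transformations. -/

/-- The Heisenberg relations for two additive endofunctors `U` and `D`, which stand for tensoring on the right
with `↑` and with `↓`; every diagram is given by its components at all objects. -/
structure HeisAction {C : Type u} [Category.{v} C] [Preadditive C] (U D : C ⥤ C) where
  x : ∀ M, U.obj (U.obj M) ⟶ U.obj (U.obj M)
  c : ∀ M, M ⟶ U.obj (D.obj M)
  d : ∀ M, D.obj (U.obj M) ⟶ M
  c' : ∀ M, M ⟶ D.obj (U.obj M)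
  d' : ∀ M, U.obj (D.obj M) ⟶ M
  x_nat : ∀ {M N} (f : M ⟶ N), U.map (U.map f) ≫ x N = x M ≫ U.map (U.map f)
  c_nat : ∀ {M N} (f : M ⟶ N), f ≫ c N = c M ≫ U.map (D.map f)
  d_nat : ∀ {M N} (f : M ⟶ N), D.map (U.map f) ≫ d N = d M ≫ f
  c'_nat : ∀ {M N} (f : M ⟶ N), f ≫ c' N = c' M ≫ D.map (U.map f)
  d'_nat : ∀ {M N} (f : M ⟶ N), U.map (D.map f) ≫ d' N = d' M ≫ f
  x_x : ∀ M, x M ≫ x M = 𝟙 _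
  braid : ∀ M, U.map (x M) ≫ x (U.obj M) ≫ U.map (x M) = x (U.obj M) ≫ U.map (x M) ≫ x (U.obj M)
  c_d_up : ∀ M, c (U.obj M) ≫ U.map (d M) = 𝟙 _
  c_d_down : ∀ M, D.map (c M) ≫ d (D.obj M) = 𝟙 _
  c'_d'_up : ∀ M, U.map (c' M) ≫ d' (U.obj M) = 𝟙 _
  c'_d'_down : ∀ M, c' (D.obj M) ≫ D.map (d' M) = 𝟙 _
  r_l' : ∀ M, (D.map (U.map (c M)) ≫ D.map (x (D.obj M)) ≫ d (U.obj (D.obj M))) ≫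
    c' (U.obj (D.obj M)) ≫ D.map (x (D.obj M)) ≫ D.map (U.map (d' M)) = 𝟙 _
  l_r' : ∀ M, (c' (U.obj (D.obj M)) ≫ D.map (x (D.obj M)) ≫ D.map (U.map (d' M))) ≫
    D.map (U.map (c M)) ≫ D.map (x (D.obj M)) ≫ d (U.obj (D.obj M)) = 𝟙 _ - d' M ≫ c M
  c_d' : ∀ M, c M ≫ d' M = 𝟙 _

namespace HeisAction

variable {C : Type u} [Category.{v} C] [Preadditive C] {U D : C ⥤ C} (H : HeisAction U D)

/-- The left crossing `↓↑ → ↑↓`. -/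
def l (M : C) : U.obj (D.obj M) ⟶ D.obj (U.obj M) :=
  H.c' (U.obj (D.obj M)) ≫ D.map (H.x (D.obj M)) ≫ D.map (U.map (H.d' M))

/-- The right crossing `↑↓ → ↓↑`. -/
def r (M : C) : D.obj (U.obj M) ⟶ U.obj (D.obj M) :=
  D.map (U.map (H.c M)) ≫ D.map (H.x (D.obj M)) ≫ H.d (U.obj (D.obj M))

/-- The downward crossing. -/
def y (M : C) : D.obj (D.obj M) ⟶ D.obj (D.obj M) :=
  H.c' (D.obj (D.obj M)) ≫ D.map (H.l (D.obj M)) ≫ D.map (D.map (H.d' M))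

/-- The right mate of the right crossing. -/
def z (M : C) : D.obj (D.obj M) ⟶ D.obj (D.obj M) :=
  D.map (D.map (H.c M)) ≫ D.map (H.r (D.obj M)) ≫ H.d (D.obj (D.obj M))

theorem r_l (M : C) : H.r M ≫ H.l M = 𝟙 _ := H.r_l' M

theorem l_r (M : C) : H.l M ≫ H.r M = 𝟙 _ - H.d' M ≫ H.c M := H.l_r' M

/-- The curls vanish as a consequence of the inversion relations and the bubble: `r ; l ; r ; d'` is
`r ; d'` by one inversion relation, and `r ; d' - r ; d' ; c ; d' = 0` by the other together with `c
; d' = 1`. -/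
theorem r_d' (M : C) : H.r M ≫ H.d' M = 0 := by
  have h : H.r M ≫ H.l M ≫ H.r M ≫ H.d' M = 0 := by
    rw [reassoc_of% (H.l_r M)]; simp [H.c_d' M]
  rwa [reassoc_of% (H.r_l M)] at h

theorem c_l (M : C) : H.c M ≫ H.l M = 0 := by
  have h : H.c M ≫ (H.l M ≫ H.r M) ≫ H.l M = 0 := by
    rw [H.l_r M]; simp [reassoc_of% (H.c_d' M)]
  simpa [H.r_l M] using h

theorem l_nat {M N : C} (f : M ⟶ N) : U.map (D.map f) ≫ H.l N = H.l M ≫ D.map (U.map f) := by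
  simp only [l, reassoc_of% H.c'_nat, Category.assoc, ← Functor.map_comp, H.d'_nat,
     reassoc_of% H.x_nat]

theorem r_nat {M N : C} (f : M ⟶ N) : D.map (U.map f) ≫ H.r N = H.r M ≫ U.map (D.map f) := by
  simp only [r, Category.assoc, ← H.d_nat, ← Functor.map_comp, ← Functor.map_comp_assoc, ← H.x_nat]
  simp only [← Functor.map_comp_assoc, ← H.c_nat, Category.assoc]

theorem y_nat {M N : C} (f : M ⟶ N) : D.map (D.map f) ≫ H.y N = H.y M ≫ D.map (D.map f) := by
  simp only [y, reassoc_of% H.c'_nat, Category.assoc, ← Functor.map_comp, H.d'_nat,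
     reassoc_of% H.l_nat]

/-! ### Pitchforks -/

/-- All pitchforks hold for one reason: unfold the rotated crossing, slide the extra cup or cap by
naturality and straighten one zigzag. -/
theorem c'_l (M : C) : U.map (H.c' M) ≫ H.l (U.obj M) = H.c' (U.obj M) ≫ D.map (H.x M) := by
  simp only [l, reassoc_of% H.c'_nat, ← Functor.map_comp, reassoc_of% H.x_nat, H.c'_d'_up]
  simp

theorem x_d' (M : C) : H.x (D.obj M) ≫ U.map (H.d' M) = U.map (H.l M) ≫ H.d' (U.obj M) := by
  rw [l, ← D.map_comp, U.map_comp, Category.assoc, H.d'_nat, reassoc_of% (H.c'_d'_up (U.obj (D.obj M)))]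

theorem l_d' (M : C) : H.l (D.obj M) ≫ D.map (H.d' M) = U.map (H.y M) ≫ H.d' (D.obj M) := by
  rw [y, ← D.map_comp, U.map_comp, Category.assoc, H.d'_nat, reassoc_of% (H.c'_d'_up (D.obj (D.obj M)))]

theorem c'_y (M : C) : D.map (H.c' M) ≫ H.y (U.obj M) = H.c' (D.obj M) ≫ D.map (H.l M) := by
  simp only [y, reassoc_of% H.c'_nat, ← Functor.map_comp, reassoc_of% H.l_nat, H.c'_d'_up]
  simp

theorem c_r_up (M : C) : H.c (U.obj M) ≫ U.map (H.r M) = U.map (H.c M) ≫ H.x (D.obj M) := by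
  simp only [r, Functor.map_comp]
  simp only [← reassoc_of% H.c_nat, H.c_d_up, Category.comp_id]

theorem x_d (M : C) : D.map (H.x M) ≫ H.d (U.obj M) = H.r (U.obj M) ≫ U.map (H.d M) := by
  simp only [r, Category.assoc, ← H.d_nat]
  simp only [← Functor.map_comp_assoc, Category.assoc, ← H.x_nat]
  simp only [← Functor.map_comp_assoc, ← Functor.map_comp, H.c_d_up, ← Category.assoc]
  simp

theorem c_r (M : C) : H.c (D.obj M) ≫ U.map (H.z M) = D.map (H.c M) ≫ H.r (D.obj M) := by
  simp only [z, Functor.map_comp]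
  simp only [← reassoc_of% H.c_nat, H.c_d_up, Category.comp_id]

theorem r_d (M : C) : D.map (H.r M) ≫ H.d (D.obj M) = H.z (U.obj M) ≫ D.map (H.d M) := by
  simp only [z, Category.assoc, ← H.d_nat]
  simp only [← Functor.map_comp_assoc, Category.assoc, ← H.r_nat]
  simp only [← Functor.map_comp_assoc, ← Functor.map_comp, H.c_d_up, ← Category.assoc]
  simp

end HeisAction

/-! ### Rotated crossings, curls and the equality of the two downward crossings. -/

namespace HeisAction

variable {C : Type u} [Category.{v} C] [Preadditive C] {U D : C ⥤ C} (H : HeisAction U D)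

/-- `D` is left adjoint to `U` with unit `c` and counit `d`, so a morphism out of `D.obj N` is
determined by its mate. Passing to mates turns a downward strand upward, which reduces relations
with downward strands to the defining ones. -/
theorem cancel_c {N Q : C} {f g : D.obj N ⟶ Q} (h : H.c N ≫ U.map f = H.c N ≫ U.map g) :
    f = g := by
  have key (k : D.obj N ⟶ Q) : D.map (H.c N ≫ U.map k) ≫ H.d Q = k := by
    rw [D.map_comp, Category.assoc, H.d_nat, reassoc_of% (H.c_d_down N)]
  rw [← key f, h, key g]

/-- The other duality: `U` is left adjoint to `D` with unit `c'` and counit `d'`. -/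
theorem cancel_d' {N Q : C} {f g : Q ⟶ D.obj N} (h : U.map f ≫ H.d' N = U.map g ≫ H.d' N) :
    f = g := by
  have key (k : Q ⟶ D.obj N) : H.c' Q ≫ D.map (U.map k ≫ H.d' N) = k := by
    rw [D.map_comp, ← reassoc_of% H.c'_nat, H.c'_d'_down, Category.comp_id]
  rw [← key f, h, key g]

theorem z_nat {M N : C} (f : M ⟶ N) : D.map (D.map f) ≫ H.z N = H.z M ≫ D.map (D.map f) := by
  simp only [z, Category.assoc, ← H.d_nat, ← Functor.map_comp, ← Functor.map_comp_assoc, ← H.r_nat]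
  simp only [← Functor.map_comp_assoc, ← H.c_nat, Category.assoc]

/-- A third Reidemeister move with one strand turned. After rotation the pitchfork `c_r_up` turns
each `r` into `x`, and the defining braid relation remains. The mixed relations below rotate one
strand more each time. -/
theorem x_r_r (M : C) : D.map (H.x M) ≫ H.r (U.obj M) ≫ U.map (H.r M) =
    H.r (U.obj M) ≫ U.map (H.r M) ≫ H.x (D.obj M) := by
  apply H.cancel_c
  have h := congrArg U.map (H.c_r_up M)
  simp only [Functor.map_comp] at h ⊢
  rw [← reassoc_of% H.c_nat, reassoc_of% (H.c_r_up (U.obj M)), reassoc_of% (H.c_r_up (U.obj M)), ← H.x_nat,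
    ← reassoc_of% H.x_nat, reassoc_of% h, reassoc_of% h, ← reassoc_of% H.x_nat, H.braid]

theorem z_r_r (M : C) : H.z (U.obj M) ≫ D.map (H.r M) ≫ H.r (D.obj M) =
    D.map (H.r M) ≫ H.r (D.obj M) ≫ U.map (H.z M) := by
  apply H.cancel_c
  have h := congrArg D.map (H.c_r_up M)
  have h' := congrArg U.map (H.c_r M)
  simp only [Functor.map_comp] at h h' ⊢
  rw [reassoc_of% (H.c_r (U.obj M)), ← reassoc_of% H.r_nat, reassoc_of% h, H.x_r_r,
    ← reassoc_of% H.c_nat, reassoc_of% (H.c_r_up (D.obj M)), ← H.x_nat, reassoc_of% h', reassoc_of% H.r_nat]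

theorem z_z (M : C) : H.z M ≫ H.z M = 𝟙 _ := by
  apply H.cancel_c
  rw [U.map_comp, reassoc_of% (H.c_r M)]
  -- After the first rotation one strand still points down; the second rotation turns the claim into
  -- `x_x`.
  apply H.cancel_c
  have h' := congrArg U.map (H.c_r M)
  simp only [Functor.map_comp] at h' ⊢
  rw [← reassoc_of% H.c_nat, reassoc_of% (H.c_r_up (D.obj M)), ← H.x_nat, reassoc_of% h',
    ← reassoc_of% H.c_nat, reassoc_of% (H.c_r_up (D.obj M)), H.x_x]
  simp

theorem z_braid (M : C) : D.map (H.z M) ≫ H.z (D.obj M) ≫ D.map (H.z M) =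
    H.z (D.obj M) ≫ D.map (H.z M) ≫ H.z (D.obj M) := by
  apply H.cancel_c
  have h := congrArg D.map (H.c_r M)
  simp only [Functor.map_comp] at h ⊢
  rw [← reassoc_of% H.c_nat, reassoc_of% (H.c_r (D.obj M)), ← H.r_nat, reassoc_of% h,
    reassoc_of% (H.c_r (D.obj M)), ← reassoc_of% H.r_nat, reassoc_of% h, ← H.z_r_r, reassoc_of% H.z_nat]

theorem x_l_l (M : C) : H.x (D.obj M) ≫ U.map (H.l M) ≫ H.l (U.obj M) =
    U.map (H.l M) ≫ H.l (U.obj M) ≫ D.map (H.x M) := by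
  apply H.cancel_d'
  have h := congrArg U.map (H.x_d' M)
  simp only [Functor.map_comp, Category.assoc] at h ⊢
  rw [H.d'_nat, ← H.x_d', ← reassoc_of% (H.x_d' (U.obj M)), reassoc_of% H.x_nat, ← h, reassoc_of% H.x_nat,
    ← reassoc_of% h, H.x_nat, reassoc_of% H.braid]

theorem y_l_l (M : C) : U.map (H.y M) ≫ H.l (D.obj M) ≫ D.map (H.l M) =
    H.l (D.obj M) ≫ D.map (H.l M) ≫ H.y (U.obj M) := by
  apply H.cancel_d'
  have h := congrArg U.map (H.l_d' M)
  have h' := congrArg D.map (H.x_d' M)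
  simp only [Functor.map_comp, Category.assoc] at h h' ⊢
  rw [H.d'_nat, ← H.l_d', ← reassoc_of% H.x_d', reassoc_of% H.x_nat, ← reassoc_of% h,
    reassoc_of% H.l_nat, ← h', H.l_nat, reassoc_of% (H.x_l_l (D.obj M))]

/-- The right curl. -/
def curl (M : C) : U.obj M ⟶ U.obj M := H.c' (U.obj M) ≫ D.map (H.x M) ≫ H.d (U.obj M)

theorem curl_nat {M N : C} (f : M ⟶ N) : U.map f ≫ H.curl N = H.curl M ≫ U.map f := by
  simp only [curl, reassoc_of% H.c'_nat, Category.assoc, ← H.d_nat, ← Functor.map_comp_assoc, H.x_nat]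

theorem c_curl (M : C) : H.c M ≫ H.curl (D.obj M) = H.c' M ≫ H.r M := by
  simp only [curl, r, reassoc_of% H.c'_nat]

/-- Naturality writes the left side as a loop closed around three crossings. After the braid
relation the loop contains `l ; r = 1 - d' ; c`: the identity gives the curl on the other strand,
and `d' ; c` straightens to a single crossing. -/
theorem x_curl_x (M : C) : H.x M ≫ H.curl (U.obj M) ≫ H.x M = U.map (H.curl M) - H.x M := by
  have h1 : H.x M ≫ H.curl (U.obj M) ≫ H.x M = H.c' (U.obj (U.obj M)) ≫
      D.map (U.map (H.x M) ≫ H.x (U.obj M) ≫ U.map (H.x M)) ≫ H.d (U.obj (U.obj M)) := by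
    simp only [curl, Category.assoc, ← H.d_nat, reassoc_of% H.c'_nat, Functor.map_comp]
  rw [h1, H.braid]
  simp only [Functor.map_comp, Category.assoc, H.x_d]
  rw [← reassoc_of% H.c'_l, ← reassoc_of% H.l_nat, reassoc_of% H.l_r, Preadditive.sub_comp,
    Preadditive.comp_sub, Preadditive.comp_sub, Category.id_comp, Category.assoc, H.c_d_up,
    Category.comp_id, H.d'_nat, reassoc_of% (H.c'_d'_up (U.obj M)), curl, Functor.map_comp, Functor.map_comp]

/-- This is the relation between a polynomial generator and a transposition in the degenerate affine
Hecke algebra, with the curl as polynomial generator. -/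
theorem curl_x (M : C) : H.curl (U.obj M) ≫ H.x M = H.x M ≫ U.map (H.curl M) - 𝟙 _ := by
  have h := congrArg (H.x M ≫ ·) (H.x_curl_x M)
  simpa [reassoc_of% (H.x_x M), H.x_x M] using h

variable [U.Additive]

/-- The rotation of `curl_x`; under rotation the identity in the error term becomes `d ; c`. -/
theorem curl_r (M : C) : D.map (H.curl M) ≫ H.r M = H.r M ≫ H.curl (D.obj M) - H.d M ≫ H.c M := by
  apply H.cancel_c
  simp only [Functor.map_comp, Functor.map_sub, Preadditive.comp_sub]
  rw [← reassoc_of% H.c_nat, H.c_r_up, ← reassoc_of% H.curl_nat, H.curl_x, reassoc_of% H.c_r_up,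
    reassoc_of% H.c_d_up, Preadditive.comp_sub, Category.comp_id]

variable [D.Additive]

/-- A pitchfork that mixes the two dualities, and the core of `y_eq_z`. Both sides agree after two
right crossings, which can be cancelled because `r ; l = 1`. The common value is a difference: on
the left the error term comes from a curl passing `r`, on the right from `l ; r = 1 - d' ; c`. -/
theorem c'_z (M : C) : D.map (H.c' M) ≫ H.z (U.obj M) = H.c' (D.obj M) ≫ D.map (H.l M) := by
  have hl : (D.map (H.c' M) ≫ H.z (U.obj M)) ≫ D.map (H.r M) ≫ H.r (D.obj M) =
      H.c (D.obj M) ≫ H.curl (D.obj (D.obj M)) - H.c (D.obj M) ≫ U.map (H.z M) := by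
    rw [Category.assoc, H.z_r_r, ← D.map_comp_assoc, ← H.c_curl, D.map_comp, Category.assoc,
      reassoc_of% (H.curl_r (D.obj M)), Preadditive.sub_comp, Preadditive.comp_sub, Category.assoc,
      Category.assoc, reassoc_of% (H.c_d_down M), ← reassoc_of% (H.c_r M), ← H.curl_nat,
      ← U.map_comp_assoc, H.z_z, U.map_id, Category.id_comp]
  have hr : (H.c' (D.obj M) ≫ D.map (H.l M)) ≫ D.map (H.r M) ≫ H.r (D.obj M) =
      H.c (D.obj M) ≫ H.curl (D.obj (D.obj M)) - H.c (D.obj M) ≫ U.map (H.z M) := by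
    rw [Category.assoc, ← D.map_comp_assoc, H.l_r, D.map_sub, Preadditive.sub_comp, Preadditive.comp_sub,
      D.map_id, Category.id_comp, D.map_comp, Category.assoc, reassoc_of% (H.c'_d'_down M), H.c_curl, H.c_r]
  have h := congrArg (fun f => f ≫ H.l (D.obj M) ≫ D.map (H.l M)) (hl.trans hr.symm)
  simpa only [Category.assoc, reassoc_of% (H.r_l (D.obj M)), ← D.map_comp, H.r_l, D.map_id,
    Category.comp_id] using h

/-- The crossing is cyclic. What was proved for `z` through the right duality now holds for `y`,
including the pitchforks with `c` and `d`. -/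
theorem y_eq_z (M : C) : H.y M = H.z M := by
  rw [y, ← reassoc_of% H.c'_z, ← H.z_nat, ← D.map_comp_assoc, H.c'_d'_down, D.map_id, Category.id_comp]

theorem y_y (M : C) : H.y M ≫ H.y M = 𝟙 _ := by rw [y_eq_z, z_z]

theorem y_braid (M : C) : D.map (H.y M) ≫ H.y (D.obj M) ≫ D.map (H.y M) =
    H.y (D.obj M) ≫ D.map (H.y M) ≫ H.y (D.obj M) := by simp only [y_eq_z, z_braid]

theorem c_y (M : C) : H.c (D.obj M) ≫ U.map (H.y M) = D.map (H.c M) ≫ H.r (D.obj M) := by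
  rw [y_eq_z, c_r]

theorem y_d (M : C) : H.y (U.obj M) ≫ D.map (H.d M) = D.map (H.r M) ≫ H.d (D.obj M) := by
  rw [y_eq_z, r_d]

end HeisAction

/-! ### The crossing of `↑↓` with itself. -/

namespace HeisAction

variable {C : Type u} [Category.{v} C] [Preadditive C] {U D : C ⥤ C} (H : HeisAction U D)

def mul (M : C) : D.obj (U.obj (D.obj (U.obj M))) ⟶ D.obj (U.obj M) := D.map (H.d' (U.obj M))

def comul (M : C) : D.obj (U.obj M) ⟶ D.obj (U.obj (D.obj (U.obj M))) := D.map (H.c (U.obj M))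

/-- The projection to the summand `↑↓` of `↑↓↑↓`. -/
def join (M : C) : D.obj (U.obj (D.obj (U.obj M))) ⟶ D.obj (U.obj (D.obj (U.obj M))) :=
  H.mul M ≫ H.comul M

/-- The interchange of the strands of `↑↓↑↓` in pairs. -/
def cross4 (M : C) : D.obj (U.obj (D.obj (U.obj M))) ⟶ D.obj (U.obj (D.obj (U.obj M))) :=
  D.map (H.l (U.obj M)) ≫ D.map (D.map (H.x M)) ≫ H.y (U.obj (U.obj M)) ≫ D.map (H.r (U.obj M))

def swap (M : C) : D.obj (U.obj (D.obj (U.obj M))) ⟶ D.obj (U.obj (D.obj (U.obj M))) :=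
  H.cross4 M + H.join M

theorem comul_mul (M : C) : H.comul M ≫ H.mul M = 𝟙 _ := by
  rw [mul, comul, ← D.map_comp, H.c_d', D.map_id]

theorem join_join (M : C) : H.join M ≫ H.join M = H.join M := by
  simp only [join, Category.assoc, reassoc_of% H.comul_mul]

variable [D.Additive]

theorem cross4_mul (M : C) : H.cross4 M ≫ H.mul M = 0 := by
  simp only [cross4, mul, Category.assoc, ← D.map_comp, H.r_d', Functor.map_zero, Limits.comp_zero]

theorem comul_cross4 (M : C) : H.comul M ≫ H.cross4 M = 0 := by
  rw [cross4, comul, ← D.map_comp_assoc, H.c_l, D.map_zero, Limits.zero_comp]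

theorem swap_mul' (M : C) : H.swap M ≫ H.mul M = H.mul M := by
  rw [swap, Preadditive.add_comp, cross4_mul, join, Category.assoc, comul_mul]; simp

theorem cross4_join (M : C) : H.cross4 M ≫ H.join M = 0 := by
  rw [join, reassoc_of% H.cross4_mul, Limits.zero_comp]

theorem join_cross4 (M : C) : H.join M ≫ H.cross4 M = 0 := by
  rw [join, Category.assoc, comul_cross4, Limits.comp_zero]

variable [U.Additive]

/-- The inner crossings cancel by `r ; l = 1`, `x ; x = 1` and `y ; y = 1`; the outer pair `l ; r =
1 - d' ; c` leaves the complement of `join`. As `join` is idempotent and annihilates `cross4` on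
both sides, `swap` is an involution. -/
theorem cross4_cross4 (M : C) : H.cross4 M ≫ H.cross4 M = 𝟙 _ - H.join M := by
  have h := congrArg D.map (H.r_l (U.obj M))
  have h' := congrArg (fun f => D.map (D.map f)) (H.x_x M)
  have h'' := congrArg D.map (H.l_r (U.obj M))
  simp only [Functor.map_comp, CategoryTheory.Functor.map_id, Functor.map_sub] at h h' h''
  simp only [cross4, Category.assoc]
  rw [reassoc_of% h, ← reassoc_of% H.y_nat, reassoc_of% (H.y_y), reassoc_of% h', h'', join, mul, comul]

theorem swap_swap (M : C) : H.swap M ≫ H.swap M = 𝟙 _ := by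
  simp only [swap, Preadditive.add_comp, Preadditive.comp_add, cross4_cross4, cross4_join, join_cross4,
    join_join]
  abel

/-- The cup passes through `cross4` up to the defect of `l ; r`. This defect is `comul`, which is
exactly what the summand `join` contributes. The counit behaves in the same way with `mul`. -/
theorem unit_swap (M : C) : H.c' (D.obj (U.obj M)) ≫ H.swap M = D.map (U.map (H.c' M)) := by
  have h1 : H.c' (D.obj (U.obj M)) ≫ H.join M = H.comul M := by
    rw [join, mul, reassoc_of% (H.c'_d'_down (U.obj M))]
  have h := congrArg D.map (H.c'_l M)
  have h'' := congrArg D.map (H.l_r (U.obj M))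
  simp only [Functor.map_comp, CategoryTheory.Functor.map_id, Functor.map_sub] at h h''
  have h4 : D.map (U.map (H.c' M)) ≫ D.map (H.d' (U.obj M)) = 𝟙 _ := by
    rw [← D.map_comp, H.c'_d'_up, D.map_id]
  rw [swap, Preadditive.comp_add, h1, cross4, ← reassoc_of% (H.c'_y (U.obj M)), ← reassoc_of% H.y_nat,
    reassoc_of% (H.y_y), ← reassoc_of% h, h'', Preadditive.comp_sub, reassoc_of% h4, comul]
  simp

theorem swap_counit (M : C) : H.swap M ≫ H.d (D.obj (U.obj M)) = D.map (U.map (H.d M)) := by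
  have h1 : H.join M ≫ H.d (D.obj (U.obj M)) = H.mul M := by
    rw [join, comul, Category.assoc, H.c_d_down, Category.comp_id]
  have h := congrArg D.map (H.x_d M)
  have h'' := congrArg D.map (H.l_r (U.obj M))
  simp only [Functor.map_comp, CategoryTheory.Functor.map_id, Functor.map_sub] at h h''
  have h4 : D.map (H.c (U.obj M)) ≫ D.map (U.map (H.d M)) = 𝟙 _ := by
    rw [← D.map_comp, H.c_d_up, D.map_id]
  rw [swap, Preadditive.add_comp, h1, cross4, Category.assoc, Category.assoc, Category.assoc,
    ← H.y_d, reassoc_of% (H.y_y), h, reassoc_of% h'', Preadditive.sub_comp, Category.assoc, h4, mul]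
  simp

/-- Closing one pair of strands produces a curl: the cap moves from the downward crossing to a left
crossing by `l_d'`, and `c ; l = 0`. -/
theorem trace_cross4 (M : C) : H.comul (D.obj (U.obj M)) ≫ D.map (U.map (H.cross4 M)) ≫
    H.mul (D.obj (U.obj M)) = 0 := by
  have h : H.c (U.obj (D.obj (U.obj M))) ≫ U.map (H.cross4 M) ≫ H.d' (U.obj (D.obj (U.obj M))) = 0 := by
    simp only [cross4, Functor.map_comp, Category.assoc, H.d'_nat, ← reassoc_of% H.c_nat]
    rw [← reassoc_of% H.l_d', reassoc_of% H.c_l]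
    simp
  rw [comul, mul, ← D.map_comp, ← D.map_comp, h, D.map_zero]

/-- The inner cap slides through both crossings. In `hf` two upward crossings cancel by `x ; x = 1`,
in `hg` two sideways crossings by `r ; l = 1`; one `cross4` is left behind the merge. -/
theorem cross4_cross4_mul (M : C) : H.cross4 (D.obj (U.obj M)) ≫ D.map (U.map (H.cross4 M)) ≫
    H.mul (D.obj (U.obj M)) = D.map (U.map (H.mul M)) ≫ H.cross4 M := by
  have hf : H.x (D.obj (U.obj M)) ≫ U.map (H.l (U.obj M)) ≫ U.map (D.map (H.x M)) ≫ H.d' (U.obj (U.obj M)) =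
      U.map (H.d' (U.obj M)) ≫ H.x M := by
    rw [H.d'_nat, ← reassoc_of% H.x_d', reassoc_of% H.x_x]
  have hg : H.r (U.obj (D.obj (U.obj M))) ≫ U.map (H.cross4 M) ≫ H.d' (U.obj (D.obj (U.obj M))) =
      D.map (U.map (H.l (U.obj M)) ≫ U.map (D.map (H.x M)) ≫ H.d' (U.obj (U.obj M))) ≫
        H.r (U.obj M) := by
    simp only [cross4, Functor.map_comp, Category.assoc, H.d'_nat]
    rw [← reassoc_of% H.l_d', ← reassoc_of% H.r_nat, ← reassoc_of% H.r_nat, reassoc_of% H.r_l,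
      ← D.map_comp_assoc (H.d' _), ← H.d'_nat, D.map_comp, Category.assoc]
  rw [cross4, mul, Category.assoc, Category.assoc, Category.assoc, ← D.map_comp, ← D.map_comp, hg,
    D.map_comp, ← reassoc_of% H.y_nat, ← D.map_comp_assoc (D.map _), ← D.map_comp, hf, cross4, mul]
  simp only [Functor.map_comp, Category.assoc]
  rw [← D.map_comp_assoc (H.l _), ← H.l_nat, D.map_comp, Category.assoc]

/-- Of the four terms on the left, the one with two `cross4` is the lemma above; the mixed terms
vanish by `trace_cross4` and by `cross4 ; mul = 0`; the one with two `join` is handled by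
associativity of the merge (`h2'`). -/
theorem mul_swap (M : C) : H.swap (D.obj (U.obj M)) ≫ D.map (U.map (H.swap M)) ≫
    H.mul (D.obj (U.obj M)) = D.map (U.map (H.mul M)) ≫ H.swap M := by
  have h1 : H.join (D.obj (U.obj M)) ≫ D.map (U.map (H.cross4 M)) ≫ H.mul (D.obj (U.obj M)) = 0 := by
    rw [join, Category.assoc, trace_cross4, Limits.comp_zero]
  have h2 : D.map (U.map (H.join M)) ≫ H.mul (D.obj (U.obj M)) =
      H.mul (D.obj (U.obj M)) ≫ H.join M := by
    simp only [join, mul, comul, ← D.map_comp, Functor.map_comp U, Category.assoc, H.d'_nat]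
  have h2' : D.map (U.map (H.mul M)) ≫ H.mul M = H.mul (D.obj (U.obj M)) ≫ H.mul M := by
    simp only [mul, ← D.map_comp, H.d'_nat]
  have h3 : H.join (D.obj (U.obj M)) ≫ H.mul (D.obj (U.obj M)) = H.mul (D.obj (U.obj M)) := by
    rw [join, Category.assoc, comul_mul, Category.comp_id]
  have h4 : H.cross4 (D.obj (U.obj M)) ≫ H.mul (D.obj (U.obj M)) ≫ H.join M = 0 := by
    rw [reassoc_of% H.cross4_mul, Limits.zero_comp]
  simp only [swap, Functor.map_add, Preadditive.add_comp, Preadditive.comp_add, cross4_cross4_mul, h1, h2,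
    reassoc_of% h3, h4]
  rw [join, reassoc_of% h2']
  abel

theorem comul_cross4_cross4 (M : C) : H.comul (D.obj (U.obj M)) ≫ D.map (U.map (H.cross4 M)) ≫
    H.cross4 (D.obj (U.obj M)) = H.cross4 M ≫ D.map (U.map (H.comul M)) := by
  have hf : H.c (U.obj (U.obj M)) ≫ U.map (H.r (U.obj M)) ≫ H.x (D.obj (U.obj M)) =
      U.map (H.c (U.obj M)) := by
    rw [reassoc_of% H.c_r_up, H.x_x, Category.comp_id]
  have hg : H.c (U.obj (D.obj (U.obj M))) ≫ U.map (H.cross4 M) ≫ H.l (U.obj (D.obj (U.obj M))) =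
      H.l (U.obj M) ≫ D.map (H.x M) ≫ D.map (H.c (U.obj (U.obj M)) ≫ U.map (H.r (U.obj M))) := by
    simp only [cross4, Functor.map_comp, Category.assoc, H.l_nat]
    rw [← reassoc_of% H.c_nat, ← reassoc_of% H.c_nat, reassoc_of% H.c_y, reassoc_of% H.r_l]
  have hg' := congrArg D.map hg
  have hf' := congrArg (fun f => D.map (D.map f)) hf
  have hr := congrArg D.map (H.r_nat (H.c (U.obj M)))
  simp only [Functor.map_comp D, Category.assoc] at hg' hf' hr
  have e : H.cross4 (D.obj (U.obj M)) = D.map (H.l (U.obj (D.obj (U.obj M)))) ≫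
      D.map (D.map (H.x (D.obj (U.obj M)))) ≫ H.y (U.obj (U.obj (D.obj (U.obj M)))) ≫
        D.map (H.r (U.obj (D.obj (U.obj M)))) := rfl
  rw [e, comul, reassoc_of% hg', reassoc_of% hf', reassoc_of% H.y_nat, hr]
  simp only [cross4, comul, Category.assoc]

/-- The mirror image of `mul_swap`, with coassociativity in `h2'`. -/
theorem swap_comul (M : C) : H.comul (D.obj (U.obj M)) ≫ D.map (U.map (H.swap M)) ≫
    H.swap (D.obj (U.obj M)) = H.swap M ≫ D.map (U.map (H.comul M)) := by
  have h1 : H.comul (D.obj (U.obj M)) ≫ D.map (U.map (H.cross4 M)) ≫ H.join (D.obj (U.obj M)) = 0 := by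
    rw [join, reassoc_of% H.trace_cross4, Limits.zero_comp]
  have h2 : H.comul (D.obj (U.obj M)) ≫ D.map (U.map (H.join M)) =
      H.join M ≫ H.comul (D.obj (U.obj M)) := by
    simp only [join, mul, comul, ← D.map_comp, Functor.map_comp U, Category.assoc, H.c_nat]
  have h2' : H.comul M ≫ D.map (U.map (H.comul M)) = H.comul M ≫ H.comul (D.obj (U.obj M)) := by
    simp only [comul, ← D.map_comp, ← H.c_nat]
  have h3 : H.comul (D.obj (U.obj M)) ≫ H.join (D.obj (U.obj M)) = H.comul (D.obj (U.obj M)) := by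
    rw [join, reassoc_of% H.comul_mul]
  simp only [swap, Functor.map_add, Preadditive.add_comp, Preadditive.comp_add, comul_cross4_cross4, h1,
    reassoc_of% h2, h3, H.comul_cross4, Limits.comp_zero]
  rw [join, Category.assoc, Category.assoc, h2']
  abel

theorem swap_join (M : C) : H.swap M ≫ H.join M = H.join M := by
  rw [join, reassoc_of% H.swap_mul']

/-- The projection of `(↑↓)³` to its summand `↑↑↑↓↓↓`. -/
def proj6 (M : C) : D.obj (U.obj (D.obj (U.obj (D.obj (U.obj M))))) ⟶ D.obj (D.obj (D.obj (U.obj (U.obj (U.obj M))))) :=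
  D.map (U.map (D.map (H.l (U.obj M)))) ≫ D.map (H.l (D.obj (U.obj (U.obj M)))) ≫ D.map (D.map (H.l (U.obj (U.obj M))))

theorem proj6_eq (M : C) : H.proj6 M = D.map (H.l (U.obj (D.obj (U.obj M)))) ≫ D.map (D.map (U.map (H.l (U.obj M)))) ≫
    D.map (D.map (H.l (U.obj (U.obj M)))) := by
  simp only [proj6, ← D.map_comp, reassoc_of% H.l_nat]

/-- Only `cross4` survives the projection, because `join` ends in the cup `c` and `c ; l = 0`.
Sliding past the left crossings turns the swap into one transposition of upward strands and one of
downward strands. -/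
theorem left_swap_proj6 (M : C) : D.map (U.map (H.swap M)) ≫ H.proj6 M =
    H.proj6 M ≫ D.map (D.map (D.map (U.map (H.x M)))) ≫ D.map (H.y (U.obj (U.obj (U.obj M)))) := by
  have h1 : H.swap M ≫ D.map (H.l (U.obj M)) = D.map (H.l (U.obj M)) ≫ D.map (D.map (H.x M)) ≫
      H.y (U.obj (U.obj M)) := by
    have h2 := congrArg D.map (H.r_l (U.obj M))
    have h3 := congrArg D.map (H.c_l (U.obj M))
    simp only [Functor.map_comp, CategoryTheory.Functor.map_id, Functor.map_zero] at h2 h3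
    simp only [swap, cross4, join, mul, comul, Preadditive.add_comp, Category.assoc, h2, h3, Limits.comp_zero]
    simp
  have h4 := congrArg (fun f => D.map (U.map f)) h1
  have h5 := congrArg D.map (H.y_l_l (U.obj (U.obj M)))
  have h6 := congrArg D.map (H.l_nat (D.map (H.x M)))
  have h7 := congrArg (fun f => D.map (D.map f)) (H.l_nat (H.x M))
  simp only [Functor.map_comp] at h4 h5 h6 h7
  rw [proj6, reassoc_of% h4, h5, reassoc_of% h6, reassoc_of% h7]
  simp only [Category.assoc]

theorem right_swap_proj6 (M : C) : H.swap (D.obj (U.obj M)) ≫ H.proj6 M =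
    H.proj6 M ≫ D.map (D.map (D.map (H.x (U.obj M)))) ≫ H.y (D.obj (U.obj (U.obj (U.obj M)))) := by
  have h1 (M : C) : H.swap M ≫ D.map (H.l (U.obj M)) = D.map (H.l (U.obj M)) ≫ D.map (D.map (H.x M)) ≫
      H.y (U.obj (U.obj M)) := by
    have h2 := congrArg D.map (H.r_l (U.obj M))
    have h3 := congrArg D.map (H.c_l (U.obj M))
    simp only [Functor.map_comp, CategoryTheory.Functor.map_id, Functor.map_zero] at h2 h3
    simp only [swap, cross4, join, mul, comul, Preadditive.add_comp, Category.assoc, h2, h3, Limits.comp_zero]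
    simp
  have h5 := congrArg (fun f => D.map (D.map f)) (H.x_l_l (U.obj M))
  simp only [Functor.map_comp] at h5
  rw [proj6_eq, reassoc_of% h1, ← reassoc_of% H.y_nat, ← H.y_nat, reassoc_of% h5]
  simp only [Category.assoc]

/-- Upward and downward crossings act on different strands, so the relation separates into `braid`
and `y_braid`. -/
theorem perm_braid (M : C) :
    letI a := D.map (D.map (D.map (U.map (H.x M)))) ≫ D.map (H.y (U.obj (U.obj (U.obj M))))
    letI b := D.map (D.map (D.map (H.x (U.obj M)))) ≫ H.y (D.obj (U.obj (U.obj (U.obj M))))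
    a ≫ b ≫ a = b ≫ a ≫ b := by
  have h1 := congrArg (fun f => D.map (D.map (D.map f))) (H.braid M)
  have h2 := H.y_braid (U.obj (U.obj (U.obj M)))
  have h3 {N Q : C} (f : N ⟶ Q) := congrArg D.map (H.y_nat f)
  simp only [Functor.map_comp] at h1 h3
  simp only [Category.assoc, ← reassoc_of% h3, ← reassoc_of% H.y_nat, h2]
  rw [reassoc_of% h1]

theorem cross4_eq (M : C) : H.cross4 M = H.swap M - H.join M := by simp [swap]

/-- The three left crossings of `proj6` are undone one after the other, each time with `l ; r = 1 -
d' ; c`. The terms regroup into the part through `↑↑↑↓↓↓`, an inclusion-exclusion expression in the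
two joins, and a remainder through `↑↑↓↓`. -/
theorem id_decomposition (M : C) : 𝟙 (D.obj (U.obj (D.obj (U.obj (D.obj (U.obj M)))))) =
    H.proj6 M ≫ D.map (D.map (H.r (U.obj (U.obj M)))) ≫ D.map (H.r (D.obj (U.obj (U.obj M)))) ≫
      D.map (U.map (D.map (H.r (U.obj M)))) + D.map (U.map (H.join M)) + H.join (D.obj (U.obj M)) -
    D.map (U.map (H.join M)) ≫ H.join (D.obj (U.obj M)) +
    (D.map (U.map (D.map (H.l (U.obj M)))) ≫ D.map (H.l (D.obj (U.obj (U.obj M)))) ≫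
      D.map (D.map (H.d' (U.obj (U.obj M))))) ≫ D.map (D.map (H.c (U.obj (U.obj M)))) ≫
      D.map (H.r (D.obj (U.obj (U.obj M)))) ≫ D.map (U.map (D.map (H.r (U.obj M)))) := by
  have h1 := congrArg (fun f => D.map (D.map f)) (H.l_r (U.obj (U.obj M)))
  have h2 := congrArg D.map (H.l_r (D.obj (U.obj (U.obj M))))
  have h3 := congrArg (fun f => D.map (U.map (D.map f))) (H.l_r (U.obj M))
  have h4 := congrArg D.map (H.d'_nat (H.l (U.obj M)))
  have h5 := congrArg D.map (H.c_nat (H.r (U.obj M)))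
  have h6 := congrArg D.map (H.d'_nat (H.d' (U.obj M) ≫ H.c (U.obj M)))
  simp only [Functor.map_comp, CategoryTheory.Functor.map_id, Functor.map_sub] at h1 h2 h3 h4 h5 h6
  simp only [proj6, join, mul, comul, Category.assoc, reassoc_of% h1, Preadditive.sub_comp, Preadditive.comp_sub,
    Category.id_comp, reassoc_of% h2, h3, Functor.map_comp, reassoc_of% h4, ← h5, reassoc_of% h6]
  have h7 := congrArg D.map (H.l_r (U.obj M))
  simp only [Functor.map_comp, CategoryTheory.Functor.map_id, Functor.map_sub] at h7
  simp only [reassoc_of% h7, Preadditive.sub_comp, Preadditive.comp_sub,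
    Category.id_comp, Category.assoc]
  abel

/-- Brings the first factor of the remainder in `id_decomposition` into the form `cross4` followed
by `mul`, which `swap_braid` can annihilate. -/
theorem proj6_aux (M : C) : (D.map (U.map (D.map (H.l (U.obj M)))) ≫ D.map (H.l (D.obj (U.obj (U.obj M)))) ≫
      D.map (D.map (H.d' (U.obj (U.obj M))))) =
    D.map (U.map (H.cross4 M)) ≫ H.mul (D.obj (U.obj M)) ≫ D.map (H.l (U.obj M)) ≫ D.map (D.map (H.x M)) := by
  have h1 := congrArg D.map (H.d'_nat (H.r (U.obj M)))
  have h2 := congrArg D.map (H.r_l (U.obj M))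
  have h3 := congrArg D.map (H.l_d' (U.obj (U.obj M)))
  have h4 := congrArg D.map (H.l_nat (D.map (H.x M)))
  have h5 := congrArg (fun f => D.map (D.map f)) (H.d'_nat (H.x M))
  have h6 := congrArg (fun f => D.map (D.map f)) (H.x_x M)
  simp only [Functor.map_comp, CategoryTheory.Functor.map_id] at h1 h2 h3 h4 h5 h6
  simp only [cross4, mul, Functor.map_comp, Category.assoc, reassoc_of% h1, reassoc_of% h2, ← reassoc_of% h3,
    reassoc_of% h4, reassoc_of% h5, h6, Category.comp_id]

/-- The difference `W` of the two sides annihilates every term of `id_decomposition`. For `proj6`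
this is `perm_braid`; for the terms with a join it follows from naturality of the swap with respect
to merge and split. -/
theorem swap_braid (M : C) :
    letI a := D.map (U.map (H.swap M))
    letI b := H.swap (D.obj (U.obj M))
    a ≫ b ≫ a = b ≫ a ≫ b := by
  set a := D.map (U.map (H.swap M)) with ha
  set b := H.swap (D.obj (U.obj M)) with hb
  set e := D.map (U.map (H.join M)) with he
  set f := H.join (D.obj (U.obj M)) with hf
  have aa : a ≫ a = 𝟙 _ := by rw [ha, ← D.map_comp, ← U.map_comp, swap_swap]; simp
  have bb : b ≫ b = 𝟙 _ := H.swap_swap _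
  have ae : a ≫ e = e := by rw [ha, he, ← D.map_comp, ← U.map_comp, swap_join]
  have bf : b ≫ f = f := H.swap_join _
  -- A merge and then a split are moved through two crossings; this carries the join of the right
  -- two pairs to the left two pairs.
  have baf : b ≫ a ≫ f = e ≫ b ≫ a := by
    have h := H.swap_comul M
    have h' : H.swap M ≫ H.comul (D.obj (U.obj M)) = D.map (U.map (H.comul M)) ≫ b ≫ a := by
      have h'' := congrArg (fun k => H.swap M ≫ k ≫ b ≫ a) h
      simpa only [Category.assoc, ← ha, ← hb, reassoc_of% bb, aa, Category.comp_id, reassoc_of% H.swap_swap] using h''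
    rw [hf, join, ha, hb, reassoc_of% H.mul_swap, h', ← ha, ← hb, he, join]
    simp
  have abe : a ≫ b ≫ e = f ≫ a ≫ b := by
    have h := congrArg (fun k => a ≫ b ≫ k ≫ a ≫ b) baf
    simpa [reassoc_of% aa, reassoc_of% bb, aa, bb] using h.symm
  have bfb : b ≫ e ≫ b = a ≫ f ≫ a := by
    have h := congrArg (fun k => a ≫ k ≫ b) abe
    simpa [reassoc_of% aa, reassoc_of% bb, aa, bb] using h
  rw [← sub_eq_zero]
  set W := a ≫ b ≫ a - b ≫ a ≫ b with hW
  have We : W ≫ e = 0 := by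
    simp only [hW, Preadditive.sub_comp, Category.assoc, ae, abe, reassoc_of% bf, sub_self]
  have Wf : W ≫ f = 0 := by
    simp only [hW, Preadditive.sub_comp, Category.assoc, bf, baf, reassoc_of% ae, sub_self]
  have Waf : W ≫ a ≫ f = 0 := by
    simp only [hW, Preadditive.sub_comp, Category.assoc, baf, reassoc_of% aa, bf, reassoc_of% ae,
      reassoc_of% bfb, aa, Category.comp_id, sub_self]
  have Wp : W ≫ H.proj6 M = 0 := by
    have h := H.perm_braid M
    simp only [Category.assoc] at h
    simp only [hW, Preadditive.sub_comp, Category.assoc, ha, hb, left_swap_proj6, reassoc_of% H.left_swap_proj6,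
      right_swap_proj6, reassoc_of% H.right_swap_proj6, h, sub_self]
  -- Here `cross4` is `a - e`, and `mul` absorbs `f`, so `Waf` and `We` suffice.
  have Wx : W ≫ D.map (U.map (H.cross4 M)) ≫ H.mul (D.obj (U.obj M)) = 0 := by
    have h : D.map (U.map (H.cross4 M)) = a - e := by
      rw [cross4_eq, U.map_sub, D.map_sub]
    have h' : H.mul (D.obj (U.obj M)) = f ≫ H.mul (D.obj (U.obj M)) := by
      rw [hf, join, Category.assoc, comul_mul, Category.comp_id]
    rw [h, h', Preadditive.sub_comp a e, Preadditive.comp_sub W, reassoc_of% Waf, reassoc_of% We]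
    simp
  have h := congrArg (W ≫ ·) (H.id_decomposition M)
  simpa only [Category.comp_id, Preadditive.comp_add, Preadditive.comp_sub, ← he, ← hf, proj6_aux, Category.assoc,
    reassoc_of% Wp, We, Wf, reassoc_of% We, reassoc_of% Wx, Limits.zero_comp, add_zero, sub_zero] using h

end HeisAction

/-! ### From an object of a monoidal category to functors. -/

namespace HeisAction
section
variable {C : Type u} [Category.{v} C] [MonoidalCategory C] (u d : C)

/-- The right crossing in a monoidal category. -/
def crossR₀ (x : u ⊗ u ⟶ u ⊗ u) (c : 𝟙_ C ⟶ d ⊗ u) (d₀ : u ⊗ d ⟶ 𝟙_ C) : u ⊗ d ⟶ d ⊗ u :=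
  (λ_ (u ⊗ d)).inv ≫ c ▷ (u ⊗ d) ≫ (α_ d u (u ⊗ d)).hom ≫
    d ◁ ((α_ u u d).inv ≫ x ▷ d ≫ (α_ u u d).hom) ≫ (α_ d u (u ⊗ d)).inv ≫ (d ⊗ u) ◁ d₀ ≫ (ρ_ _).hom

/-- The left crossing in a monoidal category. -/
def crossL₀ (x : u ⊗ u ⟶ u ⊗ u) (c' : 𝟙_ C ⟶ u ⊗ d) (d' : d ⊗ u ⟶ 𝟙_ C) : d ⊗ u ⟶ u ⊗ d :=
  (ρ_ (d ⊗ u)).inv ≫ (d ⊗ u) ◁ c' ≫ (α_ d u (u ⊗ d)).hom ≫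
    d ◁ ((α_ u u d).inv ≫ x ▷ d ≫ (α_ u u d).hom) ≫ (α_ d u (u ⊗ d)).inv ≫ d' ▷ (u ⊗ d) ≫ (λ_ _).hom

/-- A Heisenberg object in a monoidal category acts by tensoring on the right. -/
def ofMonoidal [Preadditive C] [MonoidalPreadditive C]
    (x : u ⊗ u ⟶ u ⊗ u) (c : 𝟙_ C ⟶ d ⊗ u) (d₀ : u ⊗ d ⟶ 𝟙_ C) (c' : 𝟙_ C ⟶ u ⊗ d) (d' : d ⊗ u ⟶ 𝟙_ C)
    (x_x : x ≫ x = 𝟙 _)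
    (braid : x ▷ u ≫ (α_ u u u).hom ≫ u ◁ x ≫ (α_ u u u).inv ≫ x ▷ u =
      (α_ u u u).hom ≫ u ◁ x ≫ (α_ u u u).inv ≫ x ▷ u ≫ (α_ u u u).hom ≫ u ◁ x ≫ (α_ u u u).inv)
    (c_d_up : (ρ_ u).inv ≫ u ◁ c ≫ (α_ u d u).inv ≫ d₀ ▷ u ≫ (λ_ u).hom = 𝟙 _)
    (c_d_down : (λ_ d).inv ≫ c ▷ d ≫ (α_ d u d).hom ≫ d ◁ d₀ ≫ (ρ_ d).hom = 𝟙 _)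
    (c'_d'_up : (λ_ u).inv ≫ c' ▷ u ≫ (α_ u d u).hom ≫ u ◁ d' ≫ (ρ_ u).hom = 𝟙 _)
    (c'_d'_down : (ρ_ d).inv ≫ d ◁ c' ≫ (α_ d u d).inv ≫ d' ▷ d ≫ (λ_ d).hom = 𝟙 _)
    (r_l : crossR₀ u d x c d₀ ≫ crossL₀ u d x c' d' = 𝟙 _)
    (l_r : crossL₀ u d x c' d' ≫ crossR₀ u d x c d₀ = 𝟙 _ - d' ≫ c)
    (c_d' : c ≫ d' = 𝟙 _) : HeisAction (tensorRight u) (tensorRight d) :=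
  letI x' (M : C) : (M ⊗ u) ⊗ u ⟶ (M ⊗ u) ⊗ u := (α_ M u u).hom ≫ M ◁ x ≫ (α_ M u u).inv
  letI c₁ (M : C) : M ⟶ (M ⊗ d) ⊗ u := (ρ_ M).inv ≫ M ◁ c ≫ (α_ M d u).inv
  letI d₁ (M : C) : (M ⊗ u) ⊗ d ⟶ M := (α_ M u d).hom ≫ M ◁ d₀ ≫ (ρ_ M).hom
  letI c'₁ (M : C) : M ⟶ (M ⊗ u) ⊗ d := (ρ_ M).inv ≫ M ◁ c' ≫ (α_ M u d).inv
  letI d'₁ (M : C) : (M ⊗ d) ⊗ u ⟶ M := (α_ M d u).hom ≫ M ◁ d' ≫ (ρ_ M).hom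
  -- Up to coherence, the crossings built from components are whiskerings of `crossR₀` and
  -- `crossL₀`; the inversion relations can then be applied under the whiskering.
  have hr (M : C) : (c₁ M ▷ u) ▷ d ≫ x' (M ⊗ d) ▷ d ≫ d₁ ((M ⊗ d) ⊗ u) =
      (α_ M u d).hom ≫ M ◁ crossR₀ u d x c d₀ ≫ (α_ M d u).inv := by
    simp only [x', c₁, d₁, crossR₀]; monoidal
  have hl (M : C) : c'₁ ((M ⊗ d) ⊗ u) ≫ x' (M ⊗ d) ▷ d ≫ (d'₁ M ▷ u) ▷ d =
      (α_ M d u).hom ≫ M ◁ crossL₀ u d x c' d' ≫ (α_ M u d).inv := by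
    simp only [x', c'₁, d'₁, crossL₀]; monoidal
  { x := x'
    c := c₁
    d := d₁
    c' := c'₁
    d' := d'₁
    x_nat f := by
      dsimp [x']
      simp only [Category.assoc, ← associator_inv_naturality_left, whisker_exchange_assoc,
        associator_naturality_left_assoc]
    c_nat f := by
      dsimp [c₁]
      simp only [Category.assoc, ← associator_inv_naturality_left, whisker_exchange_assoc,
        rightUnitor_inv_naturality_assoc]
    d_nat f := by
      dsimp [d₁]
      simp only [Category.assoc, ← rightUnitor_naturality, whisker_exchange_assoc,
        associator_naturality_left_assoc]
    c'_nat f := by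
      dsimp [c'₁]
      simp only [Category.assoc, ← associator_inv_naturality_left, whisker_exchange_assoc,
        rightUnitor_inv_naturality_assoc]
    d'_nat f := by
      dsimp [d'₁]
      simp only [Category.assoc, ← rightUnitor_naturality, whisker_exchange_assoc,
        associator_naturality_left_assoc]
    x_x M := by
      dsimp [x']
      simp only [Category.assoc, Iso.inv_hom_id_assoc, ← MonoidalCategory.whiskerLeft_comp_assoc, x_x]
      simp
    braid M := by
      dsimp [x']
      calc _ = ⊗𝟙.hom ≫ M ◁ (x ▷ u ≫ (α_ u u u).hom ≫ u ◁ x ≫ (α_ u u u).inv ≫ x ▷ u) ≫ ⊗𝟙.hom := by monoidal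
        _ = _ := by rw [braid]; monoidal
    c_d_up M := by
      dsimp [c₁, d₁]
      calc _ = M ◁ ((ρ_ u).inv ≫ u ◁ c ≫ (α_ u d u).inv ≫ d₀ ▷ u ≫ (λ_ u).hom) := by monoidal
        _ = _ := by rw [c_d_up]; simp
    c_d_down M := by
      dsimp [c₁, d₁]
      calc _ = M ◁ ((λ_ d).inv ≫ c ▷ d ≫ (α_ d u d).hom ≫ d ◁ d₀ ≫ (ρ_ d).hom) := by monoidal
        _ = _ := by rw [c_d_down]; simp
    c'_d'_up M := by
      dsimp [c'₁, d'₁]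
      calc _ = M ◁ ((λ_ u).inv ≫ c' ▷ u ≫ (α_ u d u).hom ≫ u ◁ d' ≫ (ρ_ u).hom) := by monoidal
        _ = _ := by rw [c'_d'_up]; simp
    c'_d'_down M := by
      dsimp [c'₁, d'₁]
      calc _ = M ◁ ((ρ_ d).inv ≫ d ◁ c' ≫ (α_ d u d).inv ≫ d' ▷ d ≫ (λ_ d).hom) := by monoidal
        _ = _ := by rw [c'_d'_down]; simp
    r_l' M := by
      refine (congrArg₂ (· ≫ ·) (hr M) (hl M)).trans ?_
      simp only [Category.assoc, Iso.inv_hom_id_assoc]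
      rw [← MonoidalCategory.whiskerLeft_comp_assoc, r_l]
      simp
    l_r' M := by
      refine (congrArg₂ (· ≫ ·) (hl M) (hr M)).trans ?_
      have h : M ◁ (𝟙 (d ⊗ u) - d' ≫ c) = 𝟙 (M ⊗ d ⊗ u) - M ◁ d' ≫ M ◁ c := by
        refine ((tensorLeft M).map_sub).trans ?_
        simp
      simp only [c₁, d'₁, Category.assoc, Iso.inv_hom_id_assoc, Iso.hom_inv_id_assoc]
      rw [← MonoidalCategory.whiskerLeft_comp_assoc, l_r, h]
      simp
    c_d' M := by
      simp only [c₁, d'₁, Category.assoc, Iso.inv_hom_id_assoc]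
      rw [← MonoidalCategory.whiskerLeft_comp_assoc, c_d']
      simp }
end
end HeisAction

/-! ### The Heisenberg category acting on itself. -/

namespace HeisAction
open HeisTerm Strand
open Heis (ofTerm cls_eq)
variable (𝕜 : Type u) [CommRing 𝕜]

variable {𝕜} in
/-- A formal morphism between words that are given explicitly. -/
abbrev mor (a b : List Strand) (f : HeisTerm 𝕜 a b) : (⟨a⟩ : Heis 𝕜) ⟶ ⟨b⟩ := ofTerm f

/-- The identity morphism of a word that is given explicitly. -/
abbrev wordId (a : List Strand) : (⟨a⟩ : Heis 𝕜) ⟶ ⟨a⟩ := 𝟙 _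

variable {𝕜} in
/-- Adding a strand `↓` to the left of a diagram. -/
def addDown {a b : List Strand} (f : (⟨a⟩ : Heis 𝕜) ⟶ ⟨b⟩) : (⟨down :: a⟩ : Heis 𝕜) ⟶ ⟨down :: b⟩ := Heis.down 𝕜 ◁ f

/-- On explicit words the associators and unitors of `Heis` are definitionally identities. Writing
them as `wordId` lets `simp` erase them. -/
theorem crossR₀_eq : crossR₀ (Heis.up 𝕜) (Heis.down 𝕜) (ofTerm cross) (ofTerm cupR) (ofTerm capR) = ofTerm crossR := by
  change wordId 𝕜 [up, down] ≫ mor [up, down] [down, up, up, down] (.tensor cupR (.id [up, down])) ≫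
    wordId 𝕜 [down, up, up, down] ≫
    addDown (wordId 𝕜 [up, up, down] ≫ mor [up, up, down] [up, up, down] (.tensor cross idDown) ≫
      wordId 𝕜 [up, up, down]) ≫ wordId 𝕜 [down, up, up, down] ≫
      mor [down, up, up, down] [down, up] (.tensor (.id [down, up]) capR) ≫ wordId 𝕜 [down, up] = _
  simp only [Category.id_comp, Category.comp_id]
  rfl

theorem crossL₀_eq : crossL₀ (Heis.up 𝕜) (Heis.down 𝕜) (ofTerm cross) (ofTerm cupL) (ofTerm capL) = ofTerm crossL := by
  change wordId 𝕜 [down, up] ≫ mor [down, up] [down, up, up, down] (.tensor (.id [down, up]) cupL) ≫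
    wordId 𝕜 [down, up, up, down] ≫
    addDown (wordId 𝕜 [up, up, down] ≫ mor [up, up, down] [up, up, down] (.tensor cross idDown) ≫
      wordId 𝕜 [up, up, down]) ≫ wordId 𝕜 [down, up, up, down] ≫
      mor [down, up, up, down] [up, down] (.tensor capL (.id [up, down])) ≫ wordId 𝕜 [up, down] = _
  simp only [Category.id_comp, Category.comp_id]
  rfl

/-- The strands `↑` and `↓` act on the Heisenberg category by tensoring on the right. -/
noncomputable def ofHeis : HeisAction (tensorRight (Heis.up 𝕜)) (tensorRight (Heis.down 𝕜)) :=
  ofMonoidal (Heis.up 𝕜) (Heis.down 𝕜) (ofTerm cross) (ofTerm cupR) (ofTerm capR) (ofTerm cupL) (ofTerm capL)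
    (cls_eq .cross_cross)
    (by
      let i := wordId 𝕜 [up, up, up]
      change mor [up, up, up] [up, up, up] crossId ≫ i ≫ mor [up, up, up] [up, up, up] idCross ≫ i ≫
        mor [up, up, up] [up, up, up] crossId = i ≫ mor [up, up, up] [up, up, up] idCross ≫ i ≫
        mor [up, up, up] [up, up, up] crossId ≫ i ≫ mor [up, up, up] [up, up, up] idCross ≫ i
      simp only [i, Category.id_comp, Category.comp_id]
      exact cls_eq .braid)
    (by
      change wordId 𝕜 [up] ≫ mor [up] [up, down, up] (.tensor idUp cupR) ≫ wordId 𝕜 [up, down, up] ≫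
        mor [up, down, up] [up] (.tensor capR idUp) ≫ wordId 𝕜 [up] = wordId 𝕜 [up]
      simp only [Category.id_comp, Category.comp_id]
      exact cls_eq .zigzag_right_up)
    (by
      change wordId 𝕜 [down] ≫ mor [down] [down, up, down] (.tensor cupR idDown) ≫ wordId 𝕜 [down, up, down] ≫
        mor [down, up, down] [down] (.tensor idDown capR) ≫ wordId 𝕜 [down] = wordId 𝕜 [down]
      simp only [Category.id_comp, Category.comp_id]
      exact cls_eq .zigzag_right_down)
    (by
      change wordId 𝕜 [up] ≫ mor [up] [up, down, up] (.tensor cupL idUp) ≫ wordId 𝕜 [up, down, up] ≫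
        mor [up, down, up] [up] (.tensor idUp capL) ≫ wordId 𝕜 [up] = wordId 𝕜 [up]
      simp only [Category.id_comp, Category.comp_id]
      exact cls_eq .zigzag_left_up)
    (by
      change wordId 𝕜 [down] ≫ mor [down] [down, up, down] (.tensor idDown cupL) ≫ wordId 𝕜 [down, up, down] ≫
        mor [down, up, down] [down] (.tensor capL idDown) ≫ wordId 𝕜 [down] = wordId 𝕜 [down]
      simp only [Category.id_comp, Category.comp_id]
      exact cls_eq .zigzag_left_down)
    (by
      rw [crossR₀_eq, crossL₀_eq]
      exact cls_eq .crossR_crossL)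
    (by
      -- The defining relation is written with `add` and the scalar `-1`, since formal terms have no
      -- subtraction.
      rw [crossR₀_eq, crossL₀_eq, sub_eq_add_neg, ← neg_one_smul 𝕜]
      exact cls_eq .crossL_crossR)
    (cls_eq .ccw_bubble)
end HeisAction

/-! ### Components as whiskered diagrams. -/

namespace HeisAction
section
variable {C : Type u} [Category.{v} C] [MonoidalCategory C] {u d : C}

theorem tensorRight_obj' (X M : C) : (tensorRight X).obj M = M ⊗ X := rfl

theorem tensorRight_map' (X : C) {M N : C} (f : M ⟶ N) : (tensorRight X).map f = f ▷ X := rfl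

/-- The downward crossing in a monoidal category. -/
def crossDown₀ (l : d ⊗ u ⟶ u ⊗ d) (c' : 𝟙_ C ⟶ u ⊗ d) (d' : d ⊗ u ⟶ 𝟙_ C) : d ⊗ d ⟶ d ⊗ d :=
  (ρ_ (d ⊗ d)).inv ≫ (d ⊗ d) ◁ c' ≫ (α_ d d (u ⊗ d)).hom ≫
    d ◁ ((α_ d u d).inv ≫ l ▷ d ≫ (α_ u d d).hom) ≫ (α_ d u (d ⊗ d)).inv ≫ d' ▷ (d ⊗ d) ≫ (λ_ _).hom

/-- The merge in a monoidal category. -/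
def mul₀ (d' : d ⊗ u ⟶ 𝟙_ C) : (u ⊗ d) ⊗ (u ⊗ d) ⟶ u ⊗ d :=
  (α_ u d (u ⊗ d)).hom ≫ u ◁ ((α_ d u d).inv ≫ d' ▷ d ≫ (λ_ d).hom)

/-- The split in a monoidal category. -/
def comul₀ (c : 𝟙_ C ⟶ d ⊗ u) : u ⊗ d ⟶ (u ⊗ d) ⊗ (u ⊗ d) :=
  u ◁ ((λ_ d).inv ≫ c ▷ d ≫ (α_ d u d).hom) ≫ (α_ u d (u ⊗ d)).inv

/-- The crossing of two pairs of strands in a monoidal category. -/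
def cross4₀ (x : u ⊗ u ⟶ u ⊗ u) (y : d ⊗ d ⟶ d ⊗ d) (l : d ⊗ u ⟶ u ⊗ d) (r : u ⊗ d ⟶ d ⊗ u) :
    (u ⊗ d) ⊗ (u ⊗ d) ⟶ (u ⊗ d) ⊗ (u ⊗ d) :=
  (α_ u d (u ⊗ d)).hom ≫ u ◁ ((α_ d u d).inv ≫ l ▷ d ≫ (α_ u d d).hom) ≫ (α_ u u (d ⊗ d)).inv ≫
    (x ⊗ₘ y) ≫ (α_ u u (d ⊗ d)).hom ≫ u ◁ ((α_ u d d).inv ≫ r ▷ d ≫ (α_ d u d).hom) ≫ (α_ u d (u ⊗ d)).inv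

variable [Preadditive C] [MonoidalPreadditive C]

variable {x : u ⊗ u ⟶ u ⊗ u} {c : 𝟙_ C ⟶ d ⊗ u} {d₀ : u ⊗ d ⟶ 𝟙_ C} {c' : 𝟙_ C ⟶ u ⊗ d} {d' : d ⊗ u ⟶ 𝟙_ C}

/-- The components of the action are obtained from diagrams in the monoidal category. -/
structure IsWhiskered (H : HeisAction (tensorRight u) (tensorRight d)) (x : u ⊗ u ⟶ u ⊗ u) (c : 𝟙_ C ⟶ d ⊗ u)
    (d₀ : u ⊗ d ⟶ 𝟙_ C) (c' : 𝟙_ C ⟶ u ⊗ d) (d' : d ⊗ u ⟶ 𝟙_ C) : Prop where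
  x_eq (M : C) : H.x M = (α_ M u u).hom ≫ M ◁ x ≫ (α_ M u u).inv
  c_eq (M : C) : H.c M = (ρ_ M).inv ≫ M ◁ c ≫ (α_ M d u).inv
  d_eq (M : C) : H.d M = (α_ M u d).hom ≫ M ◁ d₀ ≫ (ρ_ M).hom
  c'_eq (M : C) : H.c' M = (ρ_ M).inv ≫ M ◁ c' ≫ (α_ M u d).inv
  d'_eq (M : C) : H.d' M = (α_ M d u).hom ≫ M ◁ d' ≫ (ρ_ M).hom

variable {H : HeisAction (tensorRight u) (tensorRight d)} (W : IsWhiskered H x c d₀ c' d')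
include W

/-- After unfolding, the two sides differ by coherence isomorphisms only. These formulas, ending
with `swap_eq`, connect the components used above with the explicit diagrams in the theorem. -/
theorem IsWhiskered.l_eq (M : C) : H.l M = (α_ M d u).hom ≫ M ◁ crossL₀ u d x c' d' ≫ (α_ M u d).inv := by
  simp only [l, tensorRight_obj', tensorRight_map', W.x_eq, W.c'_eq, W.d'_eq, crossL₀]
  monoidal

theorem IsWhiskered.r_eq (M : C) : H.r M = (α_ M u d).hom ≫ M ◁ crossR₀ u d x c d₀ ≫ (α_ M d u).inv := by
  simp only [r, tensorRight_obj', tensorRight_map', W.x_eq, W.c_eq, W.d_eq, crossR₀]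
  monoidal

theorem IsWhiskered.y_eq (M : C) : H.y M =
    (α_ M d d).hom ≫ M ◁ crossDown₀ (crossL₀ u d x c' d') c' d' ≫ (α_ M d d).inv := by
  simp only [y, tensorRight_obj', tensorRight_map', W.l_eq, W.c'_eq, W.d'_eq, crossDown₀]
  monoidal

theorem IsWhiskered.mul_eq (M : C) : H.mul M =
    (α_ ((M ⊗ u) ⊗ d) u d).hom ≫ (α_ M u d).hom ▷ (u ⊗ d) ≫ (α_ M (u ⊗ d) (u ⊗ d)).hom ≫ M ◁ mul₀ d' ≫
      (α_ M u d).inv := by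
  simp only [mul, tensorRight_obj', tensorRight_map', W.d'_eq, mul₀]
  monoidal

theorem IsWhiskered.comul_eq (M : C) : H.comul M =
    (α_ M u d).hom ≫ M ◁ comul₀ c ≫ (α_ M (u ⊗ d) (u ⊗ d)).inv ≫ (α_ M u d).inv ▷ (u ⊗ d) ≫
      (α_ ((M ⊗ u) ⊗ d) u d).inv := by
  simp only [comul, tensorRight_obj', tensorRight_map', W.c_eq, comul₀]
  monoidal

theorem IsWhiskered.cross4_eq (M : C) : H.cross4 M =
    (α_ ((M ⊗ u) ⊗ d) u d).hom ≫ (α_ M u d).hom ▷ (u ⊗ d) ≫ (α_ M (u ⊗ d) (u ⊗ d)).hom ≫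
      M ◁ cross4₀ x (crossDown₀ (crossL₀ u d x c' d') c' d') (crossL₀ u d x c' d') (crossR₀ u d x c d₀) ≫
      (α_ M (u ⊗ d) (u ⊗ d)).inv ≫ (α_ M u d).inv ▷ (u ⊗ d) ≫
      (α_ ((M ⊗ u) ⊗ d) u d).inv := by
  simp only [cross4, tensorRight_obj', tensorRight_map', W.x_eq, W.y_eq, W.l_eq, W.r_eq, cross4₀, MonoidalCategory.tensorHom_def]
  monoidal

theorem IsWhiskered.swap_eq (M : C) : H.swap M =
    (α_ ((M ⊗ u) ⊗ d) u d).hom ≫ (α_ M u d).hom ▷ (u ⊗ d) ≫ (α_ M (u ⊗ d) (u ⊗ d)).hom ≫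
      M ◁ (cross4₀ x (crossDown₀ (crossL₀ u d x c' d') c' d') (crossL₀ u d x c' d') (crossR₀ u d x c d₀) +
        mul₀ d' ≫ comul₀ c) ≫
      (α_ M (u ⊗ d) (u ⊗ d)).inv ≫ (α_ M u d).inv ▷ (u ⊗ d) ≫
      (α_ ((M ⊗ u) ⊗ d) u d).inv := by
  rw [swap, join, W.cross4_eq, W.mul_eq, W.comul_eq, MonoidalPreadditive.whiskerLeft_add]
  simp only [Preadditive.comp_add, Preadditive.add_comp, Category.assoc, Iso.inv_hom_id_assoc,
    MonoidalCategory.whiskerLeft_comp]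

end

theorem ofHeis_isWhiskered (𝕜 : Type u) [CommRing 𝕜] : IsWhiskered (ofHeis 𝕜) (Heis.ofTerm .cross) (Heis.ofTerm .cupR)
    (Heis.ofTerm .capR) (Heis.ofTerm .cupL) (Heis.ofTerm .capL) :=
  ⟨fun _ => rfl, fun _ => rfl, fun _ => rfl, fun _ => rfl, fun _ => rfl⟩

end HeisAction

/-! ### Evaluation of the action at the empty word and at `↑↓`. -/

namespace HeisAction
open HeisTerm Strand
open Heis (ofTerm cls_eq)
variable (𝕜 : Type u) [CommRing 𝕜]

variable {𝕜} in
/-- Adding a strand `↑` to the left of a diagram. -/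
def addUp {a b : List Strand} (f : (⟨a⟩ : Heis 𝕜) ⟶ ⟨b⟩) : (⟨up :: a⟩ : Heis 𝕜) ⟶ ⟨up :: b⟩ := Heis.up 𝕜 ◁ f

theorem crossDown₀_eq : crossDown₀ (ofTerm (𝕜 := 𝕜) crossL : Heis.down 𝕜 ⊗ Heis.up 𝕜 ⟶ Heis.up 𝕜 ⊗ Heis.down 𝕜)
    (ofTerm cupL) (ofTerm capL) = ofTerm crossDown := by
  change wordId 𝕜 [down, down] ≫ mor [down, down] [down, down, up, down] (.tensor (.id [down, down]) cupL) ≫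
    wordId 𝕜 [down, down, up, down] ≫
    addDown (wordId 𝕜 [down, up, down] ≫ mor [down, up, down] [up, down, down] (.tensor crossL idDown) ≫
      wordId 𝕜 [up, down, down]) ≫ wordId 𝕜 [down, up, down, down] ≫
      mor [down, up, down, down] [down, down] (.tensor capL (.id [down, down])) ≫ wordId 𝕜 [down, down] = _
  simp only [Category.id_comp, Category.comp_id]
  rfl

theorem mul₀_eq : mul₀ (u := Heis.up 𝕜) (d := Heis.down 𝕜) (ofTerm (𝕜 := 𝕜) capL) = ofTerm mulTerm := by
  change wordId 𝕜 [up, down, up, down] ≫ addUp (wordId 𝕜 [down, up, down] ≫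
    mor [down, up, down] [down] (.tensor capL idDown) ≫ wordId 𝕜 [down]) = _
  simp only [Category.id_comp, Category.comp_id]
  rfl

theorem comul₀_eq : comul₀ (u := Heis.up 𝕜) (d := Heis.down 𝕜) (ofTerm (𝕜 := 𝕜) cupR) = ofTerm comulTerm := by
  change addUp (wordId 𝕜 [down] ≫
    mor [down] [down, up, down] (.tensor cupR idDown) ≫ wordId 𝕜 [down, up, down]) ≫ wordId 𝕜 [up, down, up, down] = _
  simp only [Category.id_comp, Category.comp_id]
  rfl

theorem cross4₀_eq : cross4₀ (u := Heis.up 𝕜) (d := Heis.down 𝕜) (ofTerm (𝕜 := 𝕜) cross) (ofTerm (𝕜 := 𝕜) crossDown)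
    (ofTerm (𝕜 := 𝕜) crossL) (ofTerm (𝕜 := 𝕜) crossR) = mor [up, down, up, down] [up, down, up, down]
      (comp (b := [up, up, down, down]) (tensor idUp (tensor crossL idDown))
      (comp (b := [up, up, down, down]) (tensor cross crossDown)
        (tensor idUp (tensor crossR idDown)))) := by
  change wordId 𝕜 [up, down, up, down] ≫ addUp (wordId 𝕜 [down, up, down] ≫
    mor [down, up, down] [up, down, down] (.tensor crossL idDown) ≫ wordId 𝕜 [up, down, down]) ≫
    wordId 𝕜 [up, up, down, down] ≫ mor [up, up, down, down] [up, up, down, down] (tensor cross crossDown) ≫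
    wordId 𝕜 [up, up, down, down] ≫ addUp (wordId 𝕜 [up, down, down] ≫
    mor [up, down, down] [down, up, down] (.tensor crossR idDown) ≫ wordId 𝕜 [down, up, down]) ≫
    wordId 𝕜 [up, down, up, down] = _
  simp only [Category.id_comp, Category.comp_id]
  rfl

/-- The object `↑↓`. -/
abbrev pair : Heis 𝕜 := Heis.up 𝕜 ⊗ Heis.down 𝕜

/-- The crossing of `↑↓` with itself. -/
abbrev pairSwap : pair 𝕜 ⊗ pair 𝕜 ⟶ pair 𝕜 ⊗ pair 𝕜 := ofTerm swapTerm

abbrev pairMul : pair 𝕜 ⊗ pair 𝕜 ⟶ pair 𝕜 := ofTerm mulTerm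

abbrev pairComul : pair 𝕜 ⟶ pair 𝕜 ⊗ pair 𝕜 := ofTerm comulTerm

/-- The associativity isomorphism that separates two copies of `↑↓`. -/
def assoc₂ (M : Heis 𝕜) : (((M ⊗ Heis.up 𝕜) ⊗ Heis.down 𝕜) ⊗ Heis.up 𝕜) ⊗ Heis.down 𝕜 ≅ M ⊗ pair 𝕜 ⊗ pair 𝕜 :=
  α_ ((M ⊗ Heis.up 𝕜) ⊗ Heis.down 𝕜) (Heis.up 𝕜) (Heis.down 𝕜) ≪≫
    whiskerRightIso (α_ M (Heis.up 𝕜) (Heis.down 𝕜)) (pair 𝕜) ≪≫ α_ M (pair 𝕜) (pair 𝕜)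

theorem ofHeis_swap (M : Heis 𝕜) :
    (ofHeis 𝕜).swap M = (assoc₂ 𝕜 M).hom ≫ M ◁ pairSwap 𝕜 ≫ (assoc₂ 𝕜 M).inv := by
  refine ((ofHeis_isWhiskered 𝕜).swap_eq M).trans ?_
  simp only [assoc₂, Iso.trans_hom, Iso.trans_inv, whiskerRightIso_hom, whiskerRightIso_inv, Category.assoc]
  refine congrArg (fun s => (α_ ((M ⊗ Heis.up 𝕜) ⊗ Heis.down 𝕜) (Heis.up 𝕜) (Heis.down 𝕜)).hom ≫
      (α_ M (Heis.up 𝕜) (Heis.down 𝕜)).hom ▷ (pair 𝕜) ≫ (α_ M (pair 𝕜) (pair 𝕜)).hom ≫ M ◁ s ≫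
      (α_ M (pair 𝕜) (pair 𝕜)).inv ≫ (α_ M (Heis.up 𝕜) (Heis.down 𝕜)).inv ▷ (pair 𝕜) ≫
      (α_ ((M ⊗ Heis.up 𝕜) ⊗ Heis.down 𝕜) (Heis.up 𝕜) (Heis.down 𝕜)).inv) ?_
  rw [crossL₀_eq, crossR₀_eq]
  refine congrArg₂ (· + ·) ((congrArg (fun y => cross4₀ (u := Heis.up 𝕜) (d := Heis.down 𝕜) (ofTerm (𝕜 := 𝕜) cross) y
    (ofTerm (𝕜 := 𝕜) crossL) (ofTerm (𝕜 := 𝕜) crossR)) (crossDown₀_eq 𝕜)).trans (cross4₀_eq 𝕜))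
    (congrArg₂ (· ≫ ·) (mul₀_eq 𝕜) (comul₀_eq 𝕜))

theorem ofHeis_mul (M : Heis 𝕜) :
    (ofHeis 𝕜).mul M = (assoc₂ 𝕜 M).hom ≫ M ◁ pairMul 𝕜 ≫ (α_ M (Heis.up 𝕜) (Heis.down 𝕜)).inv := by
  refine ((ofHeis_isWhiskered 𝕜).mul_eq M).trans ?_
  rw [mul₀_eq]
  simp only [assoc₂, Iso.trans_hom, Iso.trans_inv, whiskerRightIso_hom, whiskerRightIso_inv, Category.assoc]
  rfl

theorem ofHeis_comul (M : Heis 𝕜) :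
    (ofHeis 𝕜).comul M = (α_ M (Heis.up 𝕜) (Heis.down 𝕜)).hom ≫ M ◁ pairComul 𝕜 ≫ (assoc₂ 𝕜 M).inv := by
  refine ((ofHeis_isWhiskered 𝕜).comul_eq M).trans ?_
  rw [comul₀_eq]
  simp only [assoc₂, Iso.trans_hom, Iso.trans_inv, whiskerRightIso_hom, whiskerRightIso_inv, Category.assoc]
  rfl

variable {𝕜} in
-- `[] ++ a` reduces to `a`, so the statement needs no transport and is one of the defining
-- relations.
theorem nil_whiskerLeft {X Y : Heis 𝕜} (f : X ⟶ Y) : (⟨[]⟩ : Heis 𝕜) ◁ f = f := by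
  obtain ⟨f, rfl⟩ := Heis.cls_surj f
  exact cls_eq (.unit_tensor f)

theorem assoc₂_nil : (assoc₂ 𝕜 ⟨[]⟩) = Iso.refl (⟨[up, down, up, down]⟩ : Heis 𝕜) := by
  ext
  change wordId 𝕜 [up, down, up, down] ≫ (wordId 𝕜 [up, down] ▷ pair 𝕜) ≫ wordId 𝕜 [up, down, up, down] = _
  rw [id_whiskerRight]
  exact (Category.id_comp _).trans (Category.id_comp _)

theorem assoc₂_pair : (assoc₂ 𝕜 ⟨[up, down]⟩) = Iso.refl (⟨[up, down, up, down, up, down]⟩ : Heis 𝕜) := by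
  ext
  change wordId 𝕜 [up, down, up, down, up, down] ≫ (wordId 𝕜 [up, down, up, down] ▷ pair 𝕜) ≫ wordId 𝕜 [up, down, up, down, up, down] = _
  rw [id_whiskerRight]
  exact (Category.id_comp _).trans (Category.id_comp _)

/-- Components at the empty word are the structure morphisms of `↑↓`; components at `↑↓` are their
copies with one more factor on the left. -/
theorem ofHeis_swap_nil : (ofHeis 𝕜).swap ⟨[]⟩ = pairSwap 𝕜 := by
  refine (ofHeis_swap 𝕜 ⟨[]⟩).trans ?_
  rw [nil_whiskerLeft, assoc₂_nil]
  exact (Category.id_comp _).trans (Category.comp_id _)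

theorem ofHeis_mul_nil : (ofHeis 𝕜).mul ⟨[]⟩ = pairMul 𝕜 := by
  refine (ofHeis_mul 𝕜 ⟨[]⟩).trans ?_
  rw [nil_whiskerLeft, assoc₂_nil]
  exact (Category.id_comp _).trans (Category.comp_id _)

theorem ofHeis_comul_nil : (ofHeis 𝕜).comul ⟨[]⟩ = pairComul 𝕜 := by
  refine (ofHeis_comul 𝕜 ⟨[]⟩).trans ?_
  rw [nil_whiskerLeft, assoc₂_nil]
  exact (Category.id_comp _).trans (Category.comp_id _)

theorem ofHeis_swap_pair : (ofHeis 𝕜).swap ⟨[up, down]⟩ = pair 𝕜 ◁ pairSwap 𝕜 := by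
  refine (ofHeis_swap 𝕜 ⟨[up, down]⟩).trans ?_
  rw [assoc₂_pair]
  exact (Category.id_comp _).trans (Category.comp_id _)

theorem ofHeis_mul_pair : (ofHeis 𝕜).mul ⟨[up, down]⟩ = pair 𝕜 ◁ pairMul 𝕜 := by
  refine (ofHeis_mul 𝕜 ⟨[up, down]⟩).trans ?_
  rw [assoc₂_pair]
  exact (Category.id_comp _).trans (Category.comp_id _)

theorem ofHeis_comul_pair : (ofHeis 𝕜).comul ⟨[up, down]⟩ = pair 𝕜 ◁ pairComul 𝕜 := by
  refine (ofHeis_comul 𝕜 ⟨[up, down]⟩).trans ?_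
  rw [assoc₂_pair]
  exact (Category.id_comp _).trans (Category.comp_id _)

end HeisAction

/-! ### The Frobenius relations for `↑↓`. -/

namespace HeisAction
section
variable {C : Type u} [Category.{v} C] [Preadditive C] {U D : C ⥤ C} (H : HeisAction U D)

/-- Here and in the next five lemmas only zigzags and naturality are needed. -/
theorem unit_mul (M : C) : D.map (U.map (H.c' M)) ≫ H.mul M = 𝟙 _ := by
  rw [mul, ← D.map_comp, H.c'_d'_up, D.map_id]

theorem mul_unit (M : C) : H.c' (D.obj (U.obj M)) ≫ H.mul M = 𝟙 _ := H.c'_d'_down _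

theorem counit_comul (M : C) : H.comul M ≫ D.map (U.map (H.d M)) = 𝟙 _ := by
  rw [comul, ← D.map_comp, H.c_d_up, D.map_id]

theorem comul_counit (M : C) : H.comul M ≫ H.d (D.obj (U.obj M)) = 𝟙 _ := H.c_d_down _

theorem frobenius_left (M : C) : H.comul (D.obj (U.obj M)) ≫ D.map (U.map (H.mul M)) = H.mul M ≫ H.comul M := by
  simp only [mul, comul, ← D.map_comp, H.c_nat]

theorem frobenius_right (M : C) : D.map (U.map (H.comul M)) ≫ H.mul (D.obj (U.obj M)) = H.mul M ≫ H.comul M := by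
  simp only [mul, comul, ← D.map_comp, H.d'_nat]

end

open HeisTerm Strand
open Heis (ofTerm cls_eq)
variable (𝕜 : Type u) [CommRing 𝕜]

/-- The unit of `↑↓`. -/
abbrev pairUnit : 𝟙_ (Heis 𝕜) ⟶ pair 𝕜 := ofTerm cupL

/-- The counit of `↑↓`. -/
abbrev pairCounit : pair 𝕜 ⟶ 𝟙_ (Heis 𝕜) := ofTerm capR

theorem ofHeis_c'_nil : (ofHeis 𝕜).c' ⟨[]⟩ = pairUnit 𝕜 := by
  refine ((ofHeis_isWhiskered 𝕜).c'_eq ⟨[]⟩).trans ?_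
  rw [nil_whiskerLeft]
  exact (Category.id_comp _).trans (Category.comp_id _)

theorem ofHeis_d_nil : (ofHeis 𝕜).d ⟨[]⟩ = pairCounit 𝕜 := by
  refine ((ofHeis_isWhiskered 𝕜).d_eq ⟨[]⟩).trans ?_
  rw [nil_whiskerLeft]
  exact (Category.id_comp _).trans (Category.comp_id _)

theorem ofHeis_c'_pair : (ofHeis 𝕜).c' ⟨[up, down]⟩ = (ρ_ (pair 𝕜)).inv ≫ pair 𝕜 ◁ pairUnit 𝕜 := by
  refine ((ofHeis_isWhiskered 𝕜).c'_eq ⟨[up, down]⟩).trans ?_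
  exact congrArg _ (Category.comp_id _)

theorem ofHeis_d_pair : (ofHeis 𝕜).d ⟨[up, down]⟩ = pair 𝕜 ◁ pairCounit 𝕜 ≫ (ρ_ (pair 𝕜)).hom := by
  refine ((ofHeis_isWhiskered 𝕜).d_eq ⟨[up, down]⟩).trans ?_
  exact (Category.id_comp _)

variable {𝕜} in
/-- Adding `↑↓` to the right of a diagram. -/
def addPair {a b : List Strand} (f : (⟨a⟩ : Heis 𝕜) ⟶ ⟨b⟩) : (⟨a ++ [up] ++ [down]⟩ : Heis 𝕜) ⟶ ⟨b ++ [up] ++ [down]⟩ :=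
  (f ▷ Heis.up 𝕜) ▷ Heis.down 𝕜

theorem addPair_swap : addPair (pairSwap 𝕜) = pairSwap 𝕜 ▷ pair 𝕜 := by
  refine (Eq.trans (whiskerRight_tensor (pairSwap 𝕜) (Heis.up 𝕜) (Heis.down 𝕜)) ?_).symm
  exact (Category.id_comp _).trans (Category.comp_id _)

theorem addPair_mul : addPair (pairMul 𝕜) = pairMul 𝕜 ▷ pair 𝕜 := by
  refine (Eq.trans (whiskerRight_tensor (pairMul 𝕜) (Heis.up 𝕜) (Heis.down 𝕜)) ?_).symm
  exact (Category.id_comp _).trans (Category.comp_id _)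

theorem addPair_comul : addPair (pairComul 𝕜) = pairComul 𝕜 ▷ pair 𝕜 := by
  refine (Eq.trans (whiskerRight_tensor (pairComul 𝕜) (Heis.up 𝕜) (Heis.down 𝕜)) ?_).symm
  exact (Category.id_comp _).trans (Category.comp_id _)

theorem addPair_unit : addPair (pairUnit 𝕜) = pairUnit 𝕜 ▷ pair 𝕜 := by
  refine (Eq.trans (whiskerRight_tensor (pairUnit 𝕜) (Heis.up 𝕜) (Heis.down 𝕜)) ?_).symm
  exact (Category.id_comp _).trans (Category.comp_id _)

theorem addPair_counit : addPair (pairCounit 𝕜) = pairCounit 𝕜 ▷ pair 𝕜 := by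
  refine (Eq.trans (whiskerRight_tensor (pairCounit 𝕜) (Heis.up 𝕜) (Heis.down 𝕜)) ?_).symm
  exact (Category.id_comp _).trans (Category.comp_id _)

/-- Each `pair_` lemma is an identity of components taken at the empty word. The associators and
unitors in the statement are definitionally identities and are inserted or dropped by hand. -/
theorem pair_swap_swap : pairSwap 𝕜 ≫ pairSwap 𝕜 = 𝟙 _ := by
  have := (ofHeis 𝕜).swap_swap ⟨[]⟩
  rw [ofHeis_swap_nil] at this
  exact this

theorem pair_comm : pairSwap 𝕜 ≫ pairMul 𝕜 = pairMul 𝕜 := by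
  have := (ofHeis 𝕜).swap_mul' ⟨[]⟩
  rw [ofHeis_swap_nil, ofHeis_mul_nil] at this
  exact this

theorem pair_special : pairComul 𝕜 ≫ pairMul 𝕜 = 𝟙 _ := by
  have := (ofHeis 𝕜).comul_mul ⟨[]⟩
  rw [ofHeis_comul_nil, ofHeis_mul_nil] at this
  exact this

theorem pair_one_mul : pairUnit 𝕜 ▷ pair 𝕜 ≫ pairMul 𝕜 = (λ_ (pair 𝕜)).hom := by
  have := (ofHeis 𝕜).unit_mul ⟨[]⟩
  rw [ofHeis_c'_nil, ofHeis_mul_nil] at this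
  exact (congrArg (· ≫ _) (addPair_unit 𝕜).symm).trans this

theorem pair_mul_one : pair 𝕜 ◁ pairUnit 𝕜 ≫ pairMul 𝕜 = (ρ_ (pair 𝕜)).hom := by
  have := (ofHeis 𝕜).mul_unit ⟨[]⟩
  rw [ofHeis_mul_nil] at this
  have := (congrArg (· ≫ pairMul 𝕜) (ofHeis_c'_pair 𝕜).symm).trans this
  rw [← Iso.inv_comp_eq_id]
  exact (Category.assoc _ _ _).symm.trans this

theorem pair_counit_comul : pairComul 𝕜 ≫ pairCounit 𝕜 ▷ pair 𝕜 = (λ_ (pair 𝕜)).inv := by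
  have := (ofHeis 𝕜).counit_comul ⟨[]⟩
  rw [ofHeis_d_nil, ofHeis_comul_nil] at this
  exact (congrArg (pairComul 𝕜 ≫ ·) (addPair_counit 𝕜).symm).trans this

theorem pair_comul_counit : pairComul 𝕜 ≫ pair 𝕜 ◁ pairCounit 𝕜 = (ρ_ (pair 𝕜)).inv := by
  have := (ofHeis 𝕜).comul_counit ⟨[]⟩
  rw [ofHeis_comul_nil] at this
  have := (congrArg (pairComul 𝕜 ≫ ·) (ofHeis_d_pair 𝕜).symm).trans this
  rw [← Iso.comp_hom_eq_id]
  exact (Category.assoc _ _ _).trans this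

theorem pair_swap_unit : (ρ_ (pair 𝕜)).inv ≫ pair 𝕜 ◁ pairUnit 𝕜 ≫ pairSwap 𝕜 = (λ_ (pair 𝕜)).inv ≫ pairUnit 𝕜 ▷ pair 𝕜 := by
  have := (ofHeis 𝕜).unit_swap ⟨[]⟩
  rw [ofHeis_swap_nil, ofHeis_c'_nil] at this
  have := (congrArg (· ≫ pairSwap 𝕜) (ofHeis_c'_pair 𝕜).symm).trans (this.trans (addPair_unit 𝕜))
  exact (Category.assoc _ _ _).symm.trans (this.trans (Category.id_comp _).symm)

theorem pair_swap_counit : pairSwap 𝕜 ≫ pair 𝕜 ◁ pairCounit 𝕜 ≫ (ρ_ (pair 𝕜)).hom = pairCounit 𝕜 ▷ pair 𝕜 ≫ (λ_ (pair 𝕜)).hom := by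
  have := (ofHeis 𝕜).swap_counit ⟨[]⟩
  rw [ofHeis_swap_nil, ofHeis_d_nil] at this
  have := (congrArg (pairSwap 𝕜 ≫ ·) (ofHeis_d_pair 𝕜).symm).trans (this.trans (addPair_counit 𝕜))
  exact this.trans (Category.comp_id _).symm

theorem pair_frobenius_left : pair 𝕜 ◁ pairComul 𝕜 ≫ (α_ (pair 𝕜) (pair 𝕜) (pair 𝕜)).inv ≫ pairMul 𝕜 ▷ pair 𝕜 =
    pairMul 𝕜 ≫ pairComul 𝕜 := by
  have := (ofHeis 𝕜).frobenius_left ⟨[]⟩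
  rw [ofHeis_comul_nil, ofHeis_mul_nil] at this
  have := (congrArg₂ (· ≫ ·) (ofHeis_comul_pair 𝕜).symm (addPair_mul 𝕜).symm).trans this
  exact (congrArg (_ ≫ ·) (Category.id_comp _)).trans this

theorem pair_frobenius_right : pairComul 𝕜 ▷ pair 𝕜 ≫ (α_ (pair 𝕜) (pair 𝕜) (pair 𝕜)).hom ≫ pair 𝕜 ◁ pairMul 𝕜 =
    pairMul 𝕜 ≫ pairComul 𝕜 := by
  have := (ofHeis 𝕜).frobenius_right ⟨[]⟩
  rw [ofHeis_comul_nil, ofHeis_mul_nil] at this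
  have := (congrArg₂ (· ≫ ·) (addPair_comul 𝕜).symm (ofHeis_mul_pair 𝕜).symm).trans this
  exact (congrArg (_ ≫ ·) (Category.id_comp _)).trans this

theorem pair_swap_mul : pair 𝕜 ◁ pairSwap 𝕜 ≫ (α_ (pair 𝕜) (pair 𝕜) (pair 𝕜)).inv ≫ pairSwap 𝕜 ▷ pair 𝕜 ≫
    (α_ (pair 𝕜) (pair 𝕜) (pair 𝕜)).hom ≫ pair 𝕜 ◁ pairMul 𝕜 =
      (α_ (pair 𝕜) (pair 𝕜) (pair 𝕜)).inv ≫ pairMul 𝕜 ▷ pair 𝕜 ≫ pairSwap 𝕜 := by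
  have := (ofHeis 𝕜).mul_swap ⟨[]⟩
  rw [ofHeis_swap_nil, ofHeis_mul_nil] at this
  have := (congrArg₂ (· ≫ ·) (ofHeis_swap_pair 𝕜).symm (congrArg₂ (· ≫ ·) (addPair_swap 𝕜).symm
    (ofHeis_mul_pair 𝕜).symm)).trans (this.trans (congrArg (· ≫ pairSwap 𝕜) (addPair_mul 𝕜)))
  refine Eq.trans ?_ (this.trans (Category.id_comp _).symm)
  exact congrArg (_ ≫ ·) ((Category.id_comp _).trans (congrArg (_ ≫ ·) (Category.id_comp _)))

theorem pair_swap_comul : pair 𝕜 ◁ pairComul 𝕜 ≫ (α_ (pair 𝕜) (pair 𝕜) (pair 𝕜)).inv ≫ pairSwap 𝕜 ▷ pair 𝕜 ≫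
    (α_ (pair 𝕜) (pair 𝕜) (pair 𝕜)).hom ≫ pair 𝕜 ◁ pairSwap 𝕜 =
      pairSwap 𝕜 ≫ pairComul 𝕜 ▷ pair 𝕜 ≫ (α_ (pair 𝕜) (pair 𝕜) (pair 𝕜)).hom := by
  have := (ofHeis 𝕜).swap_comul ⟨[]⟩
  rw [ofHeis_swap_nil, ofHeis_comul_nil] at this
  have := (congrArg₂ (· ≫ ·) (ofHeis_comul_pair 𝕜).symm (congrArg₂ (· ≫ ·) (addPair_swap 𝕜).symm
    (ofHeis_swap_pair 𝕜).symm)).trans (this.trans (congrArg (pairSwap 𝕜 ≫ ·) (addPair_comul 𝕜)))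
  refine Eq.trans ?_ (this.trans (congrArg (pairSwap 𝕜 ≫ ·) (Category.comp_id _)).symm)
  exact congrArg (_ ≫ ·) ((Category.id_comp _).trans (congrArg (_ ≫ ·) (Category.id_comp _)))

theorem pair_braid : pairSwap 𝕜 ▷ pair 𝕜 ≫ (α_ (pair 𝕜) (pair 𝕜) (pair 𝕜)).hom ≫ pair 𝕜 ◁ pairSwap 𝕜 ≫
    (α_ (pair 𝕜) (pair 𝕜) (pair 𝕜)).inv ≫ pairSwap 𝕜 ▷ pair 𝕜 =
    (α_ (pair 𝕜) (pair 𝕜) (pair 𝕜)).hom ≫ pair 𝕜 ◁ pairSwap 𝕜 ≫ (α_ (pair 𝕜) (pair 𝕜) (pair 𝕜)).inv ≫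
    pairSwap 𝕜 ▷ pair 𝕜 ≫ (α_ (pair 𝕜) (pair 𝕜) (pair 𝕜)).hom ≫ pair 𝕜 ◁ pairSwap 𝕜 ≫
    (α_ (pair 𝕜) (pair 𝕜) (pair 𝕜)).inv := by
  have := (ofHeis 𝕜).swap_braid ⟨[]⟩
  rw [ofHeis_swap_nil] at this
  have := (congrArg₂ (fun a b => a ≫ b ≫ a) (addPair_swap 𝕜).symm (ofHeis_swap_pair 𝕜).symm).trans
    (this.trans (congrArg₂ (fun a b => b ≫ a ≫ b) (addPair_swap 𝕜) (ofHeis_swap_pair 𝕜)))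
  let W : Heis 𝕜 := ⟨[up, down, up, down, up, down]⟩
  let i : W ⟶ W := 𝟙 _
  let a : W ⟶ W := pairSwap 𝕜 ▷ pair 𝕜
  let b : W ⟶ W := pair 𝕜 ◁ pairSwap 𝕜
  change a ≫ i ≫ b ≫ i ≫ a = i ≫ b ≫ i ≫ a ≫ i ≫ b ≫ i
  simp only [i, Category.id_comp, Category.comp_id]
  exact this

end HeisAction

open HeisAction in
/-- The object `↑↓` of `Peis(t)` is a special commutative Frobenius object of dimension `t`. -/
theorem PeisT.isSpecialCommFrobenius {𝕜 : Type u} [CommRing 𝕜] (t : 𝕜) :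
    IsSpecialCommFrobenius t (PeisT.updown t) (PeisT.mul t) (PeisT.comul t) (PeisT.swap t)
      (PeisT.unit t) (PeisT.counit t) where
  -- All relations except `dimension` hold already in `Heis`. Passing to the full subcategory and
  -- then to the quotient respects composites and tensor products definitionally, so `congrArg`
  -- transfers them.
  one_mul := congrArg (PeisT.homMk t (X := 𝟙_ (PeisT t) ⊗ updown t) (Y := updown t)) (pair_one_mul 𝕜)
  mul_one := congrArg (PeisT.homMk t (X := updown t ⊗ 𝟙_ (PeisT t)) (Y := updown t)) (pair_mul_one 𝕜)
  counit_comul := congrArg (PeisT.homMk t (X := updown t) (Y := 𝟙_ (PeisT t) ⊗ updown t)) (pair_counit_comul 𝕜)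
  comul_counit := congrArg (PeisT.homMk t (X := updown t) (Y := updown t ⊗ 𝟙_ (PeisT t))) (pair_comul_counit 𝕜)
  frobenius_left := congrArg (PeisT.homMk t (X := updown t ⊗ updown t) (Y := updown t ⊗ updown t)) (pair_frobenius_left 𝕜)
  frobenius_right := congrArg (PeisT.homMk t (X := updown t ⊗ updown t) (Y := updown t ⊗ updown t)) (pair_frobenius_right 𝕜)
  swap_swap := congrArg (PeisT.homMk t (X := updown t ⊗ updown t) (Y := updown t ⊗ updown t)) (pair_swap_swap 𝕜)
  braid := congrArg (PeisT.homMk t (X := (updown t ⊗ updown t) ⊗ updown t) (Y := (updown t ⊗ updown t) ⊗ updown t)) (pair_braid 𝕜)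
  swap_unit := congrArg (PeisT.homMk t (X := updown t) (Y := updown t ⊗ updown t)) (pair_swap_unit 𝕜)
  swap_mul := congrArg (PeisT.homMk t (X := updown t ⊗ (updown t ⊗ updown t)) (Y := updown t ⊗ updown t)) (pair_swap_mul 𝕜)
  swap_counit := congrArg (PeisT.homMk t (X := updown t ⊗ updown t) (Y := updown t)) (pair_swap_counit 𝕜)
  swap_comul := congrArg (PeisT.homMk t (X := updown t ⊗ updown t) (Y := updown t ⊗ (updown t ⊗ updown t))) (pair_swap_comul 𝕜)
  comm := congrArg (PeisT.homMk t (X := updown t ⊗ updown t) (Y := updown t)) (pair_comm 𝕜)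
  special := congrArg (PeisT.homMk t (X := updown t) (Y := updown t)) (pair_special 𝕜)
  -- The required difference is the generator of the tensor ideal.
  dimension := TensorQuotient.homMk_eq (.of _ .mk)

/-! ### Frobenius objects through the functor `- ⊗ X`; modules and bridges. -/

/-- The structure of a special commutative Frobenius object `X` of dimension `t`, expressed through the functor `T`
that stands for tensoring on the right with `X`; every morphism is given by its components at all objects. -/
structure FrobeniusAction {R : Type*} [CommRing R] (t : R) {C : Type*} [Category* C] [Preadditive C] [Linear R C]
    (T : C ⥤ C) where
  mul (M : C) : T.obj (T.obj M) ⟶ T.obj M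
  comul (M : C) : T.obj M ⟶ T.obj (T.obj M)
  swap (M : C) : T.obj (T.obj M) ⟶ T.obj (T.obj M)
  unit (M : C) : M ⟶ T.obj M
  counit (M : C) : T.obj M ⟶ M
  mul_nat {M N : C} (f : M ⟶ N) : T.map (T.map f) ≫ mul N = mul M ≫ T.map f
  comul_nat {M N : C} (f : M ⟶ N) : T.map f ≫ comul N = comul M ≫ T.map (T.map f)
  swap_nat {M N : C} (f : M ⟶ N) : T.map (T.map f) ≫ swap N = swap M ≫ T.map (T.map f)
  unit_nat {M N : C} (f : M ⟶ N) : f ≫ unit N = unit M ≫ T.map f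
  counit_nat {M N : C} (f : M ⟶ N) : T.map f ≫ counit N = counit M ≫ f
  unit_mul (M : C) : T.map (unit M) ≫ mul M = 𝟙 _
  mul_unit (M : C) : unit (T.obj M) ≫ mul M = 𝟙 _
  counit_comul (M : C) : comul M ≫ T.map (counit M) = 𝟙 _
  comul_counit (M : C) : comul M ≫ counit (T.obj M) = 𝟙 _
  frobenius_left (M : C) : comul (T.obj M) ≫ T.map (mul M) = mul M ≫ comul M
  frobenius_right (M : C) : T.map (comul M) ≫ mul (T.obj M) = mul M ≫ comul M
  swap_swap (M : C) : swap M ≫ swap M = 𝟙 _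
  braid (M : C) : T.map (swap M) ≫ swap (T.obj M) ≫ T.map (swap M) =
    swap (T.obj M) ≫ T.map (swap M) ≫ swap (T.obj M)
  swap_unit (M : C) : unit (T.obj M) ≫ swap M = T.map (unit M)
  swap_mul (M : C) : swap (T.obj M) ≫ T.map (swap M) ≫ mul (T.obj M) = T.map (mul M) ≫ swap M
  swap_counit (M : C) : swap M ≫ counit (T.obj M) = T.map (counit M)
  swap_comul (M : C) : comul (T.obj M) ≫ T.map (swap M) ≫ swap (T.obj M) = swap M ≫ T.map (comul M)
  comm (M : C) : swap M ≫ mul M = mul M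
  special (M : C) : comul M ≫ mul M = 𝟙 _
  dimension (M : C) : unit M ≫ counit M = t • 𝟙 M

namespace FrobeniusAction

section
variable {R : Type*} [CommRing R] {t : R} {C : Type*} [Category* C] [Preadditive C] [Linear R C]
  {T : C ⥤ C} (S : FrobeniusAction t T)

/-- Associativity is not a field; it follows from the Frobenius relations. A merge is a split
followed by a merge and a counit, in the two ways `h` and `h'`, and naturality of the merge changes
the bracketing underneath `ε`. -/
theorem mul_assoc_counit (M : C) : T.map (S.mul M) ≫ S.mul M ≫ S.counit M =
    S.mul (T.obj M) ≫ S.mul M ≫ S.counit M := by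
  have h : S.mul M = S.comul (T.obj M) ≫ T.map (S.mul M) ≫ T.map (S.counit M) := by
    rw [reassoc_of% S.frobenius_left, S.counit_comul, Category.comp_id]
  have h' : S.mul (T.obj M) = T.map (S.comul (T.obj M)) ≫ S.mul (T.obj (T.obj M)) ≫ S.counit (T.obj (T.obj M)) := by
    rw [reassoc_of% S.frobenius_right, S.comul_counit, Category.comp_id]
  calc _ = T.map (S.comul (T.obj M)) ≫ T.map (T.map (S.mul M ≫ S.counit M)) ≫ S.mul M ≫ S.counit M := by
        nth_rewrite 1 [h]
        simp only [Functor.map_comp, Category.assoc]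
    _ = _ := by
        rw [reassoc_of% S.mul_nat, S.counit_nat]
        conv_rhs => rw [h']
        simp only [Category.assoc]

/-- The second merge is rewritten by `h` so that it ends in `ε`, which reduces associativity to the
previous lemma. -/
theorem mul_assoc (M : C) : T.map (S.mul M) ≫ S.mul M = S.mul (T.obj M) ≫ S.mul M := by
  have h : S.mul M = S.comul (T.obj M) ≫ T.map (S.mul M) ≫ T.map (S.counit M) := by
    rw [reassoc_of% S.frobenius_left, S.counit_comul, Category.comp_id]
  calc _ = S.comul (T.obj (T.obj M)) ≫ T.map (T.map (S.mul M) ≫ S.mul M ≫ S.counit M) := by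
        nth_rewrite 2 [h]
        simp only [Functor.map_comp]
        rw [reassoc_of% S.comul_nat]
    _ = _ := by
        rw [mul_assoc_counit, T.map_comp, reassoc_of% S.frobenius_left, T.map_comp, ← h]

/-- The copairing. -/
def copair (M : C) : M ⟶ T.obj (T.obj M) := S.unit M ≫ S.comul M

theorem copair_nat {M N : C} (f : M ⟶ N) : f ≫ S.copair N = S.copair M ≫ T.map (T.map f) := by
  simp only [copair, reassoc_of% S.unit_nat f, Category.assoc, S.comul_nat]

theorem copair_mul_left (M : C) : S.copair (T.obj M) ≫ T.map (S.mul M) = S.comul M := by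
  simp only [copair, Category.assoc, S.frobenius_left, reassoc_of% S.mul_unit]

theorem copair_mul_right (M : C) : T.map (S.copair M) ≫ S.mul (T.obj M) = S.comul M := by
  simp only [copair, Functor.map_comp, Category.assoc, S.frobenius_right, reassoc_of% S.unit_mul]

theorem map_copair_swap_swap (M : C) : S.copair (T.obj M) ≫ T.map (S.swap M) ≫ S.swap (T.obj M) = T.map (S.copair M) := by
  simp only [copair, Category.assoc, S.swap_comul, reassoc_of% S.swap_unit, Functor.map_comp]

/-- A snake identity for the flipped copairing: naturality moves the flip onto the pairing `μ ; ε`,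
which absorbs it by commutativity. -/
theorem copair_swap_pair (M : C) : S.copair (T.obj M) ≫ S.swap (T.obj M) ≫ T.map (S.mul M) ≫ T.map (S.counit M) = 𝟙 _ := by
  have h : S.swap (T.obj M) ≫ T.map (S.mul M) ≫ T.map (S.counit M) =
      T.map (S.swap M) ≫ S.swap (T.obj M) ≫ S.mul (T.obj M) ≫ S.counit (T.obj M) := by
    rw [← S.swap_counit, ← reassoc_of% S.swap_mul, reassoc_of% S.swap_swap, reassoc_of% S.comm]
  rw [h, reassoc_of% S.map_copair_swap_swap, reassoc_of% S.copair_mul_right, S.comul_counit]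

/-- The copairing and its flip are both inverse to the pairing. The composite in `h`, simplified in
two ways, shows that the inverse is unique. -/
theorem copair_swap (M : C) : S.copair M ≫ S.swap M = S.copair M := by
  have h : S.copair M ≫ S.copair (T.obj (T.obj M)) ≫ S.swap (T.obj (T.obj M)) ≫ T.map (S.mul (T.obj M)) ≫
      T.map (S.counit (T.obj M)) = S.copair M ≫ S.swap M := by
    rw [reassoc_of% S.copair_nat (S.copair M), reassoc_of% S.swap_nat, ← T.map_comp_assoc, S.copair_mul_right,
      ← T.map_comp, S.comul_counit, T.map_id, Category.comp_id]
  rw [← h, S.copair_swap_pair, Category.comp_id]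

theorem swap_mul' (M : C) : T.map (S.swap M) ≫ S.swap (T.obj M) ≫ T.map (S.mul M) = S.mul (T.obj M) ≫ S.swap M := by
  have h := S.swap_mul M
  have h2 : S.mul (T.obj M) = T.map (S.swap M) ≫ S.swap (T.obj M) ≫ T.map (S.mul M) ≫ S.swap M := by
    rw [← h, reassoc_of% S.swap_swap, ← T.map_comp_assoc, S.swap_swap, T.map_id, Category.id_comp]
  conv_rhs => rw [h2]
  simp only [Category.assoc, S.swap_swap, Category.comp_id]

/-- Cocommutativity is not a field. A split is a copairing one of whose legs is merged with the
given factor, so it follows from symmetry of the copairing and commutativity of the merge. -/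
theorem comul_swap (M : C) : S.comul M ≫ S.swap M = S.comul M := by
  have h : S.copair (T.obj M) ≫ T.map (S.swap M) = T.map (S.copair M) ≫ S.swap (T.obj M) := by
    rw [← S.map_copair_swap_swap, Category.assoc, Category.assoc, S.swap_swap, Category.comp_id]
  conv_lhs => rw [← S.copair_mul_right, Category.assoc, ← S.swap_mul', ← T.map_comp_assoc, S.copair_swap]
  rw [← reassoc_of% h, ← T.map_comp, S.comm, S.copair_mul_left]

/-! ### Modules over the Frobenius object -/

/-- The morphism `a` makes `M` a module over the Frobenius object. -/
structure IsModule {M : C} (a : T.obj M ⟶ M) : Prop where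
  unit : S.unit M ≫ a = 𝟙 M
  mul : T.map a ≫ a = S.mul M ≫ a

/-- Two module structures on the same object commute. -/
def Commute {M : C} (a b : T.obj M ⟶ M) : Prop := T.map a ≫ b = S.swap M ≫ T.map b ≫ a

/-- The module structure on `T M` that comes from one on `M`. -/
def lift {M : C} (a : T.obj M ⟶ M) : T.obj (T.obj M) ⟶ T.obj M := S.swap M ≫ T.map a

variable {S}

theorem Commute.symm {M : C} {a b : T.obj M ⟶ M} (h : S.Commute a b) : S.Commute b a := by
  rw [Commute] at *
  rw [h, reassoc_of% S.swap_swap]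

theorem IsModule.commute_self {M : C} {a : T.obj M ⟶ M} (h : S.IsModule a) : S.Commute a a := by
  rw [Commute, h.mul, reassoc_of% S.comm]

theorem isModule_mul (M : C) : S.IsModule (S.mul M) := ⟨S.mul_unit M, S.mul_assoc M⟩

theorem IsModule.lift {M : C} {a : T.obj M ⟶ M} (h : S.IsModule a) : S.IsModule (S.lift a) := by
  constructor
  · rw [FrobeniusAction.lift, reassoc_of% S.swap_unit, ← T.map_comp, h.unit, T.map_id]
  · simp only [FrobeniusAction.lift, T.map_comp, Category.assoc]
    rw [reassoc_of% S.swap_nat, ← T.map_comp, h.mul, T.map_comp, reassoc_of% S.swap_mul']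

theorem Commute.lift {M : C} {a b : T.obj M ⟶ M} (h : S.Commute a b) : S.Commute (S.lift a) (S.lift b) := by
  rw [Commute] at *
  simp only [FrobeniusAction.lift, T.map_comp, Category.assoc]
  rw [reassoc_of% S.swap_nat, reassoc_of% S.swap_nat, ← T.map_comp, h]
  simp only [T.map_comp]
  rw [reassoc_of% S.braid]

theorem commute_lift_mul {M : C} (a : T.obj M ⟶ M) : S.Commute (S.lift a) (S.mul M) := by
  rw [Commute]
  simp only [FrobeniusAction.lift, T.map_comp, Category.assoc]
  rw [S.mul_nat, ← reassoc_of% S.swap_mul, reassoc_of% S.swap_swap]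

variable (S) in
/-- Two tensor factors joined by a bridge: the image of the copairing acts through `a` and `b`. -/
def bridge {M : C} (a b : T.obj M ⟶ M) : M ⟶ M := S.copair M ≫ T.map a ≫ b

theorem Commute.bridge_comm {M : C} {a b : T.obj M ⟶ M} (h : S.Commute a b) : S.bridge a b = S.bridge b a := by
  rw [bridge, bridge, h, reassoc_of% S.copair_swap]

/-- The two legs of the copairing merge again, and `Δ ; μ = 1` removes the loop. -/
theorem IsModule.bridge_self {M : C} {a : T.obj M ⟶ M} (h : S.IsModule a) : S.bridge a a = 𝟙 M := by
  rw [bridge, h.mul, copair, Category.assoc, reassoc_of% S.special, h.unit]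

/-- Bridges are module endomorphisms. -/
theorem bridge_map {M : C} {a b c : T.obj M ⟶ M} (ha : S.Commute a c) (hb : S.Commute b c) :
    T.map (S.bridge a b) ≫ c = c ≫ S.bridge a b := by
  simp only [bridge, T.map_comp, Category.assoc]
  rw [hb, reassoc_of% S.swap_nat]
  conv_rhs => rw [reassoc_of% S.copair_nat, ← T.map_comp_assoc, ha.symm, T.map_comp, T.map_comp]
  rw [← reassoc_of% S.map_copair_swap_swap, reassoc_of% S.swap_swap]
  simp only [Category.assoc]

/-- A bridge is an endomorphism for every action that commutes with both of its ends, hence it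
commutes with bridges between such actions. -/
theorem bridge_bridge_comm {M : C} {a b c d : T.obj M ⟶ M} (hac : S.Commute a c) (hbc : S.Commute b c)
    (had : S.Commute a d) (hbd : S.Commute b d) : S.bridge a b ≫ S.bridge c d = S.bridge c d ≫ S.bridge a b := by
  conv_lhs => rw [bridge.eq_1 S c d, reassoc_of% S.copair_nat, ← T.map_comp_assoc, bridge_map hac hbc, T.map_comp,
    Category.assoc, bridge_map had hbd]
  conv_rhs => rw [bridge.eq_1 S c d, Category.assoc, Category.assoc]

/-- Acting at either end of a bridge amounts to splitting the acting factor and letting the parts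
act through `a` and `b`. Cocommutativity makes the two ends indistinguishable. -/
theorem bridge_transfer {M : C} {a b : T.obj M ⟶ M} (ha : S.IsModule a) (hb : S.IsModule b) (h : S.Commute a b) :
    T.map (S.bridge a b) ≫ a = T.map (S.bridge a b) ≫ b := by
  have key {a b : T.obj M ⟶ M} (hb : S.IsModule b) : T.map (S.bridge a b) ≫ b = S.comul M ≫ T.map a ≫ b := by
    simp only [bridge, T.map_comp, Category.assoc]
    rw [hb.mul, reassoc_of% S.mul_nat, reassoc_of% S.copair_mul_right]
  rw [key hb, h.bridge_comm, key ha, h, reassoc_of% S.comul_swap]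

/-- Transitivity: in the presence of a bridge from `a` to `b`, acting through `b` is acting through
`a`. -/
theorem bridge_bridge {M : C} {a b c : T.obj M ⟶ M} (ha : S.IsModule a) (hb : S.IsModule b) (h : S.Commute a b)
    (hac : S.Commute a c) (hbc : S.Commute b c) :
    S.bridge a b ≫ S.bridge b c = S.bridge a b ≫ S.bridge a c := by
  have key {d : T.obj M ⟶ M} : S.bridge a b ≫ S.bridge c d = S.copair M ≫ T.map c ≫ T.map (S.bridge a b) ≫ d := by
    rw [bridge.eq_1 S c d, reassoc_of% S.copair_nat, ← T.map_comp_assoc, bridge_map hac hbc, T.map_comp,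
    Category.assoc]
  rw [hbc.bridge_comm, hac.bridge_comm, key, key, bridge_transfer ha hb h]

end
end FrobeniusAction

/-! ### Increasing maps between finite ordinals. -/

/-- Strictly increasing maps from `Fin m` to `Fin n`, described from the top. -/
inductive Thin : ℕ → ℕ → Type
  | nil : Thin 0 0
  | keep {m n : ℕ} (f : Thin m n) : Thin (m + 1) (n + 1)
  | skip {m n : ℕ} (f : Thin m n) : Thin m (n + 1)

namespace Thin

/-- The underlying map. -/
def toFun : ∀ {m n : ℕ}, Thin m n → Fin m → Fin n
  | _, _, nil => id
  | _, _, keep (n := n) f => Fin.lastCases (Fin.last n) fun i => (toFun f i).castSucc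
  | _, _, skip f => fun i => (toFun f i).castSucc

instance (m n : ℕ) : CoeFun (Thin m n) fun _ => Fin m → Fin n := ⟨toFun⟩

@[simp] theorem keep_last {m n : ℕ} (f : Thin m n) : f.keep (Fin.last m) = Fin.last n := by simp [toFun]

@[simp] theorem keep_castSucc {m n : ℕ} (f : Thin m n) (i : Fin m) : f.keep i.castSucc = (f i).castSucc := by
  simp [toFun]

@[simp] theorem skip_apply {m n : ℕ} (f : Thin m n) (i : Fin m) : f.skip i = (f i).castSucc := rfl

/-- The values determine the shape: `keep` sends the last point to the last point, whereas `skip`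
misses it. -/
theorem ext {m n : ℕ} {f g : Thin m n} (h : ∀ i, (f i : ℕ) = g i) : f = g := by
  induction f with
  | nil => cases g; rfl
  | @keep m n f ih =>
    cases g with
    | keep g => exact congrArg keep (ih fun i => by simpa using h i.castSucc)
    | skip g =>
      have := h (Fin.last m)
      have h2 := (g (Fin.last m)).isLt
      simp only [keep_last, Fin.val_last, skip_apply, Fin.val_castSucc] at this
      omega
  | @skip m n f ih =>
    cases g with
    | @keep m _ g =>
      have := h (Fin.last m)
      have h2 := (f (Fin.last m)).isLt
      simp only [keep_last, Fin.val_last, skip_apply, Fin.val_castSucc] at this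
      omega
    | skip g => exact congrArg skip (ih fun i => by simpa using h i)

/-- The composite of two increasing maps. -/
def comp : ∀ {a b c : ℕ}, Thin a b → Thin b c → Thin a c
  | _, _, _, f, nil => f
  | _, _, _, f, skip g => skip (comp f g)
  | _, _, _, keep f, keep g => keep (comp f g)
  | _, _, _, skip f, keep g => skip (comp f g)

@[simp] theorem comp_apply : ∀ {a b c : ℕ} (f : Thin a b) (g : Thin b c) (i : Fin a), f.comp g i = g (f i)
  | _, _, _, f, nil, i => by simp only [comp]; rfl
  | _, _, _, f, skip g, i => by simp [comp, comp_apply f g]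
  | _, _, _, keep f, keep g, i => by
    induction i using Fin.lastCases <;> simp [comp, comp_apply f g]
  | _, _, _, skip f, keep g, i => by simp [comp, comp_apply f g]

/-- The identity map. -/
def id : ∀ n, Thin n n
  | 0 => nil
  | n + 1 => keep (id n)

@[simp] theorem id_apply : ∀ (n : ℕ) (i : Fin n), id n i = i
  | 0, i => i.elim0
  | n + 1, i => by induction i using Fin.lastCases <;> simp [id, id_apply n]

/-- Adding further points at the top that are fixed. -/
def pad {m n : ℕ} (f : Thin m n) : ∀ k, Thin (m + k) (n + k)
  | 0 => f
  | k + 1 => keep (pad f k)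

/-- The inclusion of an initial segment. -/
def inl (m : ℕ) : ∀ k, Thin m (m + k)
  | 0 => id m
  | k + 1 => skip (inl m k)

/-- The inclusion of the empty set. -/
def empty : ∀ n, Thin 0 n
  | 0 => nil
  | n + 1 => skip (empty n)

/-- The inclusion of a final segment. -/
def inr (m : ℕ) : ∀ k, Thin k (m + k)
  | 0 => empty m
  | k + 1 => keep (inr m k)

@[simp] theorem inl_val (m k : ℕ) (i : Fin m) : (inl m k i : ℕ) = i := by
  induction k with
  | zero => simp [inl]
  | succ k ih => simpa [inl] using ih

@[simp] theorem inr_val (m k : ℕ) (i : Fin k) : (inr m k i : ℕ) = m + i := by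
  induction k with
  | zero => exact i.elim0
  | succ k ih => induction i using Fin.lastCases <;> simp [inr, ih]

theorem pad_val {m n : ℕ} (f : Thin m n) (k : ℕ) (i : Fin (m + k)) :
    (pad f k i : ℕ) = if h : (i : ℕ) < m then (f ⟨i, h⟩ : ℕ) else n + (i - m) := by
  induction k with
  | zero => simp [pad]
  | succ k ih =>
    induction i using Fin.lastCases with
    | last => simp [pad]
    | cast i => simp [pad, ih]

theorem pad_comp {a b c : ℕ} (f : Thin a b) (g : Thin b c) (k : ℕ) : (f.comp g).pad k = (f.pad k).comp (g.pad k) := by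
  induction k with
  | zero => rfl
  | succ k ih => simp only [pad, comp, ih]

end Thin

/-! ### Powers of the Frobenius object: actions on factors, units and counits. -/

namespace FrobeniusAction

section
variable {R : Type*} [CommRing R] {t : R} {C : Type*} [Category* C] [Preadditive C] [Linear R C]
  {T : C ⥤ C} (S : FrobeniusAction t T) (Z : C)

/-- This and the following lemmas are stated for arbitrary objects, because `pow T Z (n + 1)` and
`T.obj (pow T Z n)` agree only after unfolding; they are applied by `exact`. -/
theorem comp_unit {A B D : C} (f : A ⟶ B) (g : B ⟶ D) :
    (f ≫ g) ≫ S.unit D = (f ≫ S.unit B) ≫ T.map g := by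
  rw [Category.assoc, S.unit_nat, Category.assoc]

theorem comp_unit_of_comm {A B D E : C} {f : A ⟶ B} {i : B ⟶ D} {j : A ⟶ E} {p : E ⟶ D} (h : f ≫ i = j ≫ p) :
    f ≫ i ≫ S.unit D = (j ≫ S.unit E) ≫ T.map p := by
  rw [reassoc_of% h, S.unit_nat, Category.assoc]

theorem counit_comp {A B D : C} (f : A ⟶ B) (g : B ⟶ D) :
    S.counit A ≫ f ≫ g = T.map f ≫ S.counit B ≫ g := by
  rw [reassoc_of% S.counit_nat]

theorem map_lift {M N : C} {g : M ⟶ N} {a : T.obj M ⟶ M} {b : T.obj N ⟶ N} (h : T.map g ≫ b = a ≫ g) :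
    T.map (T.map g) ≫ S.lift b = S.lift a ≫ T.map g := by
  rw [lift, lift, reassoc_of% S.swap_nat, ← T.map_comp, h, T.map_comp, Category.assoc]

theorem comp_unit_lift {M N : C} {g : M ⟶ N} {a : T.obj M ⟶ M} {b : T.obj N ⟶ N} (h : T.map g ≫ b = a ≫ g) :
    T.map (g ≫ S.unit N) ≫ S.lift b = a ≫ g ≫ S.unit N := by
  rw [lift, T.map_comp, Category.assoc, ← S.swap_unit, Category.assoc, reassoc_of% S.swap_swap, ← S.unit_nat,
    reassoc_of% h]

theorem lift_counit_comp {M N : C} {g : M ⟶ N} {a : T.obj M ⟶ M} {b : T.obj N ⟶ N} (h : T.map g ≫ b = a ≫ g) :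
    T.map (S.counit M ≫ g) ≫ b = S.lift a ≫ S.counit M ≫ g := by
  rw [lift, T.map_comp, Category.assoc, h, Category.assoc, reassoc_of% S.counit_nat, reassoc_of% S.swap_counit]

variable (T) in
/-- The iterates of `T` applied to an object. -/
def pow : ℕ → C
  | 0 => Z
  | n + 1 => T.obj (pow n)

/-- The action of the Frobenius object on one of the factors of a power. -/
def act : ∀ (n : ℕ) (_ : Fin n), T.obj (pow T Z n) ⟶ pow T Z n
  | n + 1, i => Fin.lastCases (motive := fun _ => T.obj (T.obj (pow T Z n)) ⟶ T.obj (pow T Z n))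
      (S.mul (pow T Z n)) (fun j => S.lift (act n j)) i

theorem act_last (n : ℕ) : S.act Z (n + 1) (Fin.last n) = S.mul (pow T Z n) := by
  simp only [act, Fin.lastCases_last]; rfl

theorem act_castSucc (n : ℕ) (i : Fin n) : S.act Z (n + 1) i.castSucc = S.lift (S.act Z n i) := by
  simp only [act, Fin.lastCases_castSucc]; rfl

theorem act_isModule : ∀ (n : ℕ) (i : Fin n), S.IsModule (S.act Z n i)
  | n + 1, i => by
    induction i using Fin.lastCases with
    | last => rw [act_last]; exact isModule_mul _
    | cast i => rw [act_castSucc]; exact (act_isModule n i).lift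

theorem act_commute : ∀ (n : ℕ) (i j : Fin n), S.Commute (S.act Z n i) (S.act Z n j)
  | n + 1, i, j => by
    induction i using Fin.lastCases with
    | last =>
      induction j using Fin.lastCases with
      | last => exact (S.act_isModule Z _ _).commute_self
      | cast j => rw [act_last, act_castSucc]; exact (commute_lift_mul _).symm
    | cast i =>
      induction j using Fin.lastCases with
      | last => rw [act_last, act_castSucc]; exact commute_lift_mul _
      | cast j => rw [act_castSucc, act_castSucc]; exact (act_commute n i j).lift

/-- Insertion of units. -/
def ins : ∀ {m n : ℕ}, Thin m n → (pow T Z m ⟶ pow T Z n)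
  | _, _, .nil => 𝟙 _
  | _, _, .keep f => T.map (ins f)
  | _, _, .skip f => ins f ≫ S.unit _

/-- Deletion by counits. -/
def del : ∀ {m n : ℕ}, Thin m n → (pow T Z n ⟶ pow T Z m)
  | _, _, .nil => 𝟙 _
  | _, _, .keep f => T.map (del f)
  | _, _, .skip f => S.counit _ ≫ del f

theorem ins_id : ∀ n, S.ins Z (Thin.id n) = 𝟙 _
  | 0 => rfl
  | n + 1 => (congrArg T.map (ins_id n)).trans (T.map_id _)

theorem del_id : ∀ n, S.del Z (Thin.id n) = 𝟙 _
  | 0 => rfl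
  | n + 1 => (congrArg T.map (del_id n)).trans (T.map_id _)

theorem ins_comp : ∀ {a b c : ℕ} (f : Thin a b) (g : Thin b c), S.ins Z (f.comp g) = S.ins Z f ≫ S.ins Z g
  | _, _, _, f, .nil => by simp only [Thin.comp]; exact (Category.comp_id _).symm
  | _, _, _, f, .skip g => by
    simp only [Thin.comp, ins]
    rw [ins_comp f g]; exact Category.assoc _ _ _
  | _, _, _, .keep f, .keep g => by
    simp only [Thin.comp, ins]
    rw [ins_comp f g]; exact T.map_comp _ _
  | _, _, _, .skip f, .keep g => by
    simp only [Thin.comp, ins]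
    rw [ins_comp f g]; exact S.comp_unit _ _

theorem del_comp : ∀ {a b c : ℕ} (f : Thin a b) (g : Thin b c), S.del Z (f.comp g) = S.del Z g ≫ S.del Z f
  | _, _, _, f, .nil => by simp only [Thin.comp]; exact (Category.id_comp _).symm
  | _, _, _, f, .skip g => by
    simp only [Thin.comp, del]
    rw [del_comp f g]; exact (Category.assoc _ _ _).symm
  | _, _, _, .keep f, .keep g => by
    simp only [Thin.comp, del]
    rw [del_comp f g]; exact T.map_comp _ _
  | _, _, _, .skip f, .keep g => by
    simp only [Thin.comp, del]
    rw [del_comp f g]; exact S.counit_comp _ _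

/-- Inserted units leave the action on the old factors unchanged, only renumbered by `f`. With
`del_act` this carries links and blocks along `ins` and `del`. -/
theorem ins_act {m n : ℕ} (f : Thin m n) (i : Fin m) :
    T.map (S.ins Z f) ≫ S.act Z n (f i) = S.act Z m i ≫ S.ins Z f := by
  induction f with
  | nil => exact i.elim0
  | keep f ih =>
    induction i using Fin.lastCases with
    | last => rw [Thin.keep_last, act_last, act_last]; exact S.mul_nat _
    | cast i =>
      rw [Thin.keep_castSucc, act_castSucc, act_castSucc]; exact S.map_lift (ih i)
  | skip f ih => rw [Thin.skip_apply, act_castSucc]; exact S.comp_unit_lift (ih i)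

theorem del_act {m n : ℕ} (f : Thin m n) (i : Fin m) :
    T.map (S.del Z f) ≫ S.act Z m i = S.act Z n (f i) ≫ S.del Z f := by
  induction f with
  | nil => exact i.elim0
  | keep f ih =>
    induction i using Fin.lastCases with
    | last => rw [Thin.keep_last, act_last, act_last]; exact S.mul_nat _
    | cast i =>
      rw [Thin.keep_castSucc, act_castSucc, act_castSucc]; exact S.map_lift (ih i)
  | skip f ih => rw [Thin.skip_apply, act_castSucc]; exact S.lift_counit_comp (ih i)

/-- Adding further factors at the right. -/
def padMap {m n : ℕ} (f : pow T Z m ⟶ pow T Z n) : ∀ k, pow T Z (m + k) ⟶ pow T Z (n + k)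
  | 0 => f
  | k + 1 => T.map (padMap f k)

variable {Z} in
theorem padMap_comp {a b c : ℕ} (f : pow T Z a ⟶ pow T Z b) (g : pow T Z b ⟶ pow T Z c) (k : ℕ) :
    padMap Z (f ≫ g) k = padMap Z f k ≫ padMap Z g k := by
  induction k with
  | zero => rfl
  | succ k ih => exact (congrArg T.map ih).trans (T.map_comp _ _)

theorem padMap_id (a k : ℕ) : padMap Z (𝟙 (pow T Z a)) k = 𝟙 _ := by
  induction k with
  | zero => rfl
  | succ k ih => exact (congrArg T.map ih).trans (T.map_id _)

theorem ins_pad {m n : ℕ} (f : Thin m n) (k : ℕ) : S.ins Z (f.pad k) = padMap Z (S.ins Z f) k := by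
  induction k with
  | zero => rfl
  | succ k ih => exact congrArg T.map ih

theorem del_pad {m n : ℕ} (f : Thin m n) (k : ℕ) : S.del Z (f.pad k) = padMap Z (S.del Z f) k := by
  induction k with
  | zero => rfl
  | succ k ih => exact congrArg T.map ih

variable {Z} in
/-- Units can be inserted at the right before or after any morphism. -/
theorem padMap_ins_inl {m n : ℕ} (f : pow T Z m ⟶ pow T Z n) (k : ℕ) :
    f ≫ S.ins Z (Thin.inl n k) = S.ins Z (Thin.inl m k) ≫ padMap Z f k := by
  induction k with
  | zero => simp [Thin.inl, ins_id, padMap]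
  | succ k ih =>
    simp only [Thin.inl, ins]
    exact S.comp_unit_of_comm ih

end
end FrobeniusAction

/-! ### Equivalence relations generated by lists of pairs. -/

theorem EqvGen.setoid_le_iff {α : Type*} {r : α → α → Prop} {s : Setoid α} :
    Relation.EqvGen.setoid r ≤ s ↔ ∀ x y, r x y → s x y :=
  ⟨fun h x y hxy => h (Relation.EqvGen.rel x y hxy), fun h => Setoid.eqvGen_le h⟩

/-- The equivalence relation generated by a list of pairs. -/
def listSetoid {α : Type*} (L : List (α × α)) : Setoid α := Relation.EqvGen.setoid fun x y => (x, y) ∈ L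

/-- The universal property of the generated relation. Later equalities between generated relations
are checked by comparing upper bounds. -/
theorem listSetoid_le_iff {α : Type*} {L : List (α × α)} {s : Setoid α} :
    listSetoid L ≤ s ↔ ∀ p ∈ L, s p.1 p.2 :=
  EqvGen.setoid_le_iff.trans ⟨fun h p hp => h p.1 p.2 hp, fun h x y hxy => h (x, y) hxy⟩

theorem listSetoid_rel {α : Type*} {L : List (α × α)} {p : α × α} (h : p ∈ L) : listSetoid L p.1 p.2 :=
  listSetoid_le_iff.1 le_rfl p h

theorem listSetoid_append {α : Type*} (L L' : List (α × α)) : listSetoid (L ++ L') = listSetoid L ⊔ listSetoid L' := by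
  refine eq_of_forall_ge_iff fun s => ?_
  simp only [listSetoid_le_iff, sup_le_iff, List.mem_append, or_imp, forall_and]

theorem Setoid.map_le_iff {α β : Type*} {r : Setoid α} {f : α → β} {s : Setoid β} : r.map f ≤ s ↔ r ≤ s.comap f := by
  constructor
  · intro h x y hxy
    exact h (Setoid.le_comap_map hxy)
  · intro h
    refine Setoid.eqvGen_le ?_
    rintro _ _ ⟨x, y, hxy, rfl, rfl⟩
    exact h hxy

theorem listSetoid_map {α β : Type*} (L : List (α × α)) (f : α → β) :
    listSetoid (L.map (Prod.map f f)) = (listSetoid L).map f := by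
  refine eq_of_forall_ge_iff fun s => ?_
  simp only [listSetoid_le_iff, Setoid.map_le_iff, List.mem_map, forall_exists_index, and_imp,
    forall_apply_eq_imp_iff₂, Prod.map_fst, Prod.map_snd, Setoid.comap_rel]

open Classical in
/-- The list of all related pairs. -/
noncomputable def relatedPairs {α : Type*} [Fintype α] (r : Setoid α) : List (α × α) :=
  (Finset.univ.filter fun p : α × α => r p.1 p.2).toList

theorem listSetoid_relatedPairs {α : Type*} [Fintype α] (r : Setoid α) : listSetoid (relatedPairs r) = r := by
  refine eq_of_forall_ge_iff fun s => ?_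
  simp only [listSetoid_le_iff, relatedPairs, Finset.mem_toList, Finset.mem_filter, Finset.mem_univ, true_and]
  exact ⟨fun h x y hxy => h (x, y) hxy, fun h p hp => h hp⟩

/-! ### Linking the factors of each block. -/

namespace FrobeniusAction

section
variable {R : Type*} [CommRing R] {t : R} {C : Type*} [Category* C] [Preadditive C] [Linear R C]
  {T : C ⥤ C} (S : FrobeniusAction t T) (Z : C)

/-- The bridge between two factors of a power. -/
def link (n : ℕ) (i j : Fin n) : pow T Z n ⟶ pow T Z n := S.bridge (S.act Z n i) (S.act Z n j)

theorem link_self (n : ℕ) (i : Fin n) : S.link Z n i i = 𝟙 _ := (S.act_isModule Z n i).bridge_self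

theorem link_symm (n : ℕ) (i j : Fin n) : S.link Z n i j = S.link Z n j i := (S.act_commute Z n i j).bridge_comm

theorem link_comm (n : ℕ) (i j k l : Fin n) : S.link Z n i j ≫ S.link Z n k l = S.link Z n k l ≫ S.link Z n i j :=
  bridge_bridge_comm (S.act_commute Z n _ _) (S.act_commute Z n _ _) (S.act_commute Z n _ _) (S.act_commute Z n _ _)

theorem link_link (n : ℕ) (i j k : Fin n) : S.link Z n i j ≫ S.link Z n j k = S.link Z n i j ≫ S.link Z n i k :=
  bridge_bridge (S.act_isModule Z n _) (S.act_isModule Z n _) (S.act_commute Z n _ _) (S.act_commute Z n _ _)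
    (S.act_commute Z n _ _)

theorem link_link_self (n : ℕ) (i j : Fin n) : S.link Z n i j ≫ S.link Z n i j = S.link Z n i j := by
  rw [← link_link, link_self, Category.comp_id]

theorem bridge_nat {M N : C} {g : M ⟶ N} {a b : T.obj M ⟶ M} {a' b' : T.obj N ⟶ N} (ha : T.map g ≫ a' = a ≫ g)
    (hb : T.map g ≫ b' = b ≫ g) : g ≫ S.bridge a' b' = S.bridge a b ≫ g := by
  rw [bridge, bridge, reassoc_of% S.copair_nat, ← T.map_comp_assoc, ha, T.map_comp, Category.assoc, hb]
  simp only [Category.assoc]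

theorem ins_link {m n : ℕ} (f : Thin m n) (i j : Fin m) :
    S.ins Z f ≫ S.link Z n (f i) (f j) = S.link Z m i j ≫ S.ins Z f :=
  S.bridge_nat (S.ins_act Z f i) (S.ins_act Z f j)

theorem del_link {m n : ℕ} (f : Thin m n) (i j : Fin m) :
    S.del Z f ≫ S.link Z m i j = S.link Z n (f i) (f j) ≫ S.del Z f :=
  S.bridge_nat (S.del_act Z f i) (S.del_act Z f j)

/-- The composite of a list of links. -/
def links (n : ℕ) : List (Fin n × Fin n) → (pow T Z n ⟶ pow T Z n)
  | [] => 𝟙 _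
  | p :: L => S.link Z n p.1 p.2 ≫ links n L

theorem links_append (n : ℕ) (L L' : List (Fin n × Fin n)) :
    S.links Z n (L ++ L') = S.links Z n L ≫ S.links Z n L' := by
  induction L with
  | nil => simp [links]
  | cons p L ih => simp [links, ih]

theorem link_links (n : ℕ) (i j : Fin n) (L : List (Fin n × Fin n)) :
    S.link Z n i j ≫ S.links Z n L = S.links Z n L ≫ S.link Z n i j := by
  induction L with
  | nil => simp [links]
  | cons p L ih => simp only [links, Category.assoc, ← ih]; rw [← Category.assoc, link_comm, Category.assoc]

theorem links_comm (n : ℕ) (L L' : List (Fin n × Fin n)) :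
    S.links Z n L ≫ S.links Z n L' = S.links Z n L' ≫ S.links Z n L := by
  induction L with
  | nil => simp [links]
  | cons p L ih => simp only [links, Category.assoc, ih]; rw [← Category.assoc, link_links, Category.assoc]

/-- The pairs whose link is absorbed by a given composite of links. -/
def absorbed (n : ℕ) (L : List (Fin n × Fin n)) : Setoid (Fin n) where
  r i j := S.links Z n L ≫ S.link Z n i j = S.links Z n L
  iseqv :=
    { refl i := by rw [link_self, Category.comp_id]
      symm {i j} h := by rw [link_symm, h]
      trans {i j k} h h' := by rw [← h, Category.assoc, ← link_link, reassoc_of% h, h', h] }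

/-- Absorption is an equivalence relation, with transitivity from `link_link`. It therefore suffices
that the generators are absorbed, and they are because links commute and are idempotent. -/
theorem le_absorbed (n : ℕ) (L : List (Fin n × Fin n)) : listSetoid L ≤ S.absorbed Z n L := by
  refine listSetoid_le_iff.2 ?_
  induction L with
  | nil => simp
  | cons p L ih =>
    intro q hq
    have hq' : q = p ∨ q ∈ L := by simpa using hq
    change (S.link Z n p.1 p.2 ≫ S.links Z n L) ≫ S.link Z n q.1 q.2 = S.link Z n p.1 p.2 ≫ S.links Z n L
    rcases hq' with rfl | hq'
    · rw [Category.assoc, ← link_links, ← Category.assoc, link_link_self]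
    · rw [Category.assoc, show S.links Z n L ≫ S.link Z n q.1 q.2 = S.links Z n L from ih q hq']

theorem links_absorb (n : ℕ) (L L' : List (Fin n × Fin n)) (h : listSetoid L' ≤ listSetoid L) :
    S.links Z n L ≫ S.links Z n L' = S.links Z n L := by
  have h' : ∀ p ∈ L', S.absorbed Z n L p.1 p.2 := fun p hp => S.le_absorbed Z n L (h (listSetoid_rel hp))
  clear h
  induction L' with
  | nil => simp [links]
  | cons p L' ih =>
    have hp : S.links Z n L ≫ S.link Z n p.1 p.2 = S.links Z n L := h' p (by simp)
    rw [links, reassoc_of% hp, ih fun q hq => h' q (by simp [hq])]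

/-- Each composite absorbs the other, and they commute. So a composite of links is determined by the
generated equivalence relation, which makes `blocks` independent of the chosen list. -/
theorem links_eq (n : ℕ) (L L' : List (Fin n × Fin n)) (h : listSetoid L' = listSetoid L) :
    S.links Z n L = S.links Z n L' := by
  rw [← S.links_absorb Z n L L' h.le, links_comm, S.links_absorb Z n L' L h.ge]

/-- All factors of a power that belong to the same block are linked. -/
noncomputable def blocks {n : ℕ} (r : Setoid (Fin n)) : pow T Z n ⟶ pow T Z n := S.links Z n (relatedPairs r)

theorem links_eq_blocks {n : ℕ} (L : List (Fin n × Fin n)) : S.links Z n L = S.blocks Z (listSetoid L) :=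
  S.links_eq Z n _ _ (listSetoid_relatedPairs _)

theorem blocks_bot (n : ℕ) : S.blocks Z (⊥ : Setoid (Fin n)) = 𝟙 _ := by
  have : listSetoid ([] : List (Fin n × Fin n)) = ⊥ := le_bot_iff.1 (listSetoid_le_iff.2 (by simp))
  rw [← this, ← links_eq_blocks, links]

/-- Stacking partitions is a join of equivalence relations; here it becomes composition. -/
theorem blocks_sup {n : ℕ} (r s : Setoid (Fin n)) : S.blocks Z (r ⊔ s) = S.blocks Z r ≫ S.blocks Z s := by
  rw [blocks.eq_1 S Z r, blocks.eq_1 S Z s, ← links_append, links_eq_blocks, listSetoid_append, listSetoid_relatedPairs,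
    listSetoid_relatedPairs]

theorem ins_links {m n : ℕ} (f : Thin m n) (L : List (Fin m × Fin m)) :
    S.ins Z f ≫ S.links Z n (L.map (Prod.map f f)) = S.links Z m L ≫ S.ins Z f := by
  induction L with
  | nil => simp [links]
  | cons p L ih =>
    simp only [List.map_cons, links, Prod.map_fst, Prod.map_snd, Category.assoc, ← ih]
    rw [reassoc_of% S.ins_link]

theorem del_links {m n : ℕ} (f : Thin m n) (L : List (Fin m × Fin m)) :
    S.del Z f ≫ S.links Z m L = S.links Z n (L.map (Prod.map f f)) ≫ S.del Z f := by
  induction L with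
  | nil => simp [links]
  | cons p L ih =>
    simp only [List.map_cons, links, Prod.map_fst, Prod.map_snd, Category.assoc, ← ih]
    rw [← Category.assoc, ← Category.assoc, S.del_link]

theorem ins_blocks {m n : ℕ} (f : Thin m n) (r : Setoid (Fin m)) :
    S.ins Z f ≫ S.blocks Z (r.map f) = S.blocks Z r ≫ S.ins Z f := by
  rw [blocks.eq_1 S Z r, ← ins_links, links_eq_blocks, listSetoid_map, listSetoid_relatedPairs]

theorem del_blocks {m n : ℕ} (f : Thin m n) (r : Setoid (Fin m)) :
    S.del Z f ≫ S.blocks Z r = S.blocks Z (r.map f) ≫ S.del Z f := by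
  rw [blocks.eq_1 S Z r, del_links, links_eq_blocks, listSetoid_map, listSetoid_relatedPairs]

/-! ### Removing a factor -/

/-- The increasing map that avoids exactly the value `a`. -/
def _root_.Thin.avoid (a k : ℕ) : Thin (a + k) (a + 1 + k) := (Thin.id a).skip.pad k

/-- The value avoided by `Thin.avoid`. -/
def _root_.Thin.avoided (a k : ℕ) : Fin (a + 1 + k) := ⟨a, by omega⟩

/-- A factor acting on a fresh unit simply takes its place, and the deletion then applies `ε` to it.
The induction moves the avoided position under the later factors with the swap. -/
theorem ins_act_del (a k : ℕ) : T.map (S.ins Z (Thin.avoid a k)) ≫ S.act Z (a + 1 + k) (Thin.avoided a k) ≫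
    S.del Z (Thin.avoid a k) = S.counit _ := by
  induction k with
  | zero =>
    have h1 : S.ins Z (Thin.avoid a 0) = S.unit (pow T Z a) := by
      change S.ins Z (Thin.id a) ≫ S.unit (pow T Z a) = _
      rw [ins_id, Category.id_comp]
    have h2 : S.del Z (Thin.avoid a 0) = S.counit (pow T Z a) := by
      change S.counit (pow T Z a) ≫ S.del Z (Thin.id a) = _
      rw [del_id, Category.comp_id]
    have h3 : S.act Z (a + 1 + 0) (Thin.avoided a 0) = S.mul (pow T Z a) := S.act_last Z a
    have h4 : T.map (S.unit (pow T Z a)) ≫ S.mul (pow T Z a) ≫ S.counit (pow T Z a) = S.counit _ := by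
      rw [reassoc_of% S.unit_mul]
    exact (congrArg₂ (· ≫ ·) (congrArg T.map h1) (congrArg₂ (· ≫ ·) h3 h2)).trans h4
  | succ k ih =>
    have h3 : S.act Z (a + 1 + (k + 1)) (Thin.avoided a (k + 1)) = S.lift (S.act Z (a + 1 + k) (Thin.avoided a k)) :=
      S.act_castSucc Z (a + 1 + k) (Thin.avoided a k)
    have key {M N : C} {f : M ⟶ N} {b : T.obj N ⟶ N} {g : N ⟶ M} (h : T.map f ≫ b ≫ g = S.counit M) :
        T.map (T.map f) ≫ S.lift b ≫ T.map g = S.counit (T.obj M) := by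
      rw [lift, Category.assoc, reassoc_of% S.swap_nat, ← T.map_comp, ← T.map_comp, h, ← S.swap_counit,
        reassoc_of% S.swap_swap]
    rw [h3]
    exact key ih

/-- The composite is `η ; ε`; an extra unit that acts trivially on the avoided factor brings it into
the form of `ins_act_del`. -/
theorem ins_del_avoid (a k : ℕ) : S.ins Z (Thin.avoid a k) ≫ S.del Z (Thin.avoid a k) = t • 𝟙 _ := by
  have h := (S.act_isModule Z _ (Thin.avoided a k)).unit
  rw [← S.dimension, ← S.ins_act_del, ← reassoc_of% S.unit_nat, reassoc_of% h]

/-- The leg of the copairing at the removed factor ends in `ε`, which turns the copairing into a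
unit; that unit acts trivially on factor `j`. -/
theorem ins_link_del (a k : ℕ) (j : Fin (a + k)) : S.ins Z (Thin.avoid a k) ≫
    S.link Z _ (Thin.avoid a k j) (Thin.avoided a k) ≫ S.del Z (Thin.avoid a k) = 𝟙 _ := by
  have h := (S.act_isModule Z _ j).unit
  have h2 : S.copair (pow T Z (a + k)) ≫ S.counit _ = S.unit _ := by
    rw [copair, Category.assoc, S.comul_counit, Category.comp_id]
  rw [link, bridge, Category.assoc, Category.assoc, reassoc_of% S.copair_nat, ← T.map_comp_assoc, S.ins_act, T.map_comp,
    Category.assoc, S.ins_act_del, S.counit_nat, reassoc_of% h2, h]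

end
end FrobeniusAction

/-! ### Counting the classes lost under restriction. -/

/-- The number of classes of an equivalence relation that do not meet the range of a map. -/
noncomputable def missedClasses {ι α : Type*} (r : Setoid α) (h : ι → α) : ℕ :=
  Nat.card {q : Quotient r // ∀ i, Quotient.mk r (h i) ≠ q}

theorem missedClasses_eq_ncard {ι α : Type*} (r : Setoid α) (h : ι → α) :
    missedClasses r h = Set.ncard {q : Quotient r | ∀ i, Quotient.mk r (h i) ≠ q} := rfl

/-- The classes of the pullback along `d` embed into those of `r`. A class missed by `d ∘ h` is
either missed by `d` or is the image of a class missed by `h`. This allows vertices to be removed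
one at a time. -/
theorem missedClasses_comp {ι α β : Type*} [Finite α] [Finite β] (r : Setoid α) (d : β → α) (h : ι → β) :
    missedClasses r (d ∘ h) = missedClasses r d + missedClasses (r.comap d) h := by
  let f : Quotient (r.comap d) → Quotient r := Quotient.map' d fun _ _ h => h
  have hf : Function.Injective f := by
    rintro ⟨x⟩ ⟨y⟩ hxy
    exact Quotient.sound (Quotient.exact hxy : r (d x) (d y))
  simp only [missedClasses_eq_ncard]
  rw [← Set.ncard_image_of_injective _ hf, ← Set.ncard_union_eq]
  · congr 1
    ext q
    simp only [Set.mem_ofPred_eq, Function.comp_apply, Set.mem_union, Set.mem_image]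
    constructor
    · intro hq
      by_cases hd : ∀ i, Quotient.mk r (d i) ≠ q
      · exact .inl hd
      · push Not at hd
        obtain ⟨i, rfl⟩ := hd
        refine .inr ⟨Quotient.mk _ i, fun j hj => hq j ?_, rfl⟩
        exact congrArg f hj
    · rintro (hq | ⟨q, hq, rfl⟩) i
      · exact hq _
      · intro hi
        exact hq i (hf hi)
  · rw [Set.disjoint_left]
    rintro _ hq ⟨q, -, rfl⟩
    induction q using Quotient.inductionOn with
    | h x => exact hq x rfl

namespace Thin

theorem eq_avoided_or (a k : ℕ) (i : Fin (a + 1 + k)) : i = avoided a k ∨ ∃ j, avoid a k j = i := by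
  rcases lt_trichotomy i.val a with h | h | h
  · refine .inr ⟨⟨i, by omega⟩, Fin.ext ?_⟩
    simp [avoid, pad_val, h]
  · exact .inl (Fin.ext h)
  · refine .inr ⟨⟨i - 1, by omega⟩, Fin.ext ?_⟩
    simp only [avoid, pad_val]
    rw [dif_neg (by omega)]
    omega

theorem missedClasses_avoid_isolated {a k : ℕ} (r : Setoid (Fin (a + 1 + k)))
    (h : ∀ j, ¬ r (avoid a k j) (avoided a k)) : missedClasses r (avoid a k) = 1 := by
  have : {q : Quotient r | ∀ i, Quotient.mk r (avoid a k i) ≠ q} = {Quotient.mk r (avoided a k)} := by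
    ext q
    simp only [Set.mem_ofPred_eq, Set.mem_singleton_iff]
    constructor
    · intro hq
      obtain ⟨x, rfl⟩ := Quotient.exists_rep q
      rcases eq_avoided_or a k x with rfl | ⟨j, rfl⟩
      · rfl
      · exact absurd rfl (hq j)
    · rintro rfl i hi
      exact h i (Quotient.exact hi)
  rw [missedClasses_eq_ncard, this, Set.ncard_singleton]

theorem missedClasses_avoid {a k : ℕ} (r : Setoid (Fin (a + 1 + k))) (j : Fin (a + k))
    (h : r (avoid a k j) (avoided a k)) : missedClasses r (avoid a k) = 0 := by
  have : {q : Quotient r | ∀ i, Quotient.mk r (avoid a k i) ≠ q} = ∅ := by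
    ext q
    simp only [Set.mem_ofPred_eq, Set.mem_empty_iff_false, iff_false]
    intro hq
    obtain ⟨x, rfl⟩ := Quotient.exists_rep q
    rcases eq_avoided_or a k x with rfl | ⟨j', rfl⟩
    · exact hq j (Quotient.sound h)
    · exact hq j' rfl
  rw [missedClasses_eq_ncard, this, Set.ncard_empty]

end Thin

/-! ### Removing a row of factors. -/

namespace FrobeniusAction

section
variable {R : Type*} [CommRing R] {t : R} {C : Type*} [Category* C] [Preadditive C] [Linear R C]
  {T : C ⥤ C} (S : FrobeniusAction t T) (Z : C)

/-- If the removed factor has a neighbour `j` in its block, the relation is generated by its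
restriction and the pair of `j` with the removed factor, and `ins_link_del` applies. If it is
isolated, the relation comes from the restriction alone and `η ; ε` contributes `t`. -/
theorem ins_blocks_del_avoid {a k : ℕ} (r : Setoid (Fin (a + 1 + k))) :
    S.ins Z (Thin.avoid a k) ≫ S.blocks Z r ≫ S.del Z (Thin.avoid a k) =
      t ^ missedClasses r (Thin.avoid a k) • S.blocks Z (r.comap (Thin.avoid a k)) := by
  have hle : (r.comap (Thin.avoid a k)).map (Thin.avoid a k) ≤ r := Setoid.map_le_iff.2 le_rfl
  by_cases h : ∃ j, r (Thin.avoid a k j) (Thin.avoided a k)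
  · obtain ⟨j, hj⟩ := h
    have hr : listSetoid [(Thin.avoid a k j, Thin.avoided a k)] ⊔ (r.comap (Thin.avoid a k)).map (Thin.avoid a k) = r := by
      set r' := listSetoid [(Thin.avoid a k j, Thin.avoided a k)] ⊔ (r.comap (Thin.avoid a k)).map (Thin.avoid a k) with hr'
      have h1 : r' (Thin.avoid a k j) (Thin.avoided a k) :=
        (le_sup_left : _ ≤ r') (listSetoid_rel (p := (Thin.avoid a k j, Thin.avoided a k)) (by simp))
      have h2 {i i' : Fin (a + k)} (hi : r (Thin.avoid a k i) (Thin.avoid a k i')) :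
          r' (Thin.avoid a k i) (Thin.avoid a k i') :=
        (le_sup_right : _ ≤ r') (Setoid.le_comap_map (f := Thin.avoid a k) hi)
      refine le_antisymm (sup_le (listSetoid_le_iff.2 (by simpa using hj)) hle) ?_
      have h3 (i : Fin (a + k)) (hi : r (Thin.avoided a k) (Thin.avoid a k i)) : r' (Thin.avoided a k) (Thin.avoid a k i) :=
        r'.trans (r'.symm h1) (h2 (r.trans hj hi))
      intro x y hxy
      rcases Thin.eq_avoided_or a k x with rfl | ⟨i, rfl⟩ <;> rcases Thin.eq_avoided_or a k y with rfl | ⟨i', rfl⟩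
      · exact r'.refl _
      · exact h3 _ hxy
      · exact r'.symm (h3 _ (r.symm hxy))
      · exact h2 hxy
    rw [Thin.missedClasses_avoid r j hj, pow_zero, one_smul]
    conv_lhs => rw [← hr]
    rw [blocks_sup, Category.assoc, ← del_blocks, ← links_eq_blocks]
    simp only [links, Category.comp_id]
    have := S.ins_link_del Z a k j
    rw [← Category.assoc, ← Category.assoc, Category.assoc (S.ins Z _), this, Category.id_comp]
  · push Not at h
    have hr : (r.comap (Thin.avoid a k)).map (Thin.avoid a k) = r := by
      refine le_antisymm hle ?_
      intro x y hxy
      rcases Thin.eq_avoided_or a k x with rfl | ⟨i, rfl⟩ <;> rcases Thin.eq_avoided_or a k y with rfl | ⟨i', rfl⟩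
      · exact Setoid.refl' _ _
      · exact absurd (r.symm hxy) (h _)
      · exact absurd hxy (h _)
      · exact Setoid.le_comap_map (f := Thin.avoid a k) hxy
    rw [Thin.missedClasses_avoid_isolated r h, pow_one]
    conv_lhs => rw [← hr]
    rw [← del_blocks, reassoc_of% S.ins_del_avoid, Linear.smul_comp, Category.id_comp]

/-- The increasing map that avoids `l` consecutive values. -/
def _root_.Thin.gap (m l k : ℕ) : Thin (m + k) (m + l + k) := (Thin.inl m l).pad k

theorem _root_.Thin.gap_succ (m l k : ℕ) : Thin.gap m (l + 1) k = (Thin.gap m l k).comp (Thin.avoid (m + l) k) := by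
  refine Eq.trans ?_ (Thin.pad_comp (Thin.inl m l) (Thin.id (m + l)).skip k)
  have : Thin.inl m (l + 1) = (Thin.inl m l).comp (Thin.id (m + l)).skip := by
    refine Thin.ext fun i => ?_
    simp
  rw [Thin.gap, this]

/-- The row is removed one factor at a time, and the exponents of `t` add up by
`missedClasses_comp`. -/
theorem ins_blocks_del_gap (m l k : ℕ) (r : Setoid (Fin (m + l + k))) :
    S.ins Z (Thin.gap m l k) ≫ S.blocks Z r ≫ S.del Z (Thin.gap m l k) =
      t ^ missedClasses r (Thin.gap m l k) • S.blocks Z (r.comap (Thin.gap m l k)) := by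
  induction l with
  | zero =>
    have h : Thin.gap m 0 k = Thin.id (m + k) := Thin.ext fun i => by
      simp only [Thin.gap, Thin.pad_val, Thin.inl_val, Thin.id_apply]
      split_ifs <;> omega
    have h' : ((Thin.id (m + k) : Thin (m + k) (m + k)) : Fin (m + k) → Fin (m + k)) = _root_.id := by
      funext i; simp
    have h'' : missedClasses r (_root_.id : Fin (m + k) → Fin (m + k)) = 0 := by
      have : IsEmpty {q : Quotient r // ∀ i, Quotient.mk r (_root_.id i) ≠ q} := by
        refine ⟨fun ⟨q, hq⟩ => ?_⟩
        obtain ⟨x, rfl⟩ := Quotient.exists_rep q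
        exact hq x rfl
      exact Nat.card_of_isEmpty
    rw [h]
    refine Eq.trans (congrArg₂ (fun f g => f ≫ S.blocks Z r ≫ g) (S.ins_id Z (m + k)) (S.del_id Z (m + k))) ?_
    refine Eq.trans ((Category.id_comp _).trans (Category.comp_id _)) ?_
    have e : missedClasses r (Thin.id (m + k)) = 0 := by rw [h']; exact h''
    have e' : r.comap (Thin.id (m + k)) = r := by rw [h']; rfl
    refine Eq.trans ?_ (congrArg₂ (fun n s => t ^ n • S.blocks Z s) e e').symm
    rw [pow_zero, one_smul]
  | succ l ih =>
    have e : (Thin.gap m (l + 1) k : Fin (m + k) → Fin (m + (l + 1) + k)) = Thin.avoid (m + l) k ∘ Thin.gap m l k := by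
      funext i; rw [Thin.gap_succ, Thin.comp_apply]; rfl
    rw [e]
    refine Eq.trans ?_ (congrArg₂ (fun n s => t ^ n • S.blocks Z s)
      (missedClasses_comp r (Thin.avoid (m + l) k) (Thin.gap m l k))
      (Setoid.comap_comp r (Thin.avoid (m + l) k) (Thin.gap m l k))).symm
    rw [Thin.gap_succ]
    refine Eq.trans (congrArg₂ (fun f g => f ≫ S.blocks Z r ≫ g) (S.ins_comp Z _ _) (S.del_comp Z _ _)) ?_
    have := congrArg (fun f => S.ins Z (Thin.gap m l k) ≫ f ≫ S.del Z (Thin.gap m l k)) (S.ins_blocks_del_avoid Z (a := m + l) r)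
    simp only [Category.assoc, Linear.smul_comp, Linear.comp_smul, ih] at this
    rw [pow_add, mul_smul, ← this]
    exact Category.assoc _ _ _

end
end FrobeniusAction

/-! ### A stack of two partitions as an equivalence relation on one row. -/

theorem Setoid.comap_equiv_le_iff {α β : Type*} (e : α ≃ β) {r : Setoid β} {s : Setoid α} :
    r.comap e ≤ s ↔ r ≤ s.comap e.symm := by
  constructor
  · intro h x y hxy
    exact h (show r (e (e.symm x)) (e (e.symm y)) by simpa using hxy)
  · intro h x y hxy
    have : s (e.symm (e x)) (e.symm (e y)) := h hxy
    simpa using this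

theorem missedClasses_of_surjective {ι α : Type*} (r : Setoid α) {h : ι → α} (hh : Function.Surjective h) :
    missedClasses r h = 0 := by
  have : IsEmpty {q : Quotient r // ∀ i, Quotient.mk r (h i) ≠ q} := by
    refine ⟨fun ⟨q, hq⟩ => ?_⟩
    obtain ⟨x, rfl⟩ := Quotient.exists_rep q
    obtain ⟨i, rfl⟩ := hh x
    exact hq i rfl
  exact Nat.card_of_isEmpty

theorem missedClasses_comp_surjective {κ ι α : Type*} (r : Setoid α) (h : ι → α) {e : κ → ι} (he : Function.Surjective e) :
    missedClasses r (h ∘ e) = missedClasses r h := by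
  simp only [missedClasses, Function.comp_apply]
  refine congrArg (fun p : Quotient r → Prop => Nat.card (Subtype p)) (funext fun q => propext ?_)
  exact ⟨fun H i => by obtain ⟨j, rfl⟩ := he i; exact H j, fun H j => H _⟩

/-- A component lies in the middle row exactly when it meets neither outer row. -/
theorem middleCount_eq_missedClasses {α β γ : Type} (P : Setoid (α ⊕ β)) (Q : Setoid (β ⊕ γ)) :
    middleCount P Q = missedClasses (stackSetoid P Q) (Sum.map id Sum.inr : α ⊕ γ → α ⊕ (β ⊕ γ)) := by
  refine congrArg (fun p : Quotient (stackSetoid P Q) → Prop => Nat.card (Subtype p)) (funext fun q => propext ?_)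
  constructor
  · rintro H (i | i) hi
    · obtain ⟨y, hy⟩ := H _ hi; simp at hy
    · obtain ⟨y, hy⟩ := H _ hi; simp at hy
  · rintro H (x | x | x) hx
    · exact absurd hx (H (.inl x))
    · exact ⟨x, rfl⟩
    · exact absurd hx (H (.inr x))

/-- The rows of a stack of two partitions, written from left to right. -/
def rowsEquiv (m l k : ℕ) : Fin m ⊕ (Fin l ⊕ Fin k) ≃ Fin (m + l + k) :=
  (Equiv.sumAssoc _ _ _).symm.trans ((Equiv.sumCongr finSumFinEquiv (Equiv.refl _)).trans finSumFinEquiv)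

theorem inl_finSum (m l k : ℕ) (x : Fin m ⊕ Fin l) :
    Thin.inl (m + l) k (finSumFinEquiv x) = rowsEquiv m l k (Sum.map id Sum.inl x) := by
  rcases x with x | x <;> refine Fin.ext ?_ <;> simp [rowsEquiv]

theorem inr_finSum (m l k : ℕ) (x : Fin l ⊕ Fin k) :
    (Thin.inr m l).pad k (finSumFinEquiv x) = rowsEquiv m l k (Sum.inr x) := by
  rcases x with x | x <;> refine Fin.ext ?_ <;> simp [rowsEquiv, Thin.pad_val]

theorem gap_finSum (m l k : ℕ) (x : Fin m ⊕ Fin k) :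
    Thin.gap m l k (finSumFinEquiv x) = rowsEquiv m l k (Sum.map id Sum.inr x) := by
  rcases x with x | x <;> refine Fin.ext ?_ <;> simp [rowsEquiv, Thin.pad_val, Thin.gap]

/-- The stack of two partitions, with the rows written from left to right. -/
def rowsSetoid {m l k : ℕ} (P : Setoid (Fin m ⊕ Fin l)) (Q : Setoid (Fin l ⊕ Fin k)) : Setoid (Fin (m + l + k)) :=
  (P.comap finSumFinEquiv.symm).map (Thin.inl (m + l) k) ⊔ (Q.comap finSumFinEquiv.symm).map ((Thin.inr m l).pad k)

/-- Both sides are joins of images of `P` and `Q`, hence are compared through their upper bounds. -/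
theorem rowsSetoid_comap {m l k : ℕ} (P : Setoid (Fin m ⊕ Fin l)) (Q : Setoid (Fin l ⊕ Fin k)) :
    (rowsSetoid P Q).comap (rowsEquiv m l k) = stackSetoid P Q := by
  refine eq_of_forall_ge_iff fun s => ?_
  rw [Setoid.comap_equiv_le_iff, rowsSetoid, stackSetoid, sup_le_iff, sup_le_iff, Setoid.map_le_iff, Setoid.map_le_iff,
    Setoid.map_le_iff, Setoid.map_le_iff, Setoid.comap_equiv_le_iff, Setoid.comap_equiv_le_iff]
  refine and_congr (iff_of_eq (congrArg (P ≤ ·) (Setoid.ext fun x y => ?_)))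
    (iff_of_eq (congrArg (Q ≤ ·) (Setoid.ext fun x y => ?_)))
  · simp [Setoid.comap_rel, inl_finSum]
  · simp [Setoid.comap_rel, inr_finSum]

theorem missedClasses_rowsSetoid {m l k : ℕ} (P : Setoid (Fin m ⊕ Fin l)) (Q : Setoid (Fin l ⊕ Fin k)) :
    missedClasses (rowsSetoid P Q) (Thin.gap m l k) = middleCount P Q := by
  rw [middleCount_eq_missedClasses, ← rowsSetoid_comap]
  have h := missedClasses_comp (rowsSetoid P Q) (rowsEquiv m l k) (Sum.map id Sum.inr : Fin m ⊕ Fin k → _)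
  rw [missedClasses_of_surjective _ (rowsEquiv m l k).surjective, zero_add] at h
  rw [← h, ← missedClasses_comp_surjective _ _ (finSumFinEquiv (m := m) (n := k)).surjective]
  exact congrArg _ (funext fun x => gap_finSum m l k x)

theorem rowsSetoid_comap_gap {m l k : ℕ} (P : Setoid (Fin m ⊕ Fin l)) (Q : Setoid (Fin l ⊕ Fin k)) :
    ((rowsSetoid P Q).comap (Thin.gap m l k)).comap finSumFinEquiv = starSetoid P Q := by
  rw [starSetoid, ← rowsSetoid_comap, ← Setoid.comap_comp, ← Setoid.comap_comp]
  exact congrArg (fun f => (rowsSetoid P Q).comap f) (funext fun x => gap_finSum m l k x)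

theorem elim_inl_inr (m l : ℕ) : Sum.elim (Thin.inl m l) (Thin.inr m l) = finSumFinEquiv := by
  funext x
  rcases x with x | x <;> refine Fin.ext ?_ <;> simp

/-! ### The morphism of a partition and its composition law. -/

namespace FrobeniusAction

section
variable {R : Type*} [CommRing R] {t : R} {C : Type*} [Category* C] [Preadditive C] [Linear R C]
  {T : C ⥤ C} (S : FrobeniusAction t T) (Z : C)

/-- The morphism between powers of the Frobenius object that is given by a partition. -/
noncomputable def diagram {m l : ℕ} (P : Setoid (Fin m ⊕ Fin l)) : pow T Z m ⟶ pow T Z l :=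
  S.ins Z (Thin.inl m l) ≫ S.blocks Z (P.comap finSumFinEquiv.symm) ≫ S.del Z (Thin.inr m l)

/-- The bottom row may be inserted at the beginning and the top row may be kept at the end of any power of the right size. -/
theorem diagram_eq {m l N : ℕ} (hN : N = m + l) (f : Thin m N) (g : Thin l N) (hf : ∀ i, (f i : ℕ) = i)
    (hg : ∀ j, (g j : ℕ) = m + j) (r : Setoid (Fin N)) :
    S.ins Z f ≫ S.blocks Z r ≫ S.del Z g = S.diagram Z (r.comap (Sum.elim f g)) := by
  -- `N` is kept as a variable because in `diagram_juxt_aux` the size is a sum with different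
  -- brackets.
  subst hN
  obtain rfl : f = Thin.inl m l := Thin.ext fun i => by simp [hf]
  obtain rfl : g = Thin.inr m l := Thin.ext fun i => by simp [hg]
  rw [elim_inl_inr, diagram, ← Setoid.comap_comp, Equiv.self_comp_symm, Setoid.comap_id]

/-- All insertions are moved to the beginning and all deletions to the end, so that both partitions
act on the power `m + l + k`, where their blocks compose to those of the stack. What is inserted and
deleted beyond the outer rows is the middle row, and `ins_blocks_del_gap` removes it. -/
theorem diagram_comp {m l k : ℕ} (P : Setoid (Fin m ⊕ Fin l)) (Q : Setoid (Fin l ⊕ Fin k)) :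
    S.diagram Z P ≫ S.diagram Z Q = t ^ middleCount P Q • S.diagram Z (starSetoid P Q) := by
  -- Inserting the middle row and then the top row equals inserting the top row and then the middle
  -- row in between; `h2` is the counterpart for deletions.
  have h1 : (Thin.inl m l).comp (Thin.inl (m + l) k) = (Thin.inl m k).comp (Thin.gap m l k) := Thin.ext fun i => by
    simp [Thin.gap, Thin.pad_val]
  have h2 : (Thin.inr l k).comp ((Thin.inr m l).pad k) = (Thin.inr m k).comp (Thin.gap m l k) := Thin.ext fun i => by
    simp [Thin.gap, Thin.pad_val]
  calc _ = S.ins Z ((Thin.inl m l).comp (Thin.inl (m + l) k)) ≫ S.blocks Z (rowsSetoid P Q) ≫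
          S.del Z ((Thin.inr l k).comp ((Thin.inr m l).pad k)) := by
        simp only [diagram, Category.assoc]
        rw [ins_comp, del_comp, rowsSetoid, blocks_sup, Category.assoc, Category.assoc, ← reassoc_of% S.del_blocks,
          reassoc_of% S.ins_blocks, del_pad, ← reassoc_of% padMap_ins_inl]
    _ = _ := by
        rw [h1, h2, ins_comp, del_comp, Category.assoc]
        have := congrArg (fun f => S.ins Z (Thin.inl m k) ≫ f ≫ S.del Z (Thin.inr m k))
          (S.ins_blocks_del_gap Z m l k (rowsSetoid P Q))
        simp only [Category.assoc, Linear.smul_comp, Linear.comp_smul, missedClasses_rowsSetoid] at this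
        rw [this, S.diagram_eq Z rfl _ _ (by simp) (by simp), elim_inl_inr, rowsSetoid_comap_gap]

end
end FrobeniusAction

/-! ### From a Frobenius object in a monoidal category to its action; tensoring on the left. -/

section
variable {R : Type*} [CommRing R] {t : R} {C : Type*} [Category* C] [Preadditive C] [Linear R C] [MonoidalCategory C]
  [MonoidalPreadditive C] [MonoidalLinear R C] {X : C} {μ : X ⊗ X ⟶ X} {Δ : X ⟶ X ⊗ X} {s : X ⊗ X ⟶ X ⊗ X}
  {η : 𝟙_ C ⟶ X} {ε : X ⟶ 𝟙_ C}

/-- A special commutative Frobenius object acts by tensoring on the right. -/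
def IsSpecialCommFrobenius.action (h : IsSpecialCommFrobenius t X μ Δ s η ε) : FrobeniusAction t (tensorRight X) where
  mul M := (α_ M X X).hom ≫ M ◁ μ
  comul M := M ◁ Δ ≫ (α_ M X X).inv
  swap M := (α_ M X X).hom ≫ M ◁ s ≫ (α_ M X X).inv
  unit M := (ρ_ M).inv ≫ M ◁ η
  counit M := M ◁ ε ≫ (ρ_ M).hom
  mul_nat f := by dsimp; simp only [Category.assoc, whisker_exchange, associator_naturality_left_assoc]
  comul_nat f := by
    dsimp; simp only [Category.assoc, ← associator_inv_naturality_left, whisker_exchange_assoc]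
  swap_nat f := by
    dsimp
    simp only [Category.assoc, ← associator_inv_naturality_left, whisker_exchange_assoc, associator_naturality_left_assoc]
  unit_nat f := by dsimp; simp only [Category.assoc, rightUnitor_inv_naturality_assoc, whisker_exchange]
  counit_nat f := by dsimp; simp only [Category.assoc, ← rightUnitor_naturality, whisker_exchange_assoc]
  unit_mul M := by
    dsimp
    -- Coherence exposes the relation for `X` whiskered by `M`. The remaining relations are
    -- transferred in the same manner.
    calc _ = (ρ_ M).inv ▷ X ≫ (α_ M (𝟙_ C) X).hom ≫ M ◁ (η ▷ X ≫ μ) := by monoidal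
      _ = _ := by rw [h.one_mul]; monoidal
  mul_unit M := by
    dsimp
    calc _ = (ρ_ (M ⊗ X)).inv ≫ (α_ M X (𝟙_ C)).hom ≫ M ◁ (X ◁ η ≫ μ) := by monoidal
      _ = _ := by rw [h.mul_one]; monoidal
  counit_comul M := by
    dsimp
    calc _ = M ◁ (Δ ≫ ε ▷ X) ≫ (α_ M (𝟙_ C) X).inv ≫ (ρ_ M).hom ▷ X := by monoidal
      _ = _ := by rw [h.counit_comul]; monoidal
  comul_counit M := by
    dsimp
    calc _ = M ◁ (Δ ≫ X ◁ ε) ≫ (α_ M X (𝟙_ C)).inv ≫ (ρ_ (M ⊗ X)).hom := by monoidal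
      _ = _ := by rw [h.comul_counit]; monoidal
  frobenius_left M := by
    dsimp
    calc _ = (α_ M X X).hom ≫ M ◁ (X ◁ Δ ≫ (α_ X X X).inv ≫ μ ▷ X) ≫ (α_ M X X).inv := by monoidal
      _ = _ := by rw [h.frobenius_left]; monoidal
  frobenius_right M := by
    dsimp
    calc _ = (α_ M X X).hom ≫ M ◁ (Δ ▷ X ≫ (α_ X X X).hom ≫ X ◁ μ) ≫ (α_ M X X).inv := by monoidal
      _ = _ := by rw [h.frobenius_right]; monoidal
  swap_swap M := by
    dsimp
    calc _ = (α_ M X X).hom ≫ M ◁ (s ≫ s) ≫ (α_ M X X).inv := by monoidal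
      _ = _ := by rw [h.swap_swap]; simp
  braid M := by
    dsimp
    calc _ = ⊗𝟙.hom ≫ M ◁ (s ▷ X ≫ (α_ X X X).hom ≫ X ◁ s ≫ (α_ X X X).inv ≫ s ▷ X) ≫ ⊗𝟙.hom := by monoidal
      _ = _ := by rw [h.braid]; monoidal
  swap_unit M := by
    dsimp
    calc _ = M ◁ ((ρ_ X).inv ≫ X ◁ η ≫ s) ≫ (α_ M X X).inv := by monoidal
      _ = _ := by rw [h.swap_unit]; monoidal
  swap_mul M := by
    dsimp
    calc _ = ⊗𝟙.hom ≫ M ◁ (X ◁ s ≫ (α_ X X X).inv ≫ s ▷ X ≫ (α_ X X X).hom ≫ X ◁ μ) ≫ ⊗𝟙.hom := by monoidal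
      _ = _ := by rw [h.swap_mul]; monoidal
  swap_counit M := by
    dsimp
    calc _ = (α_ M X X).hom ≫ M ◁ (s ≫ X ◁ ε ≫ (ρ_ X).hom) := by monoidal
      _ = _ := by rw [h.swap_counit]; monoidal
  swap_comul M := by
    dsimp
    calc _ = ⊗𝟙.hom ≫ M ◁ (X ◁ Δ ≫ (α_ X X X).inv ≫ s ▷ X ≫ (α_ X X X).hom ≫ X ◁ s) ≫ ⊗𝟙.hom := by monoidal
      _ = _ := by rw [h.swap_comul]; monoidal
  comm M := by
    dsimp
    calc _ = (α_ M X X).hom ≫ M ◁ (s ≫ μ) := by monoidal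
      _ = _ := by rw [h.comm]
  special M := by
    dsimp
    calc _ = M ◁ (Δ ≫ μ) := by monoidal
      _ = _ := by rw [h.special]; simp
  dimension M := by
    calc _ = (ρ_ M).inv ≫ M ◁ (η ≫ ε) ≫ (ρ_ M).hom := by monoidal
      _ = _ := by rw [h.dimension, MonoidalLinear.whiskerLeft_smul]; simp

variable (h : IsSpecialCommFrobenius t X μ Δ s η ε)

/-- An isomorphism `A ⊗ M ≅ N` extends to an isomorphism `A ⊗ (M ⊗ X) ≅ N ⊗ X`. -/
def extendIso {A M N : C} (e : A ⊗ M ≅ N) (X : C) : A ⊗ (M ⊗ X) ≅ N ⊗ X := (α_ A M X).symm ≪≫ whiskerRightIso e X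

namespace IsSpecialCommFrobenius

variable {A M N M' N' : C}

theorem extend_map {e : A ⊗ M ≅ N} {e' : A ⊗ M' ≅ N'} {f : M ⟶ M'} {g : N ⟶ N'} (hf : A ◁ f ≫ e'.hom = e.hom ≫ g) :
    A ◁ (f ▷ X) ≫ (extendIso e' X).hom = (extendIso e X).hom ≫ g ▷ X := by
  simp only [extendIso, Iso.trans_hom, Iso.symm_hom, whiskerRightIso_hom, Category.assoc, ← comp_whiskerRight, ← hf]
  simp

/-- Tensoring with `A` on the left commutes with the components of the action; for each of them this
is the exchange law and coherence. -/
theorem extend_unit (e : A ⊗ M ≅ N) : A ◁ h.action.unit M ≫ (extendIso e X).hom = e.hom ≫ h.action.unit N := by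
  simp only [extendIso, action, Iso.trans_hom, Iso.symm_hom, whiskerRightIso_hom]
  calc _ = (ρ_ _).inv ≫ (A ⊗ M) ◁ η ≫ e.hom ▷ X := by monoidal
    _ = _ := by rw [whisker_exchange]; monoidal

theorem extend_counit (e : A ⊗ M ≅ N) : A ◁ h.action.counit M ≫ e.hom = (extendIso e X).hom ≫ h.action.counit N := by
  simp only [extendIso, action, Iso.trans_hom, Iso.symm_hom, whiskerRightIso_hom]
  calc _ = (α_ A M X).inv ≫ ((A ⊗ M) ◁ ε ≫ e.hom ▷ _) ≫ (ρ_ _).hom := by monoidal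
    _ = _ := by rw [whisker_exchange]; monoidal

theorem extend_mul (e : A ⊗ M ≅ N) : A ◁ h.action.mul M ≫ (extendIso e X).hom =
    (extendIso (extendIso e X) X).hom ≫ h.action.mul N := by
  simp only [extendIso, action, Iso.trans_hom, Iso.symm_hom, whiskerRightIso_hom]
  calc _ = (⊗𝟙 : A ⊗ (M ⊗ X) ⊗ X ≅ (A ⊗ M) ⊗ X ⊗ X).hom ≫ ((A ⊗ M) ◁ μ ≫ e.hom ▷ X) := by monoidal
    _ = _ := by rw [whisker_exchange]; monoidal

theorem extend_comul (e : A ⊗ M ≅ N) : A ◁ h.action.comul M ≫ (extendIso (extendIso e X) X).hom =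
    (extendIso e X).hom ≫ h.action.comul N := by
  simp only [extendIso, action, Iso.trans_hom, Iso.symm_hom, whiskerRightIso_hom]
  calc _ = (⊗𝟙 : A ⊗ M ⊗ X ≅ (A ⊗ M) ⊗ X).hom ≫ ((A ⊗ M) ◁ Δ ≫ e.hom ▷ _) ≫ (⊗𝟙 : N ⊗ X ⊗ X ≅ (N ⊗ X) ⊗ X).hom := by monoidal
    _ = _ := by rw [whisker_exchange]; monoidal

theorem extend_swap (e : A ⊗ M ≅ N) : A ◁ h.action.swap M ≫ (extendIso (extendIso e X) X).hom =
    (extendIso (extendIso e X) X).hom ≫ h.action.swap N := by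
  simp only [extendIso, action, Iso.trans_hom, Iso.symm_hom, whiskerRightIso_hom]
  calc _ = (⊗𝟙 : A ⊗ (M ⊗ X) ⊗ X ≅ (A ⊗ M) ⊗ X ⊗ X).hom ≫ ((A ⊗ M) ◁ s ≫ e.hom ▷ _) ≫ (⊗𝟙 : N ⊗ X ⊗ X ≅ (N ⊗ X) ⊗ X).hom := by monoidal
    _ = _ := by rw [whisker_exchange]; monoidal

end IsSpecialCommFrobenius
end

/-! ### Juxtaposition of diagrams. -/

namespace Thin

/-- Adding further points at the bottom that are fixed. -/
def shift (a : ℕ) : ∀ {m n : ℕ}, Thin m n → Thin (a + m) (a + n)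
  | _, _, nil => id a
  | _, _, keep f => keep (shift a f)
  | _, _, skip f => skip (shift a f)

theorem shift_val (a : ℕ) {m n : ℕ} (f : Thin m n) (i : Fin (a + m)) :
    (shift a f i : ℕ) = if h : (i : ℕ) < a then (i : ℕ) else a + f ⟨i - a, by omega⟩ := by
  induction f with
  | nil => have := i.isLt; simp [shift]
  | @keep m n f ih =>
    induction i using Fin.lastCases (n := a + m) with
    | last =>
      have : (⟨m, by omega⟩ : Fin (m + 1)) = Fin.last m := rfl
      simp [shift, this]
    | cast i =>
      simp only [shift, keep_castSucc, Fin.val_castSucc, ih]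
      split_ifs with hi
      · rfl
      · have : (⟨i - a, by omega⟩ : Fin (m + 1)) = Fin.castSucc ⟨i - a, by omega⟩ := rfl
        rw [this, keep_castSucc]; rfl
  | skip f ih => simp [shift, ih]

end Thin

namespace FrobeniusAction

section
variable {R : Type*} [CommRing R] {t : R} {C : Type*} [Category* C] [Preadditive C] [Linear R C]
  {T : C ⥤ C} (S : FrobeniusAction t T) (Z : C)

/-- The copairing slides past the additional last factor by naturality of the swap. -/
theorem map_bridge {M : C} (a b : T.obj M ⟶ M) : T.map (S.bridge a b) = S.bridge (S.lift a) (S.lift b) := by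
  simp only [bridge, lift, T.map_comp, Category.assoc]
  rw [reassoc_of% S.swap_nat, reassoc_of% S.map_copair_swap_swap]

theorem map_link (n : ℕ) (i j : Fin n) : T.map (S.link Z n i j) = S.link Z (n + 1) i.castSucc j.castSucc := by
  rw [link, map_bridge, link, act_castSucc, act_castSucc]; rfl

theorem padMap_link (n : ℕ) (i j : Fin n) (k : ℕ) :
    padMap Z (S.link Z n i j) k = S.link Z (n + k) (i.castAdd k) (j.castAdd k) := by
  induction k with
  | zero => rfl
  | succ k ih => exact (congrArg T.map ih).trans (S.map_link Z _ _ _)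

theorem padMap_links (n : ℕ) (L : List (Fin n × Fin n)) (k : ℕ) :
    padMap Z (S.links Z n L) k = S.links Z (n + k) (L.map (Prod.map (Fin.castAdd k) (Fin.castAdd k))) := by
  induction L with
  | nil => simp [links, padMap_id]
  | cons p L ih => simp [links, padMap_comp, ih, padMap_link]

theorem padMap_blocks {n : ℕ} (r : Setoid (Fin n)) (k : ℕ) :
    padMap Z (S.blocks Z r) k = S.blocks Z (r.map (Fin.castAdd k)) := by
  rw [blocks, padMap_links, links_eq_blocks, listSetoid_map, listSetoid_relatedPairs]

/-- The position of the vertices may be described in any power of the right size. -/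
theorem ins_blocks_del_congr {m l N N' : ℕ} (hN : N = N') (f : Thin m N) (g : Thin l N) (f' : Thin m N') (g' : Thin l N')
    (hf : ∀ i, (f i : ℕ) = f' i) (hg : ∀ i, (g i : ℕ) = g' i) (r : Setoid (Fin N)) :
    S.ins Z f ≫ S.blocks Z r ≫ S.del Z g = S.ins Z f' ≫ S.blocks Z (r.map (Fin.cast hN)) ≫ S.del Z g' := by
  subst hN
  obtain rfl := Thin.ext hf
  obtain rfl := Thin.ext hg
  have : r.map (Fin.cast rfl) = r := eq_of_forall_ge_iff fun s => Setoid.map_le_iff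
  rw [this]

end
end FrobeniusAction

namespace IsSpecialCommFrobenius
open FrobeniusAction

section
variable {R : Type*} [CommRing R] {t : R} {C : Type*} [Category* C] [Preadditive C] [Linear R C] [MonoidalCategory C]
  [MonoidalPreadditive C] [MonoidalLinear R C] {X : C} {μ : X ⊗ X ⟶ X} {Δ : X ⟶ X ⊗ X} {s : X ⊗ X ⟶ X ⊗ X}
  {η : 𝟙_ C ⟶ X} {ε : X ⟶ 𝟙_ C}
variable (h : IsSpecialCommFrobenius t X μ Δ s η ε)

theorem extend_lift {A M N : C} {e : A ⊗ M ≅ N} {f : M ⊗ X ⟶ M} {g : N ⊗ X ⟶ N}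
    (hf : A ◁ f ≫ e.hom = (extendIso e X).hom ≫ g) :
    A ◁ h.action.lift f ≫ (extendIso e X).hom = (extendIso (extendIso e X) X).hom ≫ h.action.lift g := by
  simp only [lift]
  rw [MonoidalCategory.whiskerLeft_comp, Category.assoc, ← reassoc_of% h.extend_swap e]
  exact congrArg _ (extend_map hf)

theorem extend_bridge {A M N : C} {e : A ⊗ M ≅ N} {f f' : M ⊗ X ⟶ M} {g g' : N ⊗ X ⟶ N}
    (hf : A ◁ f ≫ e.hom = (extendIso e X).hom ≫ g) (hf' : A ◁ f' ≫ e.hom = (extendIso e X).hom ≫ g') :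
    A ◁ h.action.bridge f f' ≫ e.hom = e.hom ≫ h.action.bridge g g' := by
  simp only [bridge, copair, MonoidalCategory.whiskerLeft_comp, Category.assoc]
  rw [← reassoc_of% h.extend_unit e, ← reassoc_of% h.extend_comul e]
  refine congrArg _ (congrArg _ ((congrArg _ hf').trans ?_))
  have := extend_map (X := X) hf
  exact (Category.assoc _ _ _).symm.trans ((congrArg (· ≫ g') this).trans (Category.assoc _ _ _))

theorem extend_comp {A M M' M'' N N' N'' : C} {e : A ⊗ M ≅ N} {e' : A ⊗ M' ≅ N'} {e'' : A ⊗ M'' ≅ N''} {f : M ⟶ M'} {f' : M' ⟶ M''}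
    {g : N ⟶ N'} {g' : N' ⟶ N''} (hf : A ◁ f ≫ e'.hom = e.hom ≫ g) (hf' : A ◁ f' ≫ e''.hom = e'.hom ≫ g') :
    A ◁ (f ≫ f') ≫ e''.hom = e.hom ≫ g ≫ g' := by
  rw [MonoidalCategory.whiskerLeft_comp, Category.assoc, hf', reassoc_of% hf]

theorem extend_id {A M N : C} (e : A ⊗ M ≅ N) : A ◁ (𝟙 M) ≫ e.hom = e.hom ≫ 𝟙 _ := by simp

variable (X) in
/-- Powers of `X` add up. -/
def powIso (a : ℕ) : ∀ m : ℕ, pow (tensorRight X) (𝟙_ C) a ⊗ pow (tensorRight X) (𝟙_ C) m ≅ pow (tensorRight X) (𝟙_ C) (a + m)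
  | 0 => ρ_ _
  | m + 1 => extendIso (powIso a m) X

local notation "Pow" => pow (tensorRight X) (𝟙_ C)

/-- Whiskering on the left by a power renumbers the factor `i` as `a + i`. This and the lemmas built
on it describe the right-hand partition in a juxtaposition. -/
theorem shift_act (a : ℕ) : ∀ (m : ℕ) (i : Fin m), Pow a ◁ h.action.act (𝟙_ C) m i ≫ (powIso X a m).hom =
    (powIso X a (m + 1)).hom ≫ h.action.act (𝟙_ C) (a + m) (Fin.natAdd a i)
  | m + 1, i => by
    induction i using Fin.lastCases with
    | last =>
      rw [act_last]
      refine (h.extend_mul (powIso X a m)).trans (congrArg _ (h.action.act_last _ (a + m)).symm)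
    | cast i =>
      rw [act_castSucc]
      refine (h.extend_lift (shift_act a m i)).trans (congrArg _ (h.action.act_castSucc _ (a + m) (Fin.natAdd a i)).symm)

theorem shift_link (a m : ℕ) (i j : Fin m) : Pow a ◁ h.action.link (𝟙_ C) m i j ≫ (powIso X a m).hom =
    (powIso X a m).hom ≫ h.action.link (𝟙_ C) (a + m) (Fin.natAdd a i) (Fin.natAdd a j) :=
  h.extend_bridge (h.shift_act a m i) (h.shift_act a m j)

theorem shift_links (a m : ℕ) (L : List (Fin m × Fin m)) : Pow a ◁ h.action.links (𝟙_ C) m L ≫ (powIso X a m).hom =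
    (powIso X a m).hom ≫ h.action.links (𝟙_ C) (a + m) (L.map (Prod.map (Fin.natAdd a) (Fin.natAdd a))) := by
  induction L with
  | nil => exact extend_id _
  | cons p L ih => exact extend_comp (h.shift_link a m _ _) ih

theorem shift_blocks (a m : ℕ) (r : Setoid (Fin m)) : Pow a ◁ h.action.blocks (𝟙_ C) r ≫ (powIso X a m).hom =
    (powIso X a m).hom ≫ h.action.blocks (𝟙_ C) (r.map (Fin.natAdd a)) := by
  rw [blocks, shift_links, links_eq_blocks, listSetoid_map, listSetoid_relatedPairs]

theorem shift_ins (a : ℕ) {m n : ℕ} (f : Thin m n) : Pow a ◁ h.action.ins (𝟙_ C) f ≫ (powIso X a n).hom =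
    (powIso X a m).hom ≫ h.action.ins (𝟙_ C) (f.shift a) := by
  induction f with
  | nil => exact (extend_id _).trans (congrArg _ (h.action.ins_id _ a).symm)
  | keep f ih => exact extend_map ih
  | skip f ih => exact extend_comp ih (h.extend_unit _)

theorem shift_del (a : ℕ) {m n : ℕ} (f : Thin m n) : Pow a ◁ h.action.del (𝟙_ C) f ≫ (powIso X a m).hom =
    (powIso X a n).hom ≫ h.action.del (𝟙_ C) (f.shift a) := by
  induction f with
  | nil => exact (extend_id _).trans (congrArg _ (h.action.del_id _ a).symm)
  | keep f ih => exact extend_map ih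
  | skip f ih => exact extend_comp (h.extend_counit _) ih

/-- Whiskering on the right leaves the numbering unchanged; this describes the left-hand partition
in a juxtaposition. -/
theorem whiskerRight_powIso {a b : ℕ} (f : Pow a ⟶ Pow b) (k : ℕ) :
    f ▷ Pow k ≫ (powIso X b k).hom = (powIso X a k).hom ≫ padMap (𝟙_ C) f k := by
  induction k with
  | zero => exact rightUnitor_naturality f
  | succ k ih =>
    have key {A B M N N' : C} {e : A ⊗ M ≅ N} {e' : B ⊗ M ≅ N'} {f : A ⟶ B} {g : N ⟶ N'} (hf : f ▷ M ≫ e'.hom = e.hom ≫ g) :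
        f ▷ (M ⊗ X) ≫ (extendIso e' X).hom = (extendIso e X).hom ≫ g ▷ X := by
      simp only [extendIso, Iso.trans_hom, Iso.symm_hom, whiskerRightIso_hom, Category.assoc, ← comp_whiskerRight, ← hf]
      simp
    exact key ih

end
end IsSpecialCommFrobenius

namespace FrobeniusAction

section
variable {R : Type*} [CommRing R] {t : R} {C : Type*} [Category* C] [Preadditive C] [Linear R C]
  {T : C ⥤ C} (S : FrobeniusAction t T) (Z : C)

theorem elim_eq_finSum {m l N : ℕ} (hN : N = m + l) (f : Thin m N) (g : Thin l N) (hf : ∀ i, (f i : ℕ) = i)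
    (hg : ∀ j, (g j : ℕ) = m + j) : Sum.elim f g = finSumFinEquiv.trans (finCongr hN.symm) := by
  funext x
  rcases x with x | x <;> refine Fin.ext ?_ <;> simp [hf, hg]

/-- The partition `Q` acts on the right factors and afterwards `P` on the left ones. Once all
insertions precede all deletions, both act on the power `m + m' + l + l'`, and the joint blocks
restrict to the juxtaposition. -/
theorem diagram_juxt_aux {m l m' l' : ℕ} (P : Setoid (Fin m ⊕ Fin l)) (Q : Setoid (Fin m' ⊕ Fin l')) :
    (S.ins Z ((Thin.inl m' l').shift m) ≫ S.blocks Z ((Q.comap finSumFinEquiv.symm).map (Fin.natAdd m)) ≫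
      S.del Z ((Thin.inr m' l').shift m)) ≫ padMap Z (S.diagram Z P) l' = S.diagram Z (juxtSetoid P Q) := by
  have hQ := S.ins_blocks_del_congr Z (Nat.add_assoc m m' l').symm ((Thin.inl m' l').shift m) ((Thin.inr m' l').shift m)
    (Thin.inl (m + m') l') (Thin.gap m m' l')
    (fun i => by
      simp only [Thin.shift_val, Thin.inl_val]
      split_ifs <;> omega)
    (fun i => by
      simp only [Thin.shift_val, Thin.inr_val, Thin.gap, Thin.pad_val, Thin.inl_val]
      split_ifs <;> omega) ((Q.comap finSumFinEquiv.symm).map (Fin.natAdd m))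
  have hP : padMap Z (S.diagram Z P) l' = S.ins Z (Thin.gap m l l') ≫
      S.blocks Z ((P.comap finSumFinEquiv.symm).map (Fin.castAdd l')) ≫ S.del Z ((Thin.inr m l).pad l') := by
    rw [diagram, padMap_comp, padMap_comp, padMap_blocks, ← ins_pad, ← del_pad, Thin.gap]
  -- Deleting the bottom row of `Q` and inserting the top row of `P` concern different factors and
  -- may be interchanged.
  have hx : S.del Z (Thin.gap m m' l') ≫ S.ins Z (Thin.gap m l l') =
      S.ins Z ((Thin.inl (m + m') l).pad l') ≫ S.del Z ((Thin.gap m m' l).pad l') := by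
    simp only [Thin.gap, ins_pad, del_pad, ← padMap_comp, padMap_ins_inl]
  rw [hQ, hP]
  set rQ := ((Q.comap finSumFinEquiv.symm).map (Fin.natAdd m)).map (Fin.cast (Nat.add_assoc m m' l').symm) with hrQ
  set rP := (P.comap finSumFinEquiv.symm).map (Fin.castAdd l') with hrP
  have hf (i : Fin (m + m')) : ((Thin.inl (m + m') l').comp ((Thin.inl (m + m') l).pad l') i : ℕ) = i := by
    simp [Thin.pad_val]
  have hg (j : Fin (l + l')) : (((Thin.inr m l).pad l').comp ((Thin.gap m m' l).pad l') j : ℕ) = m + m' + j := by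
    simp only [Thin.comp_apply, Thin.pad_val, Thin.gap, Thin.inl_val, Thin.inr_val]
    split_ifs <;> omega
  have hN : m + m' + l + l' = (m + m') + (l + l') := by omega
  calc _ = S.ins Z ((Thin.inl (m + m') l').comp ((Thin.inl (m + m') l).pad l')) ≫
        S.blocks Z (rQ.map ((Thin.inl (m + m') l).pad l') ⊔ rP.map ((Thin.gap m m' l).pad l')) ≫
        S.del Z (((Thin.inr m l).pad l').comp ((Thin.gap m m' l).pad l')) := by
        simp only [Category.assoc]
        rw [reassoc_of% hx, ins_comp, del_comp, blocks_sup, Category.assoc, Category.assoc, reassoc_of% S.ins_blocks,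
          ← reassoc_of% S.del_blocks]
    _ = _ := by
        rw [S.diagram_eq Z hN _ _ hf hg, elim_eq_finSum hN _ _ hf hg]
        congr 1
        refine eq_of_forall_ge_iff fun s => ?_
        rw [Setoid.comap_equiv_le_iff, juxtSetoid, sup_le_iff, sup_le_iff, hrQ, hrP]
        simp only [Setoid.map_le_iff, Setoid.comap_equiv_le_iff]
        rw [and_comm]
        refine and_congr (iff_of_eq (congrArg (P ≤ ·) (Setoid.ext fun x y => ?_)))
          (iff_of_eq (congrArg (Q ≤ ·) (Setoid.ext fun x y => ?_)))
        · have key (x : Fin m ⊕ Fin l) : (Thin.gap m m' l).pad l' (Fin.castAdd l' (finSumFinEquiv x)) =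
              (finSumFinEquiv.trans (finCongr hN.symm)) (Sum.map (Fin.castAdd m') (Fin.castAdd l') x) := by
            rcases x with x | x <;> refine Fin.ext ?_ <;> simp [Thin.pad_val, Thin.gap] <;> omega
          simp only [Setoid.comap_rel, Equiv.symm_symm, key, Equiv.symm_apply_apply]
        · have key (x : Fin m' ⊕ Fin l') : (Thin.inl (m + m') l).pad l' (Fin.cast (Nat.add_assoc m m' l').symm
              (Fin.natAdd m (finSumFinEquiv x))) =
              (finSumFinEquiv.trans (finCongr hN.symm)) (Sum.map (Fin.natAdd m) (Fin.natAdd l) x) := by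
            rcases x with x | x <;> refine Fin.ext ?_ <;> simp [Thin.pad_val, Nat.add_assoc] <;> omega
          simp only [Setoid.comap_rel, Equiv.symm_symm, key, Equiv.symm_apply_apply]

end
end FrobeniusAction

namespace IsSpecialCommFrobenius
open FrobeniusAction

section
variable {R : Type*} [CommRing R] {t : R} {C : Type*} [Category* C] [Preadditive C] [Linear R C] [MonoidalCategory C]
  [MonoidalPreadditive C] [MonoidalLinear R C] {X : C} {μ : X ⊗ X ⟶ X} {Δ : X ⟶ X ⊗ X} {s : X ⊗ X ⟶ X ⊗ X}
  {η : 𝟙_ C ⟶ X} {ε : X ⟶ 𝟙_ C}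
variable (h : IsSpecialCommFrobenius t X μ Δ s η ε)

theorem diagram_juxt {m l m' l' : ℕ} (P : Setoid (Fin m ⊕ Fin l)) (Q : Setoid (Fin m' ⊕ Fin l')) :
    (h.action.diagram (𝟙_ C) P ⊗ₘ h.action.diagram (𝟙_ C) Q) ≫ (powIso X l l').hom =
      (powIso X m m').hom ≫ h.action.diagram (𝟙_ C) (juxtSetoid P Q) := by
  rw [MonoidalCategory.tensorHom_def', Category.assoc, whiskerRight_powIso, ← diagram_juxt_aux, ← Category.assoc, ← Category.assoc]
  exact congrArg (· ≫ _) (extend_comp (h.shift_ins m _) (extend_comp (h.shift_blocks _ _ _) (h.shift_del _ _)))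

end
end IsSpecialCommFrobenius

/-! ### The diagrams of the generating partitions. -/

namespace FrobeniusAction

section
variable {R : Type*} [CommRing R] {t : R} {C : Type*} [Category* C] [Preadditive C] [Linear R C]
  {T : C ⥤ C} (S : FrobeniusAction t T) (Z : C)

/-- A link between the last factor and an earlier one splits the last factor and lets one half act
on the earlier one. The concrete evaluations below start from this formula. -/
theorem bridge_mul_lift {M : C} (a : T.obj M ⟶ M) : S.bridge (S.mul M) (S.lift a) = S.comul M ≫ T.map a := by
  rw [bridge, reassoc_of% S.copair_mul_left, lift, reassoc_of% S.comul_swap]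

theorem unit_bridge_last {M : C} (a : T.obj M ⟶ M) :
    S.unit M ≫ S.bridge (S.mul M) (S.lift a) = S.copair M ≫ T.map a := by
  rw [bridge_mul_lift, copair, Category.assoc]

theorem setoid_fin_one (r : Setoid (Fin 1)) : r = ⊥ := by
  refine le_bot_iff.1 fun x y _ => ?_
  exact Subsingleton.elim x y

theorem diagram_unit : S.diagram Z (⊤ : Setoid (Fin 0 ⊕ Fin 1)) = S.unit Z := by
  rw [diagram, setoid_fin_one (Setoid.comap _ _), blocks_bot]
  change (𝟙 Z ≫ S.unit Z) ≫ 𝟙 (T.obj Z) ≫ T.map (𝟙 Z) = S.unit Z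
  simp

theorem diagram_counit : S.diagram Z (⊤ : Setoid (Fin 1 ⊕ Fin 0)) = S.counit Z := by
  rw [diagram, setoid_fin_one (Setoid.comap _ _), blocks_bot]
  change T.map (𝟙 Z) ≫ 𝟙 (T.obj Z) ≫ S.counit Z ≫ 𝟙 Z = S.counit Z
  simp

theorem diagram_id_zero : S.diagram Z (idSetoid (Fin 0)) = 𝟙 _ := by
  have : (idSetoid (Fin 0)).comap (finSumFinEquiv (m := 0) (n := 0)).symm = ⊥ :=
    le_bot_iff.1 fun x y _ => x.elim0
  rw [diagram, this, blocks_bot]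
  change 𝟙 Z ≫ 𝟙 Z ≫ 𝟙 Z = 𝟙 Z
  simp

theorem comap_finSum_eq {m l : ℕ} (P : Setoid (Fin m ⊕ Fin l)) (L : List (Fin (m + l) × Fin (m + l)))
    (h : ∀ p ∈ L, P (finSumFinEquiv.symm p.1) (finSumFinEquiv.symm p.2))
    (h' : ∀ x y, P x y → listSetoid L (finSumFinEquiv x) (finSumFinEquiv y)) :
    listSetoid L = P.comap finSumFinEquiv.symm := by
  refine le_antisymm (listSetoid_le_iff.2 h) ?_
  rw [Setoid.comap_equiv_le_iff]
  exact fun {x y} hxy => h' x y hxy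

theorem link_two_one : S.link Z 3 2 1 = S.bridge (S.mul (T.obj (T.obj Z))) (S.lift (S.mul (T.obj Z))) := by
  rw [link, show S.act Z 3 2 = S.mul (T.obj (T.obj Z)) from S.act_last Z 2,
    show S.act Z 3 1 = S.lift (S.mul (T.obj Z)) from (S.act_castSucc Z 2 1).trans (congrArg S.lift (S.act_last Z 1))]
  rfl

theorem link_one_zero : S.link Z 2 1 0 = S.bridge (S.mul (T.obj Z)) (S.lift (S.mul Z)) := by
  rw [link, show S.act Z 2 1 = S.mul (T.obj Z) from S.act_last Z 1,
    show S.act Z 2 0 = S.lift (S.mul Z) from (S.act_castSucc Z 1 0).trans (congrArg S.lift (S.act_last Z 0))]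
  rfl

theorem link_three_zero : S.link Z 4 3 0 =
    S.bridge (S.mul (T.obj (T.obj (T.obj Z)))) (S.lift (S.lift (S.lift (S.mul Z)))) := by
  rw [link, show S.act Z 4 3 = S.mul (T.obj (T.obj (T.obj Z))) from S.act_last Z 3,
    show S.act Z 4 0 = S.lift (S.lift (S.lift (S.mul Z))) from (S.act_castSucc Z 3 0).trans
      (congrArg S.lift ((S.act_castSucc Z 2 0).trans
        (congrArg S.lift ((S.act_castSucc Z 1 0).trans (congrArg S.lift (S.act_last Z 0))))))]
  rfl

/-- A concrete partition can be evaluated with any short list of pairs that generates it, in place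
of all related pairs. -/
theorem diagram_links {m l : ℕ} (P : Setoid (Fin m ⊕ Fin l)) (L : List (Fin (m + l) × Fin (m + l)))
    (h : ∀ p ∈ L, P (finSumFinEquiv.symm p.1) (finSumFinEquiv.symm p.2))
    (h' : ∀ x y, P x y → listSetoid L (finSumFinEquiv x) (finSumFinEquiv y)) :
    S.diagram Z P = S.ins Z (Thin.inl m l) ≫ S.links Z (m + l) L ≫ S.del Z (Thin.inr m l) := by
  rw [diagram, ← comap_finSum_eq P L h h', ← links_eq_blocks]

/-- A new unit is linked to the old factor and `ε` deletes the old factor: a copairing meets a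
pairing, and the snake straightens. -/
theorem diagram_id_one : S.diagram Z (idSetoid (Fin 1)) = 𝟙 _ := by
  have h0 : listSetoid [((1 : Fin 2), (0 : Fin 2))] 1 0 :=
    listSetoid_rel (L := [((1 : Fin 2), (0 : Fin 2))]) (p := (1, 0)) (by simp)
  -- The insertion and the deletion are written out in terms of `T` so that the rewriting rules for
  -- components apply.
  have key : (T.map (𝟙 Z) ≫ S.unit (T.obj Z)) ≫ (S.bridge (S.mul (T.obj Z)) (S.lift (S.mul Z)) ≫
      𝟙 (T.obj (T.obj Z))) ≫ T.map (S.counit Z ≫ 𝟙 Z) = 𝟙 _ := by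
    simp only [T.map_id, Category.id_comp, Category.comp_id]
    rw [reassoc_of% S.unit_bridge_last, reassoc_of% S.copair_mul_left, S.counit_comul]
  rw [← link_one_zero] at key
  refine (diagram_links (m := 1) (l := 1) S Z _ [((1 : Fin 2), (0 : Fin 2))] ?_ ?_).trans key
  · intro p hp
    obtain rfl := List.mem_singleton.1 hp
    rfl
  · rintro (x | x) (y | y) _ <;> obtain rfl := Subsingleton.elim 0 x <;> obtain rfl := Subsingleton.elim 0 y
    · exact Setoid.refl' _ _
    · exact Setoid.symm' _ h0
    · exact h0
    · exact Setoid.refl' _ _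

theorem listSetoid_three (x y : Fin 3) : listSetoid [((2 : Fin 3), (1 : Fin 3)), (1, 0)] x y := by
  have h (x : Fin 3) : listSetoid [((2 : Fin 3), (1 : Fin 3)), (1, 0)] x 1 := by
    fin_cases x
    · exact Setoid.symm' _ (listSetoid_rel (p := (1, 0)) (by simp))
    · exact Setoid.refl' _ _
    · exact listSetoid_rel (p := (2, 1)) (by simp)
  exact Setoid.trans' _ (h x) (Setoid.symm' _ (h y))

/-- The chain of links 2–1 and 1–0 generates the single block on three vertices. The Frobenius
relations and the counits contract the resulting composite to one merge; the case of `comul` uses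
the same chain. -/
theorem diagram_mul : S.diagram Z (⊤ : Setoid (Fin 2 ⊕ Fin 1)) = S.mul Z := by
  have key {a b : T.obj (T.obj (T.obj Z)) ⟶ T.obj (T.obj (T.obj Z))}
      (ha : a = S.bridge (S.mul (T.obj (T.obj Z))) (S.lift (S.mul (T.obj Z))))
      (hb : b = T.map (S.bridge (S.mul (T.obj Z)) (S.lift (S.mul Z)))) :
      (T.map (T.map (𝟙 Z)) ≫ S.unit (T.obj (T.obj Z))) ≫
      (a ≫ b ≫ 𝟙 (T.obj (T.obj (T.obj Z)))) ≫
      T.map (S.counit (T.obj Z) ≫ S.counit Z ≫ 𝟙 Z) = S.mul Z := by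
    simp only [T.map_id, Category.id_comp, Category.comp_id, Category.assoc]
    rw [ha, hb, reassoc_of% S.unit_bridge_last, reassoc_of% S.copair_mul_left, S.bridge_mul_lift, S.frobenius_left,
      T.map_comp_assoc, reassoc_of% S.frobenius_left, ← T.map_comp, reassoc_of% S.comul_counit, S.counit_comul,
      Category.comp_id]
  exact (diagram_links (m := 2) (l := 1) S Z _ [((2 : Fin 3), (1 : Fin 3)), (1, 0)] (fun _ _ => trivial)
    (fun _ _ _ => listSetoid_three _ _)).trans
      (key (S.link_two_one Z) ((S.map_link Z 2 1 0).symm.trans (congrArg T.map (S.link_one_zero Z))))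

theorem diagram_comul : S.diagram Z (⊤ : Setoid (Fin 1 ⊕ Fin 2)) = S.comul Z := by
  have key {a b : T.obj (T.obj (T.obj Z)) ⟶ T.obj (T.obj (T.obj Z))}
      (ha : a = S.bridge (S.mul (T.obj (T.obj Z))) (S.lift (S.mul (T.obj Z))))
      (hb : b = T.map (S.bridge (S.mul (T.obj Z)) (S.lift (S.mul Z)))) :
      ((T.map (𝟙 Z) ≫ S.unit (T.obj Z)) ≫ S.unit (T.obj (T.obj Z))) ≫
      (a ≫ b ≫ 𝟙 (T.obj (T.obj (T.obj Z)))) ≫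
      T.map (T.map (S.counit Z ≫ 𝟙 Z)) = S.comul Z := by
    simp only [T.map_id, Category.id_comp, Category.comp_id, Category.assoc]
    rw [ha, hb, reassoc_of% S.unit_bridge_last, reassoc_of% S.copair_mul_left, S.bridge_mul_lift, S.frobenius_left,
      T.map_comp_assoc, reassoc_of% S.frobenius_left, ← T.map_comp, S.counit_comul, T.map_id,
      Category.comp_id, reassoc_of% S.mul_unit]
  exact (diagram_links (m := 1) (l := 2) S Z _ [((2 : Fin 3), (1 : Fin 3)), (1, 0)] (fun _ _ => trivial)
    (fun _ _ _ => listSetoid_three _ _)).trans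
      (key (S.link_two_one Z) ((S.map_link Z 2 1 0).symm.trans (congrArg T.map (S.link_one_zero Z))))

/-- Each of the two inserted factors is tied to one old factor by a copairing. Both snakes
straighten, and the strands that had to pass each other leave one swap. -/
theorem unit_bridge_swap : S.unit (T.obj (T.obj Z)) ≫ S.unit (T.obj (T.obj (T.obj Z))) ≫
      T.map (S.bridge (S.mul (T.obj (T.obj Z))) (S.lift (S.mul (T.obj Z)))) ≫
      S.bridge (S.mul (T.obj (T.obj (T.obj Z)))) (S.lift (S.lift (S.lift (S.mul Z)))) ≫
      T.map (T.map (S.counit (T.obj Z) ≫ S.counit Z)) = S.swap Z := by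
  have h1 : S.swap (T.obj Z) ≫ T.map (S.mul Z) ≫ S.counit (T.obj Z) ≫ S.counit Z =
      T.map (S.counit (T.obj Z)) ≫ S.mul Z ≫ S.counit Z := by
    rw [reassoc_of% S.counit_nat, reassoc_of% S.swap_counit]
  have h2 : S.copair (T.obj (T.obj Z)) ≫ T.map (S.swap (T.obj Z)) =
      T.map (S.copair (T.obj Z)) ≫ S.swap (T.obj (T.obj Z)) := by
    rw [← S.map_copair_swap_swap, Category.assoc, Category.assoc, S.swap_swap, Category.comp_id]
  rw [← reassoc_of% S.unit_nat, reassoc_of% S.unit_bridge_last, reassoc_of% S.copair_mul_left,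
    reassoc_of% S.unit_bridge_last, lift.eq_1 S (S.lift (S.mul Z)), ← T.map_comp, Category.assoc, ← T.map_comp,
    lift, Category.assoc, h1]
  simp only [T.map_comp]
  rw [← T.map_comp_assoc (S.swap (T.obj (T.obj Z))), ← S.swap_nat, T.map_comp, Category.assoc,
    ← reassoc_of% S.copair_nat, reassoc_of% S.counit_comul, reassoc_of% h2, ← reassoc_of% S.swap_nat, ← S.swap_nat,
    ← T.map_comp_assoc, S.copair_mul_left, ← T.map_comp_assoc, S.counit_comul, T.map_id, Category.id_comp]

theorem diagram_swap : S.diagram Z (Setoid.ker (Sum.elim id Fin.rev) : Setoid (Fin 2 ⊕ Fin 2)) = S.swap Z := by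
  have key {a b : T.obj (T.obj (T.obj (T.obj Z))) ⟶ T.obj (T.obj (T.obj (T.obj Z)))}
      (ha : a = T.map (S.bridge (S.mul (T.obj (T.obj Z))) (S.lift (S.mul (T.obj Z)))))
      (hb : b = S.bridge (S.mul (T.obj (T.obj (T.obj Z)))) (S.lift (S.lift (S.lift (S.mul Z))))) :
      ((T.map (T.map (𝟙 Z)) ≫ S.unit (T.obj (T.obj Z))) ≫ S.unit (T.obj (T.obj (T.obj Z)))) ≫ (a ≫ b ≫ 𝟙 (T.obj (T.obj (T.obj (T.obj Z))))) ≫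
      T.map (T.map (S.counit (T.obj Z) ≫ S.counit Z ≫ 𝟙 Z)) = S.swap Z := by
    simp only [T.map_id, Category.id_comp, Category.comp_id, Category.assoc]
    rw [ha, hb]
    exact S.unit_bridge_swap Z
  -- Vertices 0, 1 form the bottom row and 2, 3 the top row, so `Fin.rev` links 2 with 1 and 3 with
  -- 0.
  refine (diagram_links (m := 2) (l := 2) S Z _ [((2 : Fin 4), (1 : Fin 4)), (3, 0)] ?_ ?_).trans
    (key ((S.map_link Z 3 2 1).symm.trans (congrArg T.map (S.link_two_one Z))) (S.link_three_zero Z))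
  · intro p hp
    rcases List.mem_cons.1 hp with rfl | hp
    · rfl
    · obtain rfl := List.mem_singleton.1 hp
      rfl
  · have h1 : listSetoid [((2 : Fin 4), (1 : Fin 4)), (3, 0)] 2 1 := listSetoid_rel (p := (2, 1)) (by simp)
    have h2 : listSetoid [((2 : Fin 4), (1 : Fin 4)), (3, 0)] 3 0 := listSetoid_rel (p := (3, 0)) (by simp)
    rintro (x | x) (y | y) h <;> fin_cases x <;> fin_cases y <;> first
      | exact Setoid.refl' _ _ | exact h1 | exact h2 | exact Setoid.symm' _ h1 | exact Setoid.symm' _ h2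
      | exact absurd (Setoid.ker_def.1 h) (by decide)

end
end FrobeniusAction

/-! ### Linearity of the tensor product in the quotient category. -/

namespace TensorQuotient

variable {R : Type*} [CommRing R] {C : Type*} [Category* C] [Preadditive C] [Linear R C]
  [MonoidalCategory C] {S : MorphismProperty C} [MonoidalPreadditive C]

instance : MonoidalPreadditive (TensorQuotient R S) where
  whiskerLeft_zero {X _ _} :=
    congrArg homMk (show 𝟙 X.as ⊗ₘ 0 = 0 by rw [id_tensorHom, MonoidalPreadditive.whiskerLeft_zero])
  zero_whiskerRight {X _ _} :=
    congrArg homMk (show 0 ⊗ₘ 𝟙 X.as = 0 by rw [tensorHom_id, MonoidalPreadditive.zero_whiskerRight])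
  whiskerLeft_add {X _ _} f g := by
    obtain ⟨f, rfl⟩ := homMk_surj f
    obtain ⟨g, rfl⟩ := homMk_surj g
    exact congrArg homMk (show 𝟙 X.as ⊗ₘ (f + g) = 𝟙 X.as ⊗ₘ f + 𝟙 X.as ⊗ₘ g by
      simp only [id_tensorHom, MonoidalPreadditive.whiskerLeft_add])
  add_whiskerRight {X _ _} f g := by
    obtain ⟨f, rfl⟩ := homMk_surj f
    obtain ⟨g, rfl⟩ := homMk_surj g
    exact congrArg homMk (show (f + g) ⊗ₘ 𝟙 X.as = f ⊗ₘ 𝟙 X.as + g ⊗ₘ 𝟙 X.as by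
      simp only [tensorHom_id, MonoidalPreadditive.add_whiskerRight])

instance [MonoidalLinear R C] : MonoidalLinear R (TensorQuotient R S) where
  whiskerLeft_smul X _ _ r f := by
    obtain ⟨f, rfl⟩ := homMk_surj f
    exact congrArg homMk (show 𝟙 X.as ⊗ₘ (r • f) = r • (𝟙 X.as ⊗ₘ f) by
      simp only [id_tensorHom, MonoidalLinear.whiskerLeft_smul])
  smul_whiskerRight r _ _ f X := by
    obtain ⟨f, rfl⟩ := homMk_surj f
    exact congrArg homMk (show (r • f) ⊗ₘ 𝟙 X.as = r • (f ⊗ₘ 𝟙 X.as) by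
      simp only [tensorHom_id, MonoidalLinear.smul_whiskerRight])

end TensorQuotient

/-! ### The strict linear monoidal functor on the partition category. -/

namespace IsSpecialCommFrobenius
open FrobeniusAction

section
variable {R : Type u} [CommRing R] {t : R} {C : Type*} [Category* C] [Preadditive C] [Linear R C] [MonoidalCategory C]
  [MonoidalPreadditive C] [MonoidalLinear R C] {X : C} {μ : X ⊗ X ⟶ X} {Δ : X ⟶ X ⊗ X} {s : X ⊗ X ⟶ X ⊗ X}
  {η : 𝟙_ C ⟶ X} {ε : X ⟶ 𝟙_ C}
variable (h : IsSpecialCommFrobenius t X μ Δ s η ε)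

local notation "Pow" => pow (tensorRight X) (𝟙_ C)

/-- The identity partition is a juxtaposition of single strands, so `diagram_juxt` reduces the claim
to `diagram_id_one`; the isomorphism of powers cancels. -/
theorem diagram_id : ∀ n : ℕ, h.action.diagram (𝟙_ C) (idSetoid (Fin n)) = 𝟙 _
  | 0 => h.action.diagram_id_zero _
  | n + 1 => by
    have key := h.diagram_juxt (idSetoid (Fin n)) (idSetoid (Fin 1))
    rw [diagram_id n, diagram_id_one, juxt_id, id_tensorHom_id, Category.id_comp] at key
    exact ((cancel_epi (powIso X n 1).hom).1 ((Category.comp_id _).trans key)).symm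

/-- The morphism given by a linear combination of partitions. -/
noncomputable def diagramMap (m l : ℕ) : (Setoid (Fin m ⊕ Fin l) →₀ R) →ₗ[R] (Pow m ⟶ Pow l) :=
  Finsupp.linearCombination R fun P => h.action.diagram (𝟙_ C) P

theorem diagramMap_single {m l : ℕ} (P : Setoid (Fin m ⊕ Fin l)) :
    h.diagramMap m l (Finsupp.single P 1) = h.action.diagram (𝟙_ C) P := by simp [diagramMap]

theorem diagramMap_comp {m l k : ℕ} (f : Setoid (Fin m ⊕ Fin l) →₀ R) (g : Setoid (Fin l ⊕ Fin k) →₀ R) :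
    h.diagramMap m k (parComp t f g) = h.diagramMap m l f ≫ h.diagramMap l k g := by
  induction f using parHom_induction with
  | zero => simp
  | add f f' hf hf' => simp [hf, hf']
  | smul r f hf => simp [hf]
  | single P =>
  induction g using parHom_induction with
  | zero => simp
  | add f f' hf hf' => simp [hf, hf']
  | smul r f hf => simp [hf]
  | single Q =>
  rw [parComp_single, single_pow, map_smul, diagramMap_single, diagramMap_single, diagramMap_single, diagram_comp]

theorem diagramMap_tensor {m l m' l' : ℕ} (f : Setoid (Fin m ⊕ Fin l) →₀ R) (g : Setoid (Fin m' ⊕ Fin l') →₀ R) :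
    (h.diagramMap m l f ⊗ₘ h.diagramMap m' l' g) ≫ (powIso X l l').hom =
      (powIso X m m').hom ≫ h.diagramMap _ _ (parTensor R f g) := by
  induction f using parHom_induction with
  | zero => simp [MonoidalCategory.tensorHom_def]
  | add f f' hf hf' => simp [MonoidalPreadditive.add_tensor, hf, hf']
  | smul r f hf =>
    rw [MonoidalCategory.tensorHom_def] at hf
    simp [MonoidalCategory.tensorHom_def, hf]
  | single P =>
  induction g using parHom_induction with
  | zero => simp [MonoidalCategory.tensorHom_def]
  | add f f' hf hf' => simp [MonoidalPreadditive.tensor_add, hf, hf']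
  | smul r f hf =>
    rw [MonoidalCategory.tensorHom_def] at hf
    simp [MonoidalCategory.tensorHom_def, hf]
  | single Q =>
  rw [parTensor_single, diagramMap_single, diagramMap_single, diagramMap_single, diagram_juxt]

end

section
variable {R : Type u} [CommRing R] {t : R} {C : Type*} [Category* C] [Preadditive C] [Linear R C] [MonoidalCategory C]
  [MonoidalPreadditive C] [MonoidalLinear R C] [IsStrictMonoidal C] {X : C} {μ : X ⊗ X ⟶ X} {Δ : X ⟶ X ⊗ X}
  {s : X ⊗ X ⟶ X ⊗ X} {η : 𝟙_ C ⟶ X} {ε : X ⟶ 𝟙_ C}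
variable (h : IsSpecialCommFrobenius t X μ Δ s η ε)

theorem _root_.CategoryTheory.Iso.inv_eq_eqToHom {A B : C} {e : A ≅ B} {p : A = B} (he : e.hom = eqToHom p) :
    e.inv = eqToHom p.symm := by
  rw [← cancel_epi e.hom, e.hom_inv_id, he]
  simp

theorem _root_.CategoryTheory.eq_eqToHom_conj {A B A' B' : C} {p : A = B} {q : A' = B'} {f : A ⟶ A'} {g : B ⟶ B'}
    (hf : f ≫ eqToHom q = eqToHom p ≫ g) : g = eqToHom p.symm ≫ f ≫ eqToHom q := by
  subst p q
  simpa using hf.symm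

theorem extendIso_eq {A M N : C} {e : A ⊗ M ≅ N} {he : A ⊗ M = N} (h' : e.hom = eqToHom he) :
    (extendIso e X).hom = eqToHom ((IsStrictMonoidal.tensor_assoc A M X).symm.trans (congrArg (· ⊗ X) he)) := by
  subst he
  simp [extendIso, h', Iso.inv_eq_eqToHom (IsStrictMonoidal.associator_hom A M X)]

variable (X) in
theorem pow_add (a : ℕ) : ∀ m : ℕ, pow (tensorRight X) (𝟙_ C) a ⊗ pow (tensorRight X) (𝟙_ C) m =
    pow (tensorRight X) (𝟙_ C) (a + m)
  | 0 => IsStrictMonoidal.tensor_unit _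
  | m + 1 => (IsStrictMonoidal.tensor_assoc _ _ X).symm.trans (congrArg (· ⊗ X) (pow_add a m))

/-- In a strict category the isomorphisms that add powers are transports along equalities, so
compatibility up to `powIso` is strict compatibility. -/
theorem powIso_eq (a : ℕ) : ∀ m : ℕ, (powIso X a m).hom = eqToHom (pow_add X a m)
  | 0 => IsStrictMonoidal.rightUnitor_hom _
  | m + 1 => extendIso_eq (powIso_eq a m)

/-- A special commutative Frobenius object of dimension `t` in a strict monoidal category determines a strict monoidal
functor on the partition category. -/
noncomputable def parFunctor : StrictLinearMonoidalFunctor R (Par t) C where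
  obj k := pow (tensorRight X) (𝟙_ C) k.n
  map {m l} f := h.diagramMap m.n l.n f
  map_id m := (h.diagramMap_single _).trans (h.diagram_id m.n)
  map_comp f g := h.diagramMap_comp f g
  map_add f g := map_add (h.diagramMap _ _) f g
  map_smul r f := map_smul (h.diagramMap _ _) r f
  obj_unit := rfl
  obj_tensor a b := (pow_add X a.n b.n).symm
  map_tensor {a b c d} f g := by
    have := h.diagramMap_tensor f g
    rw [powIso_eq, powIso_eq] at this
    exact eq_eqToHom_conj this

theorem pow_eq_tensorPow : ∀ k, pow (tensorRight X) (𝟙_ C) k = tensorPow X k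
  | 0 => rfl
  | k + 1 => congrArg (· ⊗ X) (pow_eq_tensorPow k)

theorem parFunctor_map_ofPartition {m l : ℕ} (P : Setoid (Fin m ⊕ Fin l)) :
    h.parFunctor.map (Par.ofPartition t P) = h.action.diagram (𝟙_ C) P := h.diagramMap_single P

theorem leftUnitor_whiskerRight_eq (A B : C) : (λ_ A).hom ▷ B =
    eqToHom (congrArg (· ⊗ B) (IsStrictMonoidal.unit_tensor A)) := by
  rw [IsStrictMonoidal.leftUnitor_hom, eqToHom_whiskerRight]

theorem leftUnitor_inv_whiskerRight_eq (A B : C) : (λ_ A).inv ▷ B =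
    eqToHom (congrArg (· ⊗ B) (IsStrictMonoidal.unit_tensor A)).symm :=
  Iso.inv_eq_eqToHom (e := whiskerRightIso (λ_ A) B) (leftUnitor_whiskerRight_eq A B)

theorem leftUnitor_inv_eq (A : C) : (λ_ A).inv = eqToHom (IsStrictMonoidal.unit_tensor A).symm :=
  Iso.inv_eq_eqToHom (IsStrictMonoidal.leftUnitor_hom A)

/-- The iterates of `- ⊗ X` start at the unit object, so the first power is `𝟙_ C ⊗ X`. The
components there agree with the structure morphisms of `X` up to transport. -/
theorem action_mul_tensorUnit : h.action.mul (𝟙_ C) = eqToHom (congrArg (· ⊗ X) (IsStrictMonoidal.unit_tensor X)) ≫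
    μ ≫ eqToHom (IsStrictMonoidal.unit_tensor X).symm := by
  rw [← leftUnitor_whiskerRight_eq, ← leftUnitor_inv_eq, action]
  monoidal

theorem action_comul_tensorUnit : h.action.comul (𝟙_ C) = eqToHom (IsStrictMonoidal.unit_tensor X) ≫ Δ ≫
    eqToHom (congrArg (· ⊗ X) (IsStrictMonoidal.unit_tensor X)).symm := by
  rw [← leftUnitor_inv_whiskerRight_eq, ← IsStrictMonoidal.leftUnitor_hom, action]
  monoidal

theorem action_swap_tensorUnit : h.action.swap (𝟙_ C) = eqToHom (congrArg (· ⊗ X) (IsStrictMonoidal.unit_tensor X)) ≫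
    s ≫ eqToHom (congrArg (· ⊗ X) (IsStrictMonoidal.unit_tensor X)).symm := by
  rw [← leftUnitor_inv_whiskerRight_eq, ← leftUnitor_whiskerRight_eq, action]
  monoidal

theorem action_unit_tensorUnit : h.action.unit (𝟙_ C) = η ≫ eqToHom (IsStrictMonoidal.unit_tensor X).symm := by
  rw [← leftUnitor_inv_eq, action]
  monoidal

theorem action_counit_tensorUnit : h.action.counit (𝟙_ C) = eqToHom (IsStrictMonoidal.unit_tensor X) ≫ ε := by
  rw [← IsStrictMonoidal.leftUnitor_hom, action]
  monoidal

theorem exists_parFunctor (h : IsSpecialCommFrobenius t X μ Δ s η ε) :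
    ∃ Ψ : StrictLinearMonoidalFunctor R (Par t) C, (∀ k : ℕ, Ψ.obj ⟨k⟩ = tensorPow X k) ∧
      ∃ (h₀ : Ψ.obj ⟨0⟩ = 𝟙_ C) (h₁ : Ψ.obj ⟨1⟩ = X) (h₂ : Ψ.obj ⟨2⟩ = X ⊗ X),
        Ψ.map (Par.mul t) = eqToHom h₂ ≫ μ ≫ eqToHom h₁.symm ∧
        Ψ.map (Par.comul t) = eqToHom h₁ ≫ Δ ≫ eqToHom h₂.symm ∧
        Ψ.map (Par.swap t) = eqToHom h₂ ≫ s ≫ eqToHom h₂.symm ∧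
        Ψ.map (Par.unit t) = eqToHom h₀ ≫ η ≫ eqToHom h₁.symm ∧
        Ψ.map (Par.counit t) = eqToHom h₁ ≫ ε ≫ eqToHom h₀.symm := by
  refine ⟨h.parFunctor, pow_eq_tensorPow, rfl, IsStrictMonoidal.unit_tensor X,
    congrArg (· ⊗ X) (IsStrictMonoidal.unit_tensor X), ?_, ?_, ?_, ?_, ?_⟩
  · exact (h.parFunctor_map_ofPartition _).trans ((h.action.diagram_mul _).trans h.action_mul_tensorUnit)
  · exact (h.parFunctor_map_ofPartition _).trans ((h.action.diagram_comul _).trans h.action_comul_tensorUnit)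
  · exact (h.parFunctor_map_ofPartition _).trans ((h.action.diagram_swap _).trans h.action_swap_tensorUnit)
  · exact (h.parFunctor_map_ofPartition _).trans ((h.action.diagram_unit _).trans
      (h.action_unit_tensorUnit.trans (Category.id_comp _).symm))
  · exact (h.parFunctor_map_ofPartition _).trans ((h.action.diagram_counit _).trans
      (h.action_counit_tensorUnit.trans (congrArg _ (Category.comp_id _).symm)))

end
end IsSpecialCommFrobenius

theorem mainTheorem2 {𝕜 : Type u} [CommRing 𝕜] (t : 𝕜) :
    (∃ Ψ : StrictLinearMonoidalFunctor 𝕜 (Par t) (PeisT t),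
      (∀ k : ℕ, Ψ.obj ⟨k⟩ = tensorPow (PeisT.updown t) k) ∧
      ∃ (h₀ : Ψ.obj ⟨0⟩ = 𝟙_ (PeisT t)) (h₁ : Ψ.obj ⟨1⟩ = PeisT.updown t)
        (h₂ : Ψ.obj ⟨2⟩ = PeisT.updown t ⊗ PeisT.updown t),
        Ψ.map (Par.mul t) = eqToHom h₂ ≫ PeisT.mul t ≫ eqToHom h₁.symm ∧
        Ψ.map (Par.comul t) = eqToHom h₁ ≫ PeisT.comul t ≫ eqToHom h₂.symm ∧
        Ψ.map (Par.swap t) = eqToHom h₂ ≫ PeisT.swap t ≫ eqToHom h₂.symm ∧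
        Ψ.map (Par.unit t) = eqToHom h₀ ≫ PeisT.unit t ≫ eqToHom h₁.symm ∧
        Ψ.map (Par.counit t) = eqToHom h₁ ≫ PeisT.counit t ≫ eqToHom h₀.symm) ∧
    IsSpecialCommFrobenius t (PeisT.updown t) (PeisT.mul t) (PeisT.comul t) (PeisT.swap t)
      (PeisT.unit t) (PeisT.counit t) :=
  ⟨(PeisT.isSpecialCommFrobenius t).exists_parFunctor, PeisT.isSpecialCommFrobenius t⟩
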